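/- Let $\Sigma$ be a closed Riemann surface, $(N,\langle\cdot,\cdot\rangle)$ a closed Riemannian manifold with Levi-Civita connection $\nabla$, and $u:\Sigma\to N$ a smooth branched conformal immersion, i.e. a smooth map that is a conformal immersion away from a discrete set $B$ on which $du=0$; $u$ need not be minimal. In a local complex coordinate $z=x+iy$ write $\partial_z=\frac12(\partial_x-i\partial_y)$, $u_z=\frac12(u_x-iu_y)$, $e^{2\lambda}=2|u_z|^2$, $d\Sigma=e^{2\lambda}\,dx\,dy$, and extend $\langle\cdot,\cdot\rangle$ and $\nabla$ complex (bi)linearly, with $|Z|^2=\langle Z,\overline Z\rangle$. For a smooth map $w:\Sigma\to N$ let $$\mathcal A(w)=\int_\Sigma |w_x\wedge w_y|\,dx\,dy,\qquad E(w)=\tfrac12\int_\Sigma\big(|w_x|^2+|w_y|^2\big)\,dx\,dy .$$ For $F=\mathcal A$ or $F=E$ let $dF(u)[w]$ be the derivative of $F(u_t)$ at $t=0$ along smooth families $u_t$ with $u_0=u$, $\partial_tu_t|_{t=0}=w$, and let the second variation $d^2F(u)[v,v]$ be the number $Q$ such that, for every smooth family $u_t$ with $u_0=u$ and $\partial_tu_t|_{t=0}=v$,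 $$F(u_t)=F(u)+t\,dF(u)[v]+\tfrac{t^2}{2}\Big(Q+dF(u)\big[\nabla_{\partial_t}\partial_tu_t|_{t=0}\big]\Big)+o(t^2)\qquad(t\to0),$$ that is, $d^2F(u)[v,v]=\partial_t^2|_{t=0}F(u_t)-dF(u)[\nabla_{\partial_t}\partial_tu_t|_{t=0}]$, with the second derivative taken in the sense of the second order Taylor expansion at $t=0$. Let $v\in\Gamma(u^*TN)$ be smooth and let $v=\sigma+s$, where away from $B$ the field $\sigma$ is tangential (with values in the image of $du$) and $s$ is normal (orthogonal to the image of $du$). Away from $B$ put $$\sigma^{0,1}=2e^{-2\lambda}\langle\sigma,u_z\rangle u_{\bar z},\qquad A(u_z,u_z)=(\nabla_{\partial_z}u_z)^\perp,\qquad \eta=\nabla^\top_{\partial_z}\sigma^{0,1}-2e^{-2\lambda}\langle s,A(u_z,u_z)\rangle u_{\bar z},\qquad \mu=\eta\otimes dz,$$ where $\top$ and $\perp$ denote the projections to the complexified tangent plane and to its orthogonal complement, and $|\mu|^2=|\eta|^2|dz|^2$ with $|dz|^2=2e^{-2\lambda}$. Then $|\eta|^2\,dx\,dy$ and $|\mu|^2\,d\Sigma$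 are integrable over $\Sigma$, the second variations $d^2\mathcal A(u)[v,v]$ and $d^2E(u)[v,v]$ exist, and $$d^2\mathcal A(u)[v,v]=d^2E(u)[v,v]-8\int_\Sigma|\eta|^2\,dx\,dy=d^2E(u)[v,v]-4\int_\Sigma|\mu|^2\,d\Sigma .$$ -/

import Mathlib

open scoped Manifold ContDiff Topology
open Set Filter Asymptotics MeasureTheory

namespace ConfVar

noncomputable section

/-! ### The Levi-Civita connection along maps

`N` is a smooth manifold modelled on a finite dimensional real vector space `E`, with a smooth
Riemannian metric `g`. The tangent space at `q` is identified, as everywhere in Mathlib, with `E`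
by means of the preferred chart at `q`. -/

section Target

variable {E : Type*} [NormedAddCommGroup E] [NormedSpace ℝ E]
  {N : Type*} [TopologicalSpace N] [ChartedSpace E N] [IsManifold 𝓘(ℝ, E) ∞ N]

variable (E N) in
/-- Smooth Riemannian metrics on `N`. -/
abbrev RMetric : Type _ :=
  Bundle.ContMDiffRiemannianMetric (IB := 𝓘(ℝ, E)) (n := ∞) E
    (fun q : N => TangentSpace 𝓘(ℝ, E) q)

/-- The coefficients of the metric in the preferred chart at `q`, at the coordinate point `y`. -/
def metricCoord (g : RMetric E N) (q : N) (y : E) : E →L[ℝ] E →L[ℝ] ℝ :=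
  let D : E →L[ℝ] E := mfderiv 𝓘(ℝ, E) 𝓘(ℝ, E) (extChartAt 𝓘(ℝ, E) q).symm y
  let b : E →L[ℝ] E →L[ℝ] ℝ := g.inner ((extChartAt 𝓘(ℝ, E) q).symm y)
  b.bilinearComp D D

/-- The right-hand side of the Koszul formula at `q` for coordinate vector fields of the preferred
chart at `q`:  `c ↦ (∂ₐ g(b,c) + ∂_b g(a,c) - ∂_c g(a,b)) / 2`. -/
def koszul (g : RMetric E N) (q : N) (a b : E) : E →ₗ[ℝ] ℝ :=
  let dg : E →L[ℝ] E →L[ℝ] E →L[ℝ] ℝ :=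
    fderiv ℝ (metricCoord g q) (extChartAt 𝓘(ℝ, E) q q)
  (1 / 2 : ℝ) • ((dg a b : E →ₗ[ℝ] ℝ) + (dg b a : E →ₗ[ℝ] ℝ)
    - ((dg.flip a).flip b : E →ₗ[ℝ] ℝ))

/-- The metric at a point is a perfect pairing. -/
theorem exists_inner_eq [FiniteDimensional ℝ E] (g : RMetric E N) (q : N) (l : E →ₗ[ℝ] ℝ) :
    ∃ w : TangentSpace 𝓘(ℝ, E) q, ∀ c : TangentSpace 𝓘(ℝ, E) q, g.inner q w c = l c := by
  let b : E →L[ℝ] E →L[ℝ] ℝ := g.inner q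
  let B : E →ₗ[ℝ] Module.Dual ℝ E :=
    { toFun := fun w => (b w : E →ₗ[ℝ] ℝ)
      map_add' := fun x y => by ext c; simp
      map_smul' := fun r x => by ext c; simp }
  have hinj : Function.Injective B := by
    rw [injective_iff_map_eq_zero]
    intro w hw
    by_contra hne
    have h1 : 0 < g.inner q w w := g.pos q w hne
    have h2 : B w w = 0 := by rw [hw]; rfl
    exact (ne_of_gt h1) h2
  have hsurj : Function.Surjective B :=
    (LinearMap.injective_iff_surjective_of_finrank_eq_finrank
      (Subspace.dual_finrank_eq (K := ℝ) (V := E)).symm).1 hinj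
  obtain ⟨w, hw⟩ := hsurj l
  exact ⟨w, fun c => LinearMap.congr_fun hw c⟩

/-! ### The complexified tangent spaces

A vector `a + i b` of `T_q N ⊗ ℂ` is the pair `(a, b)` of its real and its imaginary part. -/

/-- The complexified tangent space of `N` at `q`. -/
abbrev CTangent (E : Type*) [NormedAddCommGroup E] [NormedSpace ℝ E]
    {N : Type*} [TopologicalSpace N] [ChartedSpace E N] (q : N) : Type _ :=
  TangentSpace 𝓘(ℝ, E) q × TangentSpace 𝓘(ℝ, E) q

/-- Multiplication of a complexified tangent vector by a complex number. -/
def cmul {q : N} (c : ℂ) (Z : CTangent E q) : CTangent E q :=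
  (c.re • Z.1 - c.im • Z.2, c.re • Z.2 + c.im • Z.1)

/-- The complex bilinear extension `⟨Z, W⟩` of the metric. -/
def cinner (g : RMetric E N) {q : N} (Z W : CTangent E q) : ℂ :=
  ⟨g.inner q Z.1 W.1 - g.inner q Z.2 W.2, g.inner q Z.1 W.2 + g.inner q Z.2 W.1⟩

/-- The Hermitian square norm `|Z|² = ⟨Z, conj Z⟩`. -/
def cnormSq (g : RMetric E N) {q : N} (Z : CTangent E q) : ℝ :=
  g.inner q Z.1 Z.1 + g.inner q Z.2 Z.2

/-! ### Maps from the complex plane: `z = x + iy` -/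

/-- `f_x`. -/
def dX (f : ℂ → N) (z : ℂ) : TangentSpace 𝓘(ℝ, E) (f z) :=
  mfderiv 𝓘(ℝ, ℂ) 𝓘(ℝ, E) f z (1 : ℂ)

/-- `f_y`. -/
def dY (f : ℂ → N) (z : ℂ) : TangentSpace 𝓘(ℝ, E) (f z) :=
  mfderiv 𝓘(ℝ, ℂ) 𝓘(ℝ, E) f z Complex.I

/-- `f_z = (f_x - i f_y) / 2`. -/
def dZ (f : ℂ → N) (z : ℂ) : CTangent E (f z) :=
  ((1 / 2 : ℝ) • dX f z, -((1 / 2 : ℝ) • dY f z))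

/-- `f_z̄ = (f_x + i f_y) / 2`. -/
def dZbar (f : ℂ → N) (z : ℂ) : CTangent E (f z) :=
  ((1 / 2 : ℝ) • dX f z, (1 / 2 : ℝ) • dY f z)

/-- The Dirichlet energy density `(|f_x|² + |f_y|²) / 2` with respect to `dx dy`. -/
def energyDensity (g : RMetric E N) (f : ℂ → N) (z : ℂ) : ℝ :=
  (g.inner (f z) (dX f z) (dX f z) + g.inner (f z) (dY f z) (dY f z)) / 2

/-- The area density `|f_x ∧ f_y|` with respect to `dx dy`. -/
def areaDensity (g : RMetric E N) (f : ℂ → N) (z : ℂ) : ℝ :=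
  Real.sqrt (g.inner (f z) (dX f z) (dX f z) * g.inner (f z) (dY f z) (dY f z)
    - g.inner (f z) (dX f z) (dY f z) ^ 2)

/-- The conformal factor `e^{2λ} = 2 |f_z|²`. -/
def confFactor (g : RMetric E N) (f : ℂ → N) (z : ℂ) : ℝ :=
  2 * cnormSq g (dZ (E := E) f z)

/-- The projection to the `(1,0)` part of the complexified tangent plane of a conformal `f`:
`Z ↦ 2 e^{-2λ} ⟨Z, f_z̄⟩ f_z`. -/
def proj10 (g : RMetric E N) (f : ℂ → N) (z : ℂ) (Z : CTangent E (f z)) : CTangent E (f z) :=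
  cmul ((2 / confFactor g f z : ℝ) * cinner g Z (dZbar f z)) (dZ f z)

/-- The projection to the `(0,1)` part of the complexified tangent plane of a conformal `f`:
`Z ↦ 2 e^{-2λ} ⟨Z, f_z⟩ f_z̄`. -/
def proj01 (g : RMetric E N) (f : ℂ → N) (z : ℂ) (Z : CTangent E (f z)) : CTangent E (f z) :=
  cmul ((2 / confFactor g f z : ℝ) * cinner g Z (dZ f z)) (dZbar f z)

/-- The (complex linear) orthogonal projection `Z ↦ Z^⊤` to the complexified tangent plane. -/
def tanProj (g : RMetric E N) (f : ℂ → N) (z : ℂ) (Z : CTangent E (f z)) : CTangent E (f z) :=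
  proj10 g f z Z + proj01 g f z Z

/-- The (complex linear) orthogonal projection `Z ↦ Z^⊥` to the complexified normal space. -/
def norProj (g : RMetric E N) (f : ℂ → N) (z : ℂ) (Z : CTangent E (f z)) : CTangent E (f z) :=
  Z - tanProj g f z Z

variable [FiniteDimensional ℝ E]

/-- The Christoffel symbols of `g` at `q` in the preferred chart at `q`: the vector `Γ(a, b)` with
`g(Γ(a, b), c) = (∂ₐ g(b,c) + ∂_b g(a,c) - ∂_c g(a,b)) / 2` for all `c`. -/
def christoffel (g : RMetric E N) (q : N) (a b : TangentSpace 𝓘(ℝ, E) q) :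
    TangentSpace 𝓘(ℝ, E) q :=
  Classical.choose (exists_inner_eq g q (koszul g q a b))

theorem christoffel_spec (g : RMetric E N) (q : N) (a b c : TangentSpace 𝓘(ℝ, E) q) :
    g.inner q (christoffel g q a b) c = koszul g q a b c :=
  Classical.choose_spec (exists_inner_eq g q (koszul g q a b)) c

variable {X : Type*} [NormedAddCommGroup X] [NormedSpace ℝ X]

/-- The Levi-Civita covariant derivative `(∇_ξ V)(x₀)` of a vector field `V` along `f : X → N`:
in the preferred chart at `f x₀` it is `∂_ξ V + Γ(∂_ξ f, V)`. -/
def covDeriv (g : RMetric E N) (f : X → N) (V : ∀ x, TangentSpace 𝓘(ℝ, E) (f x))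
    (x₀ : X) (ξ : X) : TangentSpace 𝓘(ℝ, E) (f x₀) :=
  let Vcoord : X → E := fun x =>
    mfderiv 𝓘(ℝ, E) 𝓘(ℝ, E) (extChartAt 𝓘(ℝ, E) (f x₀)) (f x) (V x)
  let dV : TangentSpace 𝓘(ℝ, E) (f x₀) := fderiv ℝ Vcoord x₀ ξ
  dV + christoffel g (f x₀) (mfderiv 𝓘(ℝ, X) 𝓘(ℝ, E) f x₀ ξ) (V x₀)

/-- The covariant derivative `∇_{∂_z} = (∇_{∂_x} - i ∇_{∂_y}) / 2` of a complexified vector field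
along `f`, extended complex linearly. -/
def covDz (g : RMetric E N) (f : ℂ → N) (Z : ∀ z, CTangent E (f z)) (z : ℂ) : CTangent E (f z) :=
  ((1 / 2 : ℝ) • (covDeriv g f (fun w => (Z w).1) z 1
      + covDeriv g f (fun w => (Z w).2) z Complex.I),
   (1 / 2 : ℝ) • (covDeriv g f (fun w => (Z w).2) z 1
      - covDeriv g f (fun w => (Z w).1) z Complex.I))

/-- The second fundamental form `A(f_z, f_z) = (∇_{∂_z} f_z)^⊥`. -/
def secondFundZZ (g : RMetric E N) (f : ℂ → N) (z : ℂ) : CTangent E (f z) :=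
  norProj g f z (covDz g f (dZ f) z)

/-- The infinitesimal conformal defect
`η = ∇^⊤_{∂_z} σ^{0,1} - 2 e^{-2λ} ⟨s, A(f_z, f_z)⟩ f_z̄` of a tangential field `σ` and a normal
field `s` along the conformal map `f`. -/
def eta (g : RMetric E N) (f : ℂ → N) (σ s : ∀ z, TangentSpace 𝓘(ℝ, E) (f z)) (z : ℂ) :
    CTangent E (f z) :=
  tanProj g f z (covDz g f (fun w => proj01 g f w (σ w, 0)) z)
    - cmul ((2 / confFactor g f z : ℝ) * cinner g (s z, 0) (secondFundZZ g f z)) (dZbar f z)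

/-- The square norm of `μ = η ⊗ dz` with respect to the pulled back metric
`e^{2λ} (dx² + dy²)`, for which `|dz|² = |dx|² + |dy|² = 2 e^{-2λ}`. -/
def muNormSq (g : RMetric E N) (f : ℂ → N) (σ s : ∀ z, TangentSpace 𝓘(ℝ, E) (f z)) (z : ℂ) : ℝ :=
  cnormSq g (eta g f σ s z) * (2 / confFactor g f z)

end Target

/-! ### Integration over a closed Riemann surface

A density `d` on a surface is given by its coefficient `d p z` with respect to `dx dy` at the point
with coordinate `z` of the preferred chart at `p`, for every `p`. -/

section Surface

variable (S : Type*) [TopologicalSpace S] [T2Space S] [CompactSpace S] [ChartedSpace ℂ S]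

theorem exists_chartPartition :
    ∃ ρ : PartitionOfUnity S S univ, ρ.IsSubordinate fun p => (chartAt ℂ p).source :=
  PartitionOfUnity.exists_isSubordinate isClosed_univ _ (fun p => (chartAt ℂ p).open_source)
    fun p _ => mem_iUnion.2 ⟨p, mem_chart_source ℂ p⟩

/-- A partition of unity on `S` subordinate to the domains of the preferred charts. -/
def chartPartition : PartitionOfUnity S S univ :=
  Classical.choose (exists_chartPartition S)

theorem chartPartition_isSubordinate :
    (chartPartition S).IsSubordinate fun p => (chartAt ℂ p).source :=
  Classical.choose_spec (exists_chartPartition S)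

variable {S}

/-- The integral over `S` of a density (by the change of variables formula it depends neither on
the partition of unity nor on the charts). -/
def surfaceIntegral (d : S → ℂ → ℝ) : ℝ :=
  ∑ᶠ p : S, ∫ z in (chartAt ℂ p).target,
    chartPartition S p ((chartAt ℂ p).symm z) * d p z

/-- Integrability over `S` of a density. -/
def SurfaceIntegrable (d : S → ℂ → ℝ) : Prop :=
  ∀ p : S, IntegrableOn
    (fun z => chartPartition S p ((chartAt ℂ p).symm z) * d p z) (chartAt ℂ p).target

end Surface

/-! ### Area, energy, and their variations -/

section Variations

variable {S : Type*} [TopologicalSpace S] [ChartedSpace ℂ S]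
  {E : Type*} [NormedAddCommGroup E] [NormedSpace ℝ E]
  {N : Type*} [TopologicalSpace N] [ChartedSpace E N]

/-- The map `u` in the preferred coordinate at `p`. -/
def inChart (u : S → N) (p : S) (z : ℂ) : N := u ((chartAt ℂ p).symm z)

/-- `U` is a smooth one-parameter family of maps `U t : S → N`, defined for small `t`, with
`U 0 = u` and `∂_t U = v` at `t = 0`. -/
structure IsVariation (u : S → N) (v : ∀ p, TangentSpace 𝓘(ℝ, E) (u p)) (U : ℝ → S → N) :
    Prop where
  smooth : ∃ δ > 0, ContMDiffOn (𝓘(ℝ, ℝ).prod 𝓘(ℝ, ℂ)) 𝓘(ℝ, E) ∞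
    (fun x : ℝ × S => U x.1 x.2) (Ioo (-δ) δ ×ˢ univ)
  initial : U 0 = u
  velocity : ∀ p, tangentMap 𝓘(ℝ, ℝ) 𝓘(ℝ, E) (fun t => U t p) ⟨(0 : ℝ), (1 : ℝ)⟩ = ⟨u p, v p⟩

/-- `L` is the first variation `dF(u)[w]`: the derivative of `F` at `u` along any smooth family
with initial velocity `w`. (Every smooth field `w` along `u` is such a velocity, for instance of
`exp_u (t w)`, so `L` is unique.) -/
def IsFirstVariation (F : (S → N) → ℝ) (u : S → N) (w : ∀ p, TangentSpace 𝓘(ℝ, E) (u p))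
    (L : ℝ) : Prop :=
  ∀ U : ℝ → S → N, IsVariation u w U → HasDerivAt (fun t => F (U t)) L 0

variable [IsManifold 𝓘(ℝ, E) ∞ N]

/-- The set of points at which the differential vanishes. -/
def branchSet (E : Type*) [NormedAddCommGroup E] [NormedSpace ℝ E] {N : Type*}
    [TopologicalSpace N] [ChartedSpace E N] (u : S → N) : Set S :=
  {p | mfderiv 𝓘(ℝ, ℂ) 𝓘(ℝ, E) u p = 0}

/-- `u` is a branched conformal immersion: a smooth map which is a conformal immersion away from
a discrete set where `du` vanishes. (The preferred chart at `p` identifies `T_p S` with `ℂ`.) -/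
structure IsBranchedConformalImmersion (g : RMetric E N) (u : S → N) : Prop where
  smooth : ContMDiff 𝓘(ℝ, ℂ) 𝓘(ℝ, E) ∞ u
  discrete : IsDiscrete (branchSet E u)
  conformal : ∀ p ∉ branchSet E u, ∃ c : ℝ, 0 < c ∧ ∀ a b : ℂ,
    g.inner (u p) (mfderiv 𝓘(ℝ, ℂ) 𝓘(ℝ, E) u p a) (mfderiv 𝓘(ℝ, ℂ) 𝓘(ℝ, E) u p b)
      = c * (a * (starRingEnd ℂ) b).re

/-- `v = σ + s` with, away from the branch points, `σ` tangential and `s` normal. -/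
structure IsTangentNormalDecomposition (g : RMetric E N) (u : S → N)
    (v σ s : ∀ p, TangentSpace 𝓘(ℝ, E) (u p)) : Prop where
  sum : ∀ p, v p = σ p + s p
  tangential : ∀ p ∉ branchSet E u, ∃ a : ℂ, σ p = mfderiv 𝓘(ℝ, ℂ) 𝓘(ℝ, E) u p a
  normal : ∀ p ∉ branchSet E u, ∀ a : ℂ,
    g.inner (u p) (s p) (mfderiv 𝓘(ℝ, ℂ) 𝓘(ℝ, E) u p a) = 0

section Functionals

variable [T2Space S] [CompactSpace S]

/-- The Dirichlet energy `E(u) = 1/2 ∫ (|u_x|² + |u_y|²) dx dy`. -/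
def energy (g : RMetric E N) (u : S → N) : ℝ :=
  surfaceIntegral fun p z => energyDensity g (inChart u p) z

/-- The area `A(u) = ∫ |u_x ∧ u_y| dx dy`. -/
def area (g : RMetric E N) (u : S → N) : ℝ :=
  surfaceIntegral fun p z => areaDensity g (inChart u p) z

end Functionals

variable [FiniteDimensional ℝ E]

/-- The acceleration `∇_{∂_t} ∂_t U` at `t = 0`, a vector field along `U 0`. -/
def acceleration (g : RMetric E N) (U : ℝ → S → N) (p : S) : TangentSpace 𝓘(ℝ, E) (U 0 p) :=
  covDeriv g (fun t : ℝ => U t p)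
    (fun t => mfderiv 𝓘(ℝ, ℝ) 𝓘(ℝ, E) (fun t : ℝ => U t p) t (1 : ℝ)) 0 1

/-- `Q` is the second variation (Hessian) `d²F(u)[v,v] = ∂_t² F(u_t) - dF(u)[∇_{∂_t} ∂_t u_t]` at
`t = 0`, for every smooth family `u_t` with `u_0 = u` and initial velocity `v`. Here the second
derivative is the coefficient of `t² / 2` in the second order Taylor expansion at `t = 0`: at a
branched map the area of `u_t` has such an expansion, but it need not be differentiable at all
small `t ≠ 0`. -/
def IsSecondVariation (g : RMetric E N) (F : (S → N) → ℝ) (u : S → N)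
    (v : ∀ p, TangentSpace 𝓘(ℝ, E) (u p)) (Q : ℝ) : Prop :=
  ∀ U : ℝ → S → N, IsVariation u v U → ∃ L L' : ℝ,
    IsFirstVariation F u v L ∧ IsFirstVariation F (U 0) (acceleration g U) L' ∧
    (fun t : ℝ => F (U t) - (F u + t * L + t ^ 2 / 2 * (Q + L'))) =o[𝓝 0] fun t : ℝ => t ^ 2

/-- The density `|η|² dx dy`. -/
def etaDensity (g : RMetric E N) (u : S → N) (σ s : ∀ p, TangentSpace 𝓘(ℝ, E) (u p))
    (p : S) (z : ℂ) : ℝ :=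
  cnormSq g (eta g (inChart u p) (fun w => σ ((chartAt ℂ p).symm w))
    (fun w => s ((chartAt ℂ p).symm w)) z)

/-- The density `|μ|² dΣ`, where `dΣ = e^{2λ} dx dy` is the area element of the pulled back
metric. -/
def muDensity (g : RMetric E N) (u : S → N) (σ s : ∀ p, TangentSpace 𝓘(ℝ, E) (u p))
    (p : S) (z : ℂ) : ℝ :=
  muNormSq g (inChart u p) (fun w => σ ((chartAt ℂ p).symm w))
    (fun w => s ((chartAt ℂ p).symm w)) z * confFactor g (inChart u p) z

end Variations

end

end ConfVar

/-! The comparison of area and energy is pointwise. For a map w put e = (|w_x|² + |w_y|²)/2, h₁ =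
(|w_x|² - |w_y|²)/2 and h₂ = ⟨w_x, w_y⟩. The energy density is e, the Gram determinant turns the
area density into √(e² - h₁² - h₂²), and Cauchy–Schwarz reads h₁² + h₂² ≤ e². Along a family
starting at the conformal map u both h₁ and h₂ vanish at t = 0. With k₁, k₂ their t-derivatives
there, energy density minus area density is t² (k₁² + k₂²)/(2e) + o(t²) wherever e > 0
(`tendsto_sub_sqrt`).

Since h₁ - i h₂ = 2⟨w_z, w_z⟩, one has k₁ - i k₂ = 4⟨∇_z v, u_z⟩. On the other hand η = 2e^{-2λ}⟨∇_z
v, u_z⟩ u_z̄: the second fundamental form in the definition of η cancels exactly what the normal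
part s contributes to the derivative of σ^{0,1}. Hence |η|² = (k₁² + k₂²)/(8e)
(`LocalVariation.cnormSq_eta`). The coefficient of t² is therefore 4|η|², and the normalisation t²/2
of the second variation makes it 8|η|².

The difficulty is at branch points, where e = 0 and the square root is not smooth. A nonnegative e
with bounded second derivative satisfies |∂_t e| ≤ C√e, and |h_i| ≤ e then forces |k_i| ≤ C√e as
well. Distinguishing whether √e is small or large compared with |t| gives e - √(e² - h₁² - h₂²) ≤ C
t², with C uniform on compact sets (`sub_sqrt_le_sq`, `exists_defect_bound`). This bound is used
twice: it makes |η|² locally bounded, hence integrable, and it is the majorant that allows the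
pointwise expansion, valid off the countable branch set, to be integrated
(`IsCutoff.sqrt_expansion`).

The defect being of second order, area and energy have the same first variation at u, so their
acceleration corrections agree. It remains to see that the Hessian of the energy is well defined:
for two families with the same velocity, the second derivatives of the induced metric differ by its
first variation in the direction of the difference of accelerations
(`LocalVariation.dt_dt_pullback_sub`). The Hessian is then read off from one family
(`exists_energyHessian`), and no global family ever has to be constructed. -/

namespace ConfVar

set_option linter.unusedSectionVars false

noncomputable section

/-! ### The metric and differentials in the preferred charts. -/

section Coordinates

variable {E : Type*} [NormedAddCommGroup E] [NormedSpace ℝ E]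
  {N : Type*} [TopologicalSpace N] [ChartedSpace E N]
  {X : Type*} [NormedAddCommGroup X] [NormedSpace ℝ X]

/-- The differential at `n` of the preferred chart at `q`, as a map of the model space. -/
def chartDeriv (q n : N) : E →L[ℝ] E := mfderiv 𝓘(ℝ, E) 𝓘(ℝ, E) (extChartAt 𝓘(ℝ, E) q) n

variable (E) in
/-- The differential of a map from a vector space, as a map into the model space. -/
def mapDeriv (f : X → N) (x : X) : X →L[ℝ] E := mfderiv 𝓘(ℝ, X) 𝓘(ℝ, E) f x

variable [IsManifold 𝓘(ℝ, E) ∞ N]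

variable (E N) in
theorem isManifold_one : IsManifold 𝓘(ℝ, E) 1 N := IsManifold.of_le (n := ∞) (by simp)

/-- The metric at a point as a bilinear form on the model space. -/
def innerAt (g : RMetric E N) (q : N) : E →L[ℝ] E →L[ℝ] ℝ := g.inner q

theorem innerAt_symm (g : RMetric E N) (q : N) (a b : E) : innerAt g q a b = innerAt g q b a :=
  g.symm q a b

theorem innerAt_nonneg (g : RMetric E N) (q : N) (a : E) : 0 ≤ innerAt g q a a := by
  by_cases h : a = 0
  · simp [h]
  · exact (g.pos q a h).le

theorem chartDeriv_self (q : N) : chartDeriv (E := E) q q = ContinuousLinearMap.id ℝ E := by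
  have := isManifold_one E N
  exact mfderiv_extChartAt_self

/-- The derivative of the inverse of a chart is a left inverse of the derivative of the chart. -/
theorem mapDeriv_symm_chartDeriv {q n : N} (hn : n ∈ (chartAt E q).source) (a : E) :
    mapDeriv E (extChartAt 𝓘(ℝ, E) q).symm (extChartAt 𝓘(ℝ, E) q n) (chartDeriv q n a) = a := by
  have := isManifold_one E N
  have hn' : n ∈ (extChartAt 𝓘(ℝ, E) q).source := by simpa using hn
  have key := mfderivWithin_extChartAt_symm_comp_mfderiv_extChartAt' (I := 𝓘(ℝ, E)) hn'
  simp only [ModelWithCorners.range_eq_univ, mfderivWithin_univ] at key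
  exact DFunLike.congr_fun key a

theorem metricCoord_eq (g : RMetric E N) (q : N) (y a b : E) :
    metricCoord g q y a b = innerAt g ((extChartAt 𝓘(ℝ, E) q).symm y)
      (mapDeriv E (extChartAt 𝓘(ℝ, E) q).symm y a)
      (mapDeriv E (extChartAt 𝓘(ℝ, E) q).symm y b) := rfl

theorem metricCoord_chartDeriv (g : RMetric E N) {q n : N} (hn : n ∈ (chartAt E q).source)
    (a b : E) : metricCoord g q (extChartAt 𝓘(ℝ, E) q n) (chartDeriv q n a) (chartDeriv q n b)
      = innerAt g n a b := by
  have hn' : n ∈ (extChartAt 𝓘(ℝ, E) q).source := by simpa using hn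
  rw [metricCoord_eq, mapDeriv_symm_chartDeriv hn, mapDeriv_symm_chartDeriv hn,
    (extChartAt 𝓘(ℝ, E) q).left_inv hn']

theorem metricCoord_self (g : RMetric E N) (q : N) (a b : E) :
    metricCoord g q (extChartAt 𝓘(ℝ, E) q q) a b = innerAt g q a b := by
  simpa [chartDeriv_self] using metricCoord_chartDeriv g (mem_chart_source E q) a b

/-- The bridge between intrinsic differentials and ordinary derivatives in a fixed chart, in which
all smoothness and symmetry arguments are made. -/
theorem fderiv_extChartAt_comp {f : X → N} {x : X} {q : N}
    (hf : MDifferentiableAt 𝓘(ℝ, X) 𝓘(ℝ, E) f x) (hx : f x ∈ (chartAt E q).source) (ξ : X) :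
    fderiv ℝ (fun y => extChartAt 𝓘(ℝ, E) q (f y)) x ξ
      = chartDeriv q (f x) (mapDeriv E f x ξ) := by
  have := isManifold_one E N
  have h := (mdifferentiableAt_extChartAt (I := 𝓘(ℝ, E)) hx).hasMFDerivAt.comp x hf.hasMFDerivAt
  have h2 : HasFDerivAt (fun y => extChartAt 𝓘(ℝ, E) q (f y))
    ((chartDeriv q (f x)).comp (mapDeriv E f x)) x := hasMFDerivAt_iff_hasFDerivAt.1 h
  rw [h2.fderiv]
  rfl

theorem metricCoord_symm (g : RMetric E N) (q : N) (y a b : E) :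
    metricCoord g q y a b = metricCoord g q y b a :=
  innerAt_symm g _ _ _

theorem contMDiffOn_mapDeriv_symm (q : N) (a : E) :
    ContMDiffOn 𝓘(ℝ, E) 𝓘(ℝ, E).tangent ∞ (fun y : E =>
      (⟨(extChartAt 𝓘(ℝ, E) q).symm y, mapDeriv E (extChartAt 𝓘(ℝ, E) q).symm y a⟩ :
        TangentBundle 𝓘(ℝ, E) N)) (extChartAt 𝓘(ℝ, E) q).target := by
  have h1 : ContMDiffOn 𝓘(ℝ, E).tangent 𝓘(ℝ, E).tangent ∞ _ _ :=
    (contMDiffOn_extChartAt_symm (I := 𝓘(ℝ, E)) (n := ∞) q).contMDiffOn_tangentMapWithin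
      (m := ∞) (by simp) (isOpen_extChartAt_target q).uniqueMDiffOn
  have h2 : ContMDiff 𝓘(ℝ, E) 𝓘(ℝ, E).tangent ∞
      (fun y : E => (⟨y, a⟩ : TangentBundle 𝓘(ℝ, E) E)) :=
    contMDiff_vectorSpace_iff_contDiff.2 contDiff_const
  refine (h1.comp h2.contMDiffOn (s := (extChartAt 𝓘(ℝ, E) q).target) fun y hy => hy).congr
    fun y hy => ?_
  simp only [Function.comp, tangentMapWithin]
  rw [mfderivWithin_of_isOpen (isOpen_extChartAt_target q) hy]
  rfl

/-- In finite dimension smoothness may be tested on fixed vectors a, b, which become smooth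
coordinate fields on which the smooth metric is evaluated. -/
theorem contDiffOn_metricCoord [FiniteDimensional ℝ E] (g : RMetric E N) (q : N) :
    ContDiffOn ℝ ∞ (metricCoord g q) (extChartAt 𝓘(ℝ, E) q).target := by
  refine contDiffOn_clm_apply.2 fun a => contDiffOn_clm_apply.2 fun b => ?_
  rw [← contMDiffOn_iff_contDiffOn]
  intro y hy
  have hsymm := contMDiffOn_extChartAt_symm (I := 𝓘(ℝ, E)) (n := ∞) q y hy
  have h := ContMDiffWithinAt.clm_bundle_apply₂ (F₁ := E) (F₂ := E) (F₃ := ℝ)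
    (E₃ := Bundle.Trivial N ℝ) (g.contMDiff.contMDiffAt.comp_contMDiffWithinAt y hsymm)
    (contMDiffOn_mapDeriv_symm q a y hy) (contMDiffOn_mapDeriv_symm q b y hy)
  simp only [Bundle.contMDiffWithinAt_totalSpace] at h
  exact h.2

end Coordinates

/-! ### The connection: symmetry and compatibility with the metric. -/

section LeviCivita

variable {E : Type*} [NormedAddCommGroup E] [NormedSpace ℝ E] [FiniteDimensional ℝ E]
  {N : Type*} [TopologicalSpace N] [ChartedSpace E N] [IsManifold 𝓘(ℝ, E) ∞ N]
  {X : Type*} [NormedAddCommGroup X] [NormedSpace ℝ X]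

/-- The Christoffel symbols as a map of the model space. -/
def christoffelAt (g : RMetric E N) (q : N) (a b : E) : E := christoffel g q a b

/-- The covariant derivative along a map as a map into the model space. -/
def covAt (g : RMetric E N) (f : X → N) (V : X → E) (x ξ : X) : E := covDeriv g f V x ξ

theorem covAt_eq (g : RMetric E N) (f : X → N) (V : X → E) (x ξ : X) :
    covAt g f V x ξ = fderiv ℝ (fun y => chartDeriv (f x) (f y) (V y)) x ξ
      + christoffelAt g (f x) (mapDeriv E f x ξ) (V x) := rfl

theorem innerAt_christoffelAt (g : RMetric E N) (q : N) (a b c : E) :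
    innerAt g q (christoffelAt g q a b) c =
      1 / 2 * (fderiv ℝ (metricCoord g q) (extChartAt 𝓘(ℝ, E) q q) a b c
        + fderiv ℝ (metricCoord g q) (extChartAt 𝓘(ℝ, E) q q) b a c
        - fderiv ℝ (metricCoord g q) (extChartAt 𝓘(ℝ, E) q q) c a b) :=
  christoffel_spec g q a b c

theorem differentiableAt_metricCoord (g : RMetric E N) (q : N) {y : E}
    (hy : y ∈ (extChartAt 𝓘(ℝ, E) q).target) : DifferentiableAt ℝ (metricCoord g q) y :=
  ((contDiffOn_metricCoord g q).contDiffAt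
    ((isOpen_extChartAt_target q).mem_nhds hy)).differentiableAt (by simp)

theorem fderiv_metricCoord_symm (g : RMetric E N) (q : N) (a b c : E) :
    fderiv ℝ (metricCoord g q) (extChartAt 𝓘(ℝ, E) q q) a b c
      = fderiv ℝ (metricCoord g q) (extChartAt 𝓘(ℝ, E) q q) a c b := by
  have hd := (differentiableAt_metricCoord g q (mem_extChartAt_target q)).hasFDerivAt
  have h1 : ∀ b c : E, HasFDerivAt (fun y => metricCoord g q y b c) _ _ := fun b c =>
    (hd.clm_apply (hasFDerivAt_const b _)).clm_apply (hasFDerivAt_const c _)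
  have h2 := DFunLike.congr_fun ((h1 b c).unique
    ((h1 c b).congr_of_eventuallyEq (Eventually.of_forall fun y => metricCoord_symm g q y b c))) a
  simpa using h2

theorem christoffelAt_symm (g : RMetric E N) (q : N) (a b : E) :
    christoffelAt g q a b = christoffelAt g q b a := by
  have h : koszul g q a b = koszul g q b a := by
    refine LinearMap.ext fun c => ?_
    have h := fderiv_metricCoord_symm g q c a b
    simp only [koszul, LinearMap.smul_apply, LinearMap.sub_apply, LinearMap.add_apply,
      ContinuousLinearMap.coe_coe, ContinuousLinearMap.flip_apply, h]
    ring_nf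
  -- The Christoffel vector is a choice, but equal Koszul forms give equal predicates and hence the
  -- same chosen vector.
  unfold christoffelAt christoffel
  congr 1
  funext w
  rw [h]

/-- The metric is parallel. -/
theorem hasFDerivAt_innerAt (g : RMetric E N) {f : X → N} {V W : X → E} {x : X}
    (hf : MDifferentiableAt 𝓘(ℝ, X) 𝓘(ℝ, E) f x)
    (hV : DifferentiableAt ℝ (fun y => chartDeriv (f x) (f y) (V y)) x)
    (hW : DifferentiableAt ℝ (fun y => chartDeriv (f x) (f y) (W y)) x) :
    DifferentiableAt ℝ (fun y => innerAt g (f y) (V y) (W y)) x ∧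
    ∀ ξ, fderiv ℝ (fun y => innerAt g (f y) (V y) (W y)) x ξ
      = innerAt g (f x) (covAt g f V x ξ) (W x) + innerAt g (f x) (V x) (covAt g f W x ξ) := by
  have := isManifold_one E N
  set q := f x with hq
  have hF : DifferentiableAt ℝ (fun y => extChartAt 𝓘(ℝ, E) q (f y)) x := by
    have h := (mdifferentiableAt_extChartAt (I := 𝓘(ℝ, E)) (mem_chart_source E q)).comp x hf
    exact mdifferentiableAt_iff_differentiableAt.1 h
  have hev : ∀ᶠ y in 𝓝 x, f y ∈ (chartAt E q).source :=
    hf.continuousAt.eventually ((chartAt E q).open_source.mem_nhds (mem_chart_source E q))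
  have heq : (fun y => innerAt g (f y) (V y) (W y)) =ᶠ[𝓝 x]
      fun y => metricCoord g q (extChartAt 𝓘(ℝ, E) q (f y)) (chartDeriv q (f y) (V y))
        (chartDeriv q (f y) (W y)) := by
    filter_upwards [hev] with y hy
    rw [metricCoord_chartDeriv g hy]
  have hG0 : HasFDerivAt (metricCoord g q)
      (fderiv ℝ (metricCoord g q) (extChartAt 𝓘(ℝ, E) q q)) (extChartAt 𝓘(ℝ, E) q (f x)) :=
    (differentiableAt_metricCoord g q (mem_extChartAt_target q)).hasFDerivAt
  have hG := HasFDerivAt.comp (g := metricCoord g q) (f := fun y => extChartAt 𝓘(ℝ, E) q (f y)) x hG0 hF.hasFDerivAt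
  have hd := ((hG.clm_apply hV.hasFDerivAt).clm_apply hW.hasFDerivAt).congr_of_eventuallyEq heq
  refine ⟨hd.differentiableAt, fun ξ => ?_⟩
  rw [hd.fderiv]
  have hxi := fderiv_extChartAt_comp (q := q) hf (mem_chart_source E q) ξ
  simp only [← hq, chartDeriv_self, ContinuousLinearMap.id_apply] at hxi
  -- In the sum of the two Koszul expressions the terms differentiating along V and W cancel, up to
  -- symmetry of the metric, and ∂_ξ g(V, W) remains.
  have c1 := innerAt_christoffelAt g q (mapDeriv E f x ξ) (V x) (W x)
  have c2 := innerAt_christoffelAt g q (mapDeriv E f x ξ) (W x) (V x)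
  rw [innerAt_symm] at c2
  simp only [covAt_eq, ← hq, map_add, add_apply, ContinuousLinearMap.comp_apply,
    ContinuousLinearMap.flip_apply, Function.comp_apply, chartDeriv_self,
    ContinuousLinearMap.id_apply, hxi, metricCoord_self, c1, c2]
  have e1 := fderiv_metricCoord_symm g q (mapDeriv E f x ξ) (W x) (V x)
  have e2 := fderiv_metricCoord_symm g q (V x) (mapDeriv E f x ξ) (W x)
  have e3 := fderiv_metricCoord_symm g q (W x) (mapDeriv E f x ξ) (V x)
  have e4 := fderiv_metricCoord_symm g q (V x) (W x) (mapDeriv E f x ξ)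
  have e5 := fderiv_metricCoord_symm g q (W x) (V x) (mapDeriv E f x ξ)
  linarith

end LeviCivita

/-! ### The pulled back metric and vanishing torsion. -/

section SmoothMaps

variable {E : Type*} [NormedAddCommGroup E] [NormedSpace ℝ E] [FiniteDimensional ℝ E]
  {N : Type*} [TopologicalSpace N] [ChartedSpace E N] [IsManifold 𝓘(ℝ, E) ∞ N]
  {X : Type*} [NormedAddCommGroup X] [NormedSpace ℝ X]
  {W : X → N} {O : Set X}

theorem mdifferentiableAt_of_contMDiffOn (hO : IsOpen O)
    (hW : ContMDiffOn 𝓘(ℝ, X) 𝓘(ℝ, E) ∞ W O) {x : X} (hx : x ∈ O) :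
    MDifferentiableAt 𝓘(ℝ, X) 𝓘(ℝ, E) W x :=
  (hW.contMDiffAt (hO.mem_nhds hx)).mdifferentiableAt (by simp)

theorem isOpen_inter_preimage_source (hO : IsOpen O)
    (hW : ContMDiffOn 𝓘(ℝ, X) 𝓘(ℝ, E) ∞ W O) (q : N) :
    IsOpen (O ∩ W ⁻¹' (chartAt E q).source) :=
  hW.continuousOn.isOpen_inter_preimage hO (chartAt E q).open_source

theorem contDiffOn_extChartAt_comp
    (hW : ContMDiffOn 𝓘(ℝ, X) 𝓘(ℝ, E) ∞ W O) (q : N) :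
    ContDiffOn ℝ ∞ (fun y => extChartAt 𝓘(ℝ, E) q (W y)) (O ∩ W ⁻¹' (chartAt E q).source) := by
  rw [← contMDiffOn_iff_contDiffOn]
  exact (contMDiffOn_extChartAt (I := 𝓘(ℝ, E)) (n := ∞) (x := q)).comp
    (hW.mono inter_subset_left) fun y hy => hy.2

theorem contDiffOn_fderiv_apply {Y : Type*} [NormedAddCommGroup Y] [NormedSpace ℝ Y]
    {F : X → Y} {O : Set X} (hO : IsOpen O)
    (hF : ContDiffOn ℝ ∞ F O) (a : X) : ContDiffOn ℝ ∞ (fun y => fderiv ℝ F y a) O :=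
  (hF.fderiv_of_isOpen hO (m := ∞) (by simp)).clm_apply contDiffOn_const

theorem contDiffOn_chartDeriv_mapDeriv (hO : IsOpen O)
    (hW : ContMDiffOn 𝓘(ℝ, X) 𝓘(ℝ, E) ∞ W O) (q : N) (a : X) :
    ContDiffOn ℝ ∞ (fun y => chartDeriv q (W y) (mapDeriv E W y a))
      (O ∩ W ⁻¹' (chartAt E q).source) := by
  refine (contDiffOn_fderiv_apply (isOpen_inter_preimage_source hO hW q)
    (contDiffOn_extChartAt_comp hW q) a).congr fun y hy => ?_
  rw [fderiv_extChartAt_comp (mdifferentiableAt_of_contMDiffOn hO hW hy.1) hy.2]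

theorem differentiableAt_chartDeriv_mapDeriv (hO : IsOpen O)
    (hW : ContMDiffOn 𝓘(ℝ, X) 𝓘(ℝ, E) ∞ W O) {x : X} (hx : x ∈ O) (a : X) :
    DifferentiableAt ℝ (fun y => chartDeriv (W x) (W y) (mapDeriv E W y a)) x :=
  ((contDiffOn_chartDeriv_mapDeriv hO hW (W x) a).contDiffAt
    ((isOpen_inter_preimage_source hO hW (W x)).mem_nhds
      ⟨hx, mem_chart_source E (W x)⟩)).differentiableAt (by simp)

/-- The coefficients `⟨∂_a W, ∂_b W⟩` of the pulled back metric. -/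
def pullback (g : RMetric E N) (W : X → N) (a b : X) (x : X) : ℝ :=
  innerAt g (W x) (mapDeriv E W x a) (mapDeriv E W x b)

theorem contDiffOn_pullback (g : RMetric E N) (hO : IsOpen O)
    (hW : ContMDiffOn 𝓘(ℝ, X) 𝓘(ℝ, E) ∞ W O) (a b : X) :
    ContDiffOn ℝ ∞ (pullback g W a b) O := by
  intro x hx
  have hO' := isOpen_inter_preimage_source hO hW (W x)
  have hx' : x ∈ O ∩ W ⁻¹' (chartAt E (W x)).source := ⟨hx, mem_chart_source E (W x)⟩
  have h : ContDiffOn ℝ ∞ (pullback g W a b) (O ∩ W ⁻¹' (chartAt E (W x)).source) := by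
    have h1 := (contDiffOn_metricCoord g (W x)).comp (contDiffOn_extChartAt_comp hW (W x))
      fun y hy => (extChartAt 𝓘(ℝ, E) (W x)).map_source (by simpa using hy.2)
    refine ((h1.clm_apply (contDiffOn_chartDeriv_mapDeriv hO hW (W x) a)).clm_apply
      (contDiffOn_chartDeriv_mapDeriv hO hW (W x) b)).congr fun y hy => ?_
    rw [Function.comp, metricCoord_chartDeriv g hy.2, pullback]
  exact (h.contDiffAt (hO'.mem_nhds hx')).contDiffWithinAt

theorem fderiv_fderiv_comm {F : X → E} {O : Set X} (hO : IsOpen O)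
    (hF : ContDiffOn ℝ ∞ F O) {x : X} (hx : x ∈ O) (a b : X) :
    fderiv ℝ (fun y => fderiv ℝ F y a) x b = fderiv ℝ (fun y => fderiv ℝ F y b) x a := by
  have h1 : DifferentiableAt ℝ (fderiv ℝ F) x :=
    ((hF.fderiv_of_isOpen hO (m := ∞) (by simp)).contDiffAt
      (hO.mem_nhds hx)).differentiableAt (by simp)
  have h2 : IsSymmSndFDerivAt ℝ F x :=
    (hF.contDiffAt (hO.mem_nhds hx)).isSymmSndFDerivAt (by simp; norm_cast)
  have h3 : ∀ a b : X, fderiv ℝ (fun y => fderiv ℝ F y a) x b = fderiv ℝ (fderiv ℝ F) x b a :=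
    fun a b => by
      rw [(h1.hasFDerivAt.clm_apply (hasFDerivAt_const a x)).fderiv]
      simp
  rw [h3, h3, h2]

/-- The Levi-Civita connection is torsion free. -/
theorem covAt_mapDeriv_comm (g : RMetric E N) (hO : IsOpen O)
    (hW : ContMDiffOn 𝓘(ℝ, X) 𝓘(ℝ, E) ∞ W O) {x : X} (hx : x ∈ O) (a b : X) :
    covAt g W (fun y => mapDeriv E W y a) x b = covAt g W (fun y => mapDeriv E W y b) x a := by
  have hO' := isOpen_inter_preimage_source hO hW (W x)
  have hx' : x ∈ O ∩ W ⁻¹' (chartAt E (W x)).source := ⟨hx, mem_chart_source E (W x)⟩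
  have h : ∀ a : X, (fun y => chartDeriv (W x) (W y) (mapDeriv E W y a)) =ᶠ[𝓝 x]
      fun y => fderiv ℝ (fun y => extChartAt 𝓘(ℝ, E) (W x) (W y)) y a := fun a => by
    filter_upwards [hO'.mem_nhds hx'] with y hy
    rw [fderiv_extChartAt_comp (mdifferentiableAt_of_contMDiffOn hO hW hy.1) hy.2]
  rw [covAt_eq, covAt_eq, christoffelAt_symm, (h a).fderiv_eq, (h b).fderiv_eq,
    fderiv_fderiv_comm hO' (contDiffOn_extChartAt_comp hW (W x)) hx']

/-- The derivative of the pulled back metric. -/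
theorem fderiv_pullback (g : RMetric E N) (hO : IsOpen O)
    (hW : ContMDiffOn 𝓘(ℝ, X) 𝓘(ℝ, E) ∞ W O) {x : X} (hx : x ∈ O) (a b c : X) :
    fderiv ℝ (pullback g W a b) x c
      = innerAt g (W x) (covAt g W (fun y => mapDeriv E W y c) x a) (mapDeriv E W x b)
        + innerAt g (W x) (mapDeriv E W x a) (covAt g W (fun y => mapDeriv E W y c) x b) := by
  -- Metric compatibility produces ∇_c of ∂_a W and ∂_b W; vanishing torsion exchanges the roles, so
  -- that only derivatives of the field ∂_c W appear. For c the time direction this is the variation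
  -- field.
  rw [← covAt_mapDeriv_comm g hO hW hx a c, ← covAt_mapDeriv_comm g hO hW hx b c]
  exact (hasFDerivAt_innerAt g (mdifferentiableAt_of_contMDiffOn hO hW hx)
    (differentiableAt_chartDeriv_mapDeriv hO hW hx a)
    (differentiableAt_chartDeriv_mapDeriv hO hW hx b)).2 c

end SmoothMaps

/-! ### Second derivatives of composed curves. -/

section SecondOrderChain

variable {Y : Type*} [NormedAddCommGroup Y] [NormedSpace ℝ Y]
  {Z : Type*} [NormedAddCommGroup Z] [NormedSpace ℝ Z]

/-- Its Hessian term sees only the 1-jet of the curve, which is why it drops out when two curves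
with equal 1-jets are compared. -/
theorem deriv_deriv_comp {Θ : Y → Z} {γ : ℝ → Y} {t : ℝ} (hΘ : ContDiffAt ℝ ∞ Θ (γ t))
    (hγ : ContDiffAt ℝ ∞ γ t) :
    deriv (deriv fun s => Θ (γ s)) t = fderiv ℝ (fderiv ℝ Θ) (γ t) (deriv γ t) (deriv γ t)
      + fderiv ℝ Θ (γ t) (deriv (deriv γ) t) := by
  have h1 : ∀ᶠ s in 𝓝 t, DifferentiableAt ℝ γ s :=
    ((hγ.of_le (m := 1) (by simp)).eventually (by simp)).mono
      fun s hs => hs.differentiableAt (by simp)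
  have h2 : ∀ᶠ s in 𝓝 t, DifferentiableAt ℝ Θ (γ s) :=
    hγ.continuousAt.eventually (((hΘ.of_le (m := 1) (by simp)).eventually (by simp)).mono
      fun s hs => hs.differentiableAt (by simp))
  have h3 : (deriv fun s => Θ (γ s)) =ᶠ[𝓝 t] fun s => fderiv ℝ Θ (γ s) (deriv γ s) := by
    filter_upwards [h1, h2] with s hs1 hs2
    exact (hs2.hasFDerivAt.comp_hasDerivAt s hs1.hasDerivAt).deriv
  have h4 : HasDerivAt (fun s => fderiv ℝ Θ (γ s)) (fderiv ℝ (fderiv ℝ Θ) (γ t) (deriv γ t)) t :=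
    HasFDerivAt.comp_hasDerivAt (l := fderiv ℝ Θ) t
      ((hΘ.fderiv_right (m := ∞) (by simp)).differentiableAt (by simp)).hasFDerivAt
      (hγ.differentiableAt (by simp)).hasDerivAt
  have h5 : HasDerivAt (deriv γ) (deriv (deriv γ) t) t := by
    have : ContDiffAt ℝ ∞ (deriv γ) t :=
      (hγ.fderiv_right (m := ∞) (by simp)).clm_apply contDiffAt_const
    exact (this.differentiableAt (by simp)).hasDerivAt
  rw [h3.deriv_eq, (h4.clm_apply h5).deriv]

/-- If two curves have the same 1-jet, then the second derivatives of their images under a smooth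
map differ by the image of the difference of their second derivatives. -/
theorem deriv_deriv_comp_sub {Θ : Y → Z} {γ₁ γ₂ : ℝ → Y} {t : ℝ} (hΘ : ContDiffAt ℝ ∞ Θ (γ₁ t))
    (h₁ : ContDiffAt ℝ ∞ γ₁ t) (h₂ : ContDiffAt ℝ ∞ γ₂ t) (h0 : γ₁ t = γ₂ t)
    (h1 : deriv γ₁ t = deriv γ₂ t) :
    deriv (deriv fun s => Θ (γ₁ s)) t - deriv (deriv fun s => Θ (γ₂ s)) t
      = fderiv ℝ Θ (γ₁ t) (deriv (deriv γ₁) t - deriv (deriv γ₂) t) := by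
  rw [deriv_deriv_comp hΘ h₁, deriv_deriv_comp (h0 ▸ hΘ) h₂, ← h0, ← h1, map_sub]
  abel

end SecondOrderChain

/-! ### Time derivatives and slices of families. -/

section TimeDerivative

variable {Y : Type*} [NormedAddCommGroup Y] [NormedSpace ℝ Y]

/-- The partial derivative with respect to the first variable. -/
def dt (φ : ℝ × ℂ → Y) (x : ℝ × ℂ) : Y := fderiv ℝ φ x (1, 0)

theorem contDiffOn_dt {φ : ℝ × ℂ → Y} {O : Set (ℝ × ℂ)} (hO : IsOpen O)
    (hφ : ContDiffOn ℝ ∞ φ O) : ContDiffOn ℝ ∞ (dt φ) O :=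
  contDiffOn_fderiv_apply hO hφ _

theorem hasDerivAt_dt {φ : ℝ × ℂ → Y} {O : Set (ℝ × ℂ)} (hφ : ContDiffOn ℝ ∞ φ O)
    (hO : IsOpen O) {t : ℝ} {z : ℂ} (hx : (t, z) ∈ O) :
    HasDerivAt (fun s => φ (s, z)) (dt φ (t, z)) t :=
  ((hφ.contDiffAt (hO.mem_nhds hx)).differentiableAt (by simp)).hasFDerivAt.comp_hasDerivAt t
    ((hasDerivAt_id t).prodMk (hasDerivAt_const t z))

theorem eventually_slice_left {O : Set (ℝ × ℂ)} (hO : IsOpen O) {t : ℝ} {z : ℂ}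
    (hx : (t, z) ∈ O) : ∀ᶠ s in 𝓝 t, (s, z) ∈ O :=
  (Continuous.prodMk_left z).continuousAt.eventually (hO.mem_nhds hx)

theorem eventually_slice_right {O : Set (ℝ × ℂ)} (hO : IsOpen O) {t : ℝ} {z : ℂ}
    (hx : (t, z) ∈ O) : ∀ᶠ w in 𝓝 z, (t, w) ∈ O :=
  (Continuous.prodMk_right t).continuousAt.eventually (hO.mem_nhds hx)

theorem deriv_deriv_eq_dt {φ : ℝ × ℂ → Y} {O : Set (ℝ × ℂ)} (hφ : ContDiffOn ℝ ∞ φ O)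
    (hO : IsOpen O) {t : ℝ} {z : ℂ} (hx : (t, z) ∈ O) :
    deriv (deriv fun s => φ (s, z)) t = dt (dt φ) (t, z) := by
  have h : (deriv fun s => φ (s, z)) =ᶠ[𝓝 t] fun s => dt φ (s, z) := by
    filter_upwards [eventually_slice_left hO hx] with s hs
    exact (hasDerivAt_dt hφ hO hs).deriv
  rw [h.deriv_eq]
  exact (hasDerivAt_dt (contDiffOn_dt hO hφ) hO hx).deriv

theorem contDiffAt_slice {φ : ℝ × ℂ → Y} {O : Set (ℝ × ℂ)} (hφ : ContDiffOn ℝ ∞ φ O)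
    (hO : IsOpen O) {t : ℝ} {z : ℂ} (hx : (t, z) ∈ O) :
    ContDiffAt ℝ ∞ (fun s => φ (s, z)) t :=
  ContDiffAt.comp t (hφ.contDiffAt (hO.mem_nhds hx)) (contDiffAt_id.prodMk contDiffAt_const)

/-- The derivative of a slice `w ↦ φ (t, w)`. -/
theorem fderiv_slice_right {φ : ℝ × ℂ → Y} {t : ℝ} {z : ℂ} (hφ : DifferentiableAt ℝ φ (t, z))
    (ξ : ℂ) : fderiv ℝ (fun w => φ (t, w)) z ξ = fderiv ℝ φ (t, z) (0, ξ) := by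
  have h : HasFDerivAt (fun w => φ (t, w)) _ z :=
    hφ.hasFDerivAt.comp z ((hasFDerivAt_const t z).prodMk (hasFDerivAt_id z))
  rw [h.fderiv]
  simp

end TimeDerivative

/-! ### Families of maps defined near a point, and the first variation of the metric. -/

section LocalVariations

variable {E : Type*} [NormedAddCommGroup E] [NormedSpace ℝ E] [FiniteDimensional ℝ E]
  {N : Type*} [TopologicalSpace N] [ChartedSpace E N] [IsManifold 𝓘(ℝ, E) ∞ N]
  {X : Type*} [NormedAddCommGroup X] [NormedSpace ℝ X]
  {Y : Type*} [NormedAddCommGroup Y] [NormedSpace ℝ Y]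

theorem mapDeriv_comp {f : X → N} {i : Y → X} {y : Y}
    (hf : MDifferentiableAt 𝓘(ℝ, X) 𝓘(ℝ, E) f (i y)) {i' : Y →L[ℝ] X} (hi : HasFDerivAt i i' y) :
    mapDeriv E (fun y => f (i y)) y = (mapDeriv E f (i y)).comp i' :=
  (hf.hasMFDerivAt.comp y (hasMFDerivAt_iff_hasFDerivAt.2 hi)).mfderiv

theorem mapDeriv_slice_right {W : ℝ × ℂ → N} {t : ℝ} {z : ℂ}
    (hW : MDifferentiableAt 𝓘(ℝ, ℝ × ℂ) 𝓘(ℝ, E) W (t, z)) (ξ : ℂ) :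
    mapDeriv E (fun w => W (t, w)) z ξ = mapDeriv E W (t, z) (0, ξ) := by
  rw [mapDeriv_comp (i := fun w => (t, w)) hW
    ((hasFDerivAt_const t z).prodMk (hasFDerivAt_id z))]
  simp

theorem mapDeriv_slice_left {W : ℝ × ℂ → N} {t : ℝ} {z : ℂ}
    (hW : MDifferentiableAt 𝓘(ℝ, ℝ × ℂ) 𝓘(ℝ, E) W (t, z)) :
    mapDeriv E (fun s => W (s, z)) t 1 = mapDeriv E W (t, z) (1, 0) := by
  rw [mapDeriv_comp (i := fun s => (s, z)) hW
    ((hasFDerivAt_id t).prodMk (hasFDerivAt_const z t))]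
  simp

/-- `W` is a smooth family of maps `W (t, ·)` defined on an open set `O`, with `W (0, ·) = f` and
with initial velocity `V`. -/
structure LocalVariation (f : ℂ → N) (V : ℂ → E) (W : ℝ × ℂ → N) (O : Set (ℝ × ℂ)) : Prop where
  isOpen : IsOpen O
  smooth : ContMDiffOn 𝓘(ℝ, ℝ × ℂ) 𝓘(ℝ, E) ∞ W O
  initial : ∀ z, (0, z) ∈ O → W (0, z) = f z
  velocity : ∀ z, (0, z) ∈ O → mapDeriv E W (0, z) (1, 0) = V z

namespace LocalVariation

variable {f : ℂ → N} {V : ℂ → E} {W : ℝ × ℂ → N} {O : Set (ℝ × ℂ)}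

theorem mdifferentiableAt (h : LocalVariation f V W O) {x : ℝ × ℂ} (hx : x ∈ O) :
    MDifferentiableAt 𝓘(ℝ, ℝ × ℂ) 𝓘(ℝ, E) W x :=
  mdifferentiableAt_of_contMDiffOn h.isOpen h.smooth hx

theorem eventuallyEq (h : LocalVariation f V W O) {z : ℂ} (hz : (0, z) ∈ O) :
    f =ᶠ[𝓝 z] fun w => W (0, w) := by
  filter_upwards [eventually_slice_right h.isOpen hz] with w hw
  rw [h.initial w hw]

theorem mapDeriv_eq (h : LocalVariation f V W O) {z : ℂ} (hz : (0, z) ∈ O) (ξ : ℂ) :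
    mapDeriv E f z ξ = mapDeriv E W (0, z) (0, ξ) := by
  rw [← mapDeriv_slice_right (h.mdifferentiableAt hz)]
  have := (h.eventuallyEq hz).mfderiv_eq (I := 𝓘(ℝ, ℂ)) (I' := 𝓘(ℝ, E))
  exact DFunLike.congr_fun this ξ

theorem mdifferentiableAt_map (h : LocalVariation f V W O) {z : ℂ} (hz : (0, z) ∈ O) :
    MDifferentiableAt 𝓘(ℝ, ℂ) 𝓘(ℝ, E) f z := by
  refine MDifferentiableAt.congr_of_eventuallyEq ?_ (h.eventuallyEq hz)
  exact (h.mdifferentiableAt hz).comp z (f := fun w => (0, w))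
    (mdifferentiableAt_iff_differentiableAt.2 (by fun_prop))

theorem pullback_eq (h : LocalVariation f V W O) (g : RMetric E N) {z : ℂ} (hz : (0, z) ∈ O)
    (ξ ζ : ℂ) : pullback g f ξ ζ z = pullback g W (0, ξ) (0, ζ) (0, z) := by
  rw [pullback, pullback, h.mapDeriv_eq hz, h.mapDeriv_eq hz, h.initial z hz]

theorem chartDeriv_eventuallyEq (h : LocalVariation f V W O) {z : ℂ} (hz : (0, z) ∈ O) :
    (fun w => chartDeriv (f z) (f w) (V w)) =ᶠ[𝓝 z]
      fun w => chartDeriv (W (0, z)) (W (0, w)) (mapDeriv E W (0, w) (1, 0)) := by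
  filter_upwards [eventually_slice_right h.isOpen hz] with w hw
  rw [h.initial w hw, h.initial z hz, h.velocity w hw]

theorem differentiableAt_field (h : LocalVariation f V W O) {z : ℂ} (hz : (0, z) ∈ O) :
    DifferentiableAt ℝ (fun w => chartDeriv (f z) (f w) (V w)) z := by
  refine DifferentiableAt.congr_of_eventuallyEq ?_ (h.chartDeriv_eventuallyEq hz)
  exact (differentiableAt_chartDeriv_mapDeriv h.isOpen h.smooth hz (1, 0)).comp z
    (f := fun w => (0, w)) (by fun_prop)

theorem differentiableAt_mapDeriv (h : LocalVariation f V W O) {z : ℂ} (hz : (0, z) ∈ O) (ξ : ℂ) :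
    DifferentiableAt ℝ (fun w => chartDeriv (f z) (f w) (mapDeriv E f w ξ)) z := by
  have he : (fun w => chartDeriv (f z) (f w) (mapDeriv E f w ξ)) =ᶠ[𝓝 z]
      fun w => chartDeriv (W (0, z)) (W (0, w)) (mapDeriv E W (0, w) (0, ξ)) := by
    filter_upwards [eventually_slice_right h.isOpen hz] with w hw
    rw [h.initial w hw, h.initial z hz, h.mapDeriv_eq hw]
  refine DifferentiableAt.congr_of_eventuallyEq ?_ he
  exact (differentiableAt_chartDeriv_mapDeriv h.isOpen h.smooth hz (0, ξ)).comp z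
    (f := fun w => (0, w)) (by fun_prop)

theorem covAt_eq (h : LocalVariation f V W O) (g : RMetric E N) {z : ℂ} (hz : (0, z) ∈ O)
    (ξ : ℂ) : covAt g f V z ξ = covAt g W (fun x => mapDeriv E W x (1, 0)) (0, z) (0, ξ) := by
  rw [ConfVar.covAt_eq, ConfVar.covAt_eq, (h.chartDeriv_eventuallyEq hz).fderiv_eq,
    fderiv_slice_right (φ := fun x => chartDeriv (W (0, z)) (W x) (mapDeriv E W x (1, 0)))
      (differentiableAt_chartDeriv_mapDeriv h.isOpen h.smooth hz (1, 0)),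
    h.mapDeriv_eq hz, h.initial z hz, h.velocity z hz]

end LocalVariation

/-- The first variation `⟨∇_ξ V, f_ζ⟩ + ⟨f_ξ, ∇_ζ V⟩` of `⟨f_ξ, f_ζ⟩`. -/
def pullbackVar (g : RMetric E N) (f : ℂ → N) (V : ℂ → E) (ξ ζ z : ℂ) : ℝ :=
  innerAt g (f z) (covAt g f V z ξ) (mapDeriv E f z ζ)
    + innerAt g (f z) (mapDeriv E f z ξ) (covAt g f V z ζ)

namespace LocalVariation

variable {f : ℂ → N} {V : ℂ → E} {W : ℝ × ℂ → N} {O : Set (ℝ × ℂ)}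

theorem dt_pullback (h : LocalVariation f V W O) (g : RMetric E N) {z : ℂ} (hz : (0, z) ∈ O)
    (ξ ζ : ℂ) : dt (pullback g W (0, ξ) (0, ζ)) (0, z) = pullbackVar g f V ξ ζ z := by
  rw [dt, fderiv_pullback g h.isOpen h.smooth hz, pullbackVar, h.covAt_eq g hz, h.covAt_eq g hz,
    h.mapDeriv_eq hz, h.mapDeriv_eq hz, h.initial z hz]

end LocalVariation

/-- Every smooth field along a map is locally the velocity of a variation. -/
theorem exists_localVariation {f : ℂ → N} {V : ℂ → E} {T : Set ℂ} (hT : IsOpen T)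
    (hV : ContMDiffOn 𝓘(ℝ, ℂ) 𝓘(ℝ, E).tangent ∞
      (fun z => (⟨f z, V z⟩ : TangentBundle 𝓘(ℝ, E) N)) T) {z₀ : ℂ} (hz₀ : z₀ ∈ T) :
    ∃ W O, LocalVariation f V W O ∧ (0, z₀) ∈ O := by
  have := isManifold_one E N
  have hf : ContMDiffOn 𝓘(ℝ, ℂ) 𝓘(ℝ, E) ∞ f T := fun z hz =>
    (Bundle.contMDiffWithinAt_totalSpace.1 (hV z hz)).1
  set q := f z₀
  set T' := T ∩ f ⁻¹' (chartAt E q).source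
  have hT' : IsOpen T' := isOpen_inter_preimage_source hT hf q
  have hF : ContDiffOn ℝ ∞ (fun z => extChartAt 𝓘(ℝ, E) q (f z)) T' :=
    contDiffOn_extChartAt_comp hf q
  have hVc : ContDiffOn ℝ ∞ (fun z => chartDeriv q (f z) (V z)) T' := by
    have h1 : ContMDiffOn 𝓘(ℝ, E).tangent 𝓘(ℝ, E).tangent ∞ _ _ :=
      (contMDiffOn_extChartAt (I := 𝓘(ℝ, E)) (n := ∞) (x := q)).contMDiffOn_tangentMapWithin
        (m := ∞) (by simp) (chartAt E q).open_source.uniqueMDiffOn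
    have h2 := (contMDiff_snd_tangentBundle_modelSpace E 𝓘(ℝ, E) (n := ∞)).comp_contMDiffOn
      (h1.comp (hV.mono inter_subset_left) (s := T') fun z hz => hz.2)
    rw [contMDiffOn_iff_contDiffOn] at h2
    refine h2.congr fun z hz => ?_
    simp only [Function.comp, tangentMapWithin]
    rw [mfderivWithin_of_isOpen (chartAt E q).open_source hz.2]
    rfl
  -- In the chart at f z₀ the family moves along straight lines with velocity V; it is kept only on
  -- the open set where these stay inside the chart.
  set Φ : ℝ × ℂ → E := fun x =>
    extChartAt 𝓘(ℝ, E) q (f x.2) + x.1 • chartDeriv q (f x.2) (V x.2) with hΦ_def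
  have hO' : IsOpen ((univ : Set ℝ) ×ˢ T') := isOpen_univ.prod hT'
  have hΦ : ContDiffOn ℝ ∞ Φ ((univ : Set ℝ) ×ˢ T') :=
    (hF.comp contDiffOn_snd fun x hx => hx.2).add
      (contDiffOn_fst.smul (hVc.comp contDiffOn_snd fun x hx => hx.2))
  have h0 : ∀ z, Φ (0, z) = extChartAt 𝓘(ℝ, E) q (f z) := fun z => by simp [hΦ_def]
  have hO := hΦ.continuousOn.isOpen_inter_preimage hO' (isOpen_extChartAt_target (I := 𝓘(ℝ, E)) q)
  refine ⟨fun x => (extChartAt 𝓘(ℝ, E) q).symm (Φ x), _, ⟨hO, ?_, ?_, ?_⟩, ⟨⟨mem_univ _, hz₀,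
    mem_chart_source E q⟩, ?_⟩⟩
  · exact (contMDiffOn_extChartAt_symm (I := 𝓘(ℝ, E)) q).comp
      (contMDiffOn_iff_contDiffOn.2 (hΦ.mono inter_subset_left)) fun x hx => hx.2
  · intro z hz
    rw [h0]
    exact (extChartAt 𝓘(ℝ, E) q).left_inv (by simpa using hz.1.2.2)
  · intro z hz
    have hsymm : MDifferentiableAt 𝓘(ℝ, E) 𝓘(ℝ, E) (extChartAt 𝓘(ℝ, E) q).symm (Φ (0, z)) :=
      mdifferentiableAt_of_contMDiffOn (isOpen_extChartAt_target (I := 𝓘(ℝ, E)) q)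
        (contMDiffOn_extChartAt_symm q) hz.2
    have hdΦ := ((hΦ.contDiffAt (hO'.mem_nhds hz.1)).differentiableAt (by simp)).hasFDerivAt
    rw [mapDeriv_comp hsymm hdΦ, ContinuousLinearMap.comp_apply]
    have h1 : fderiv ℝ Φ (0, z) (1, 0) = chartDeriv q (f z) (V z) := by
      have h2 : HasDerivAt (fun s : ℝ => Φ (s, z)) (chartDeriv q (f z) (V z)) 0 := by
        have h3 := ((hasDerivAt_id (0 : ℝ)).smul_const (chartDeriv q (f z) (V z))).const_add
          (extChartAt 𝓘(ℝ, E) q (f z))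
        rw [one_smul] at h3
        exact h3
      exact (hasDerivAt_dt hΦ hO' hz.1).unique h2
    rw [h1, h0, mapDeriv_symm_chartDeriv hz.1.2.2]
  · rw [mem_preimage, h0]
    exact mem_extChartAt_target q

end LocalVariations

/-! ### Accelerations of curves and change of chart. -/

section Acceleration

variable {E : Type*} [NormedAddCommGroup E] [NormedSpace ℝ E] [FiniteDimensional ℝ E]
  {N : Type*} [TopologicalSpace N] [ChartedSpace E N] [IsManifold 𝓘(ℝ, E) ∞ N]

/-- The Christoffel correction depends on the velocity alone, so it cancels between curves with the
same velocity. -/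
theorem covAt_velocity (g : RMetric E N) {c : ℝ → N} {t₀ : ℝ}
    (hc : ∀ᶠ t in 𝓝 t₀, MDifferentiableAt 𝓘(ℝ, ℝ) 𝓘(ℝ, E) c t) :
    covAt g c (fun t => mapDeriv E c t 1) t₀ 1
      = deriv (deriv fun t => extChartAt 𝓘(ℝ, E) (c t₀) (c t)) t₀
        + christoffelAt g (c t₀) (mapDeriv E c t₀ 1) (mapDeriv E c t₀ 1) := by
  have hs : ∀ᶠ t in 𝓝 t₀, c t ∈ (chartAt E (c t₀)).source :=
    hc.self_of_nhds.continuousAt.eventually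
      ((chartAt E (c t₀)).open_source.mem_nhds (mem_chart_source E (c t₀)))
  have h : (fun t => chartDeriv (c t₀) (c t) (mapDeriv E c t 1)) =ᶠ[𝓝 t₀]
      deriv fun t => extChartAt 𝓘(ℝ, E) (c t₀) (c t) := by
    filter_upwards [hc, hs] with t ht hts
    rw [← fderiv_extChartAt_comp ht hts, fderiv_apply_one_eq_deriv]
  rw [covAt_eq, h.fderiv_eq, fderiv_apply_one_eq_deriv]

/-- At its own base point the preferred chart has identity differential, so the transition map has
there the differential of the second chart. -/
theorem fderiv_extChartAt_comp_symm {q n : N} (hn : n ∈ (chartAt E q).source) (ξ : E) :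
    fderiv ℝ (fun y => extChartAt 𝓘(ℝ, E) q ((extChartAt 𝓘(ℝ, E) n).symm y))
      (extChartAt 𝓘(ℝ, E) n n) ξ = chartDeriv q n ξ := by
  have h1 : MDifferentiableAt 𝓘(ℝ, E) 𝓘(ℝ, E) (extChartAt 𝓘(ℝ, E) n).symm
      (extChartAt 𝓘(ℝ, E) n n) :=
    mdifferentiableAt_of_contMDiffOn (isOpen_extChartAt_target (I := 𝓘(ℝ, E)) n)
      (contMDiffOn_extChartAt_symm n) (mem_extChartAt_target n)
  have h2 := mapDeriv_symm_chartDeriv (mem_chart_source E n) ξ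
  rw [chartDeriv_self, ContinuousLinearMap.id_apply] at h2
  rw [fderiv_extChartAt_comp h1 (by rwa [extChartAt_to_inv]), h2, extChartAt_to_inv]

/-- The difference of the accelerations of two curves with the same velocity is a tangent
vector. -/
theorem deriv_deriv_chart_sub {c₁ c₂ : ℝ → N} {t : ℝ} {q : N}
    (h₁ : ContinuousAt c₁ t) (h₂ : ContinuousAt c₂ t)
    (hs₁ : ContDiffAt ℝ ∞ (fun s => extChartAt 𝓘(ℝ, E) (c₁ t) (c₁ s)) t)
    (hs₂ : ContDiffAt ℝ ∞ (fun s => extChartAt 𝓘(ℝ, E) (c₁ t) (c₂ s)) t)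
    (h0 : c₁ t = c₂ t)
    (h1 : deriv (fun s => extChartAt 𝓘(ℝ, E) (c₁ t) (c₁ s)) t
      = deriv (fun s => extChartAt 𝓘(ℝ, E) (c₁ t) (c₂ s)) t)
    (hq : c₁ t ∈ (chartAt E q).source) :
    deriv (deriv fun s => extChartAt 𝓘(ℝ, E) q (c₁ s)) t
        - deriv (deriv fun s => extChartAt 𝓘(ℝ, E) q (c₂ s)) t
      = chartDeriv q (c₁ t) (deriv (deriv fun s => extChartAt 𝓘(ℝ, E) (c₁ t) (c₁ s)) t
        - deriv (deriv fun s => extChartAt 𝓘(ℝ, E) (c₁ t) (c₂ s)) t) := by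
  have key : ∀ c : ℝ → N, ContinuousAt c t → c t = c₁ t →
      (fun s => extChartAt 𝓘(ℝ, E) q (c s)) =ᶠ[𝓝 t] fun s => extChartAt 𝓘(ℝ, E) q
        ((extChartAt 𝓘(ℝ, E) (c₁ t)).symm (extChartAt 𝓘(ℝ, E) (c₁ t) (c s))) := by
    intro c hc hct
    filter_upwards [hc.eventually ((chartAt E (c₁ t)).open_source.mem_nhds
      (by rw [hct]; exact mem_chart_source E (c₁ t)))] with s hs
    rw [(extChartAt 𝓘(ℝ, E) (c₁ t)).left_inv (by rw [extChartAt_source]; exact hs)]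
  have hΘ : ContDiffAt ℝ ∞ (fun y => extChartAt 𝓘(ℝ, E) q ((extChartAt 𝓘(ℝ, E) (c₁ t)).symm y))
      (extChartAt 𝓘(ℝ, E) (c₁ t) (c₁ t)) :=
    (contDiffOn_extChartAt_comp (contMDiffOn_extChartAt_symm (I := 𝓘(ℝ, E)) (c₁ t)) q).contDiffAt
      ((isOpen_inter_preimage_source (isOpen_extChartAt_target (I := 𝓘(ℝ, E)) (c₁ t))
        (contMDiffOn_extChartAt_symm (c₁ t)) q).mem_nhds
        ⟨mem_extChartAt_target _, by rwa [mem_preimage, extChartAt_to_inv]⟩)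
  rw [(key c₁ h₁ rfl).deriv.deriv_eq, (key c₂ h₂ h0.symm).deriv.deriv_eq,
    deriv_deriv_comp_sub hΘ hs₁ hs₂ (by rw [h0]) h1, fderiv_extChartAt_comp_symm hq]

end Acceleration

/-! ### How the second derivative of the induced metric depends on the acceleration. -/

section SecondOrder

variable {E : Type*} [NormedAddCommGroup E] [NormedSpace ℝ E] [FiniteDimensional ℝ E]
  {N : Type*} [TopologicalSpace N] [ChartedSpace E N] [IsManifold 𝓘(ℝ, E) ∞ N]

variable {f : ℂ → N} {V A₁ A₂ : ℂ → E} {W W₁ W₂ H₁ H₂ : ℝ × ℂ → N} {O O₁ O₂ P₁ P₂ : Set (ℝ × ℂ)}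

/-- The acceleration at time `0` of a family. -/
def accelAt (g : RMetric E N) (W : ℝ × ℂ → N) (z : ℂ) : E :=
  covAt g (fun t => W (t, z)) (fun t => mapDeriv E (fun t => W (t, z)) t 1) 0 1

namespace LocalVariation

theorem dt_chart (h : LocalVariation f V W O) {q : N} {z : ℂ} (hz : (0, z) ∈ O)
    (hq : f z ∈ (chartAt E q).source) :
    dt (fun x => extChartAt 𝓘(ℝ, E) q (W x)) (0, z) = chartDeriv q (f z) (V z) := by
  rw [dt, fderiv_extChartAt_comp (h.mdifferentiableAt hz) (by rwa [h.initial z hz]),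
    h.velocity z hz, h.initial z hz]

theorem mdifferentiableAt_slice (h : LocalVariation f V W O) {t : ℝ} {z : ℂ} (hz : (t, z) ∈ O) :
    MDifferentiableAt 𝓘(ℝ, ℝ) 𝓘(ℝ, E) (fun s => W (s, z)) t :=
  (h.mdifferentiableAt hz).comp t (f := fun s => (s, z))
    (mdifferentiableAt_iff_differentiableAt.2 (by fun_prop))

theorem accelAt_eq (h : LocalVariation f V W O) (g : RMetric E N) {z : ℂ} (hz : (0, z) ∈ O) :
    accelAt g W z = deriv (deriv fun t => extChartAt 𝓘(ℝ, E) (f z) (W (t, z))) 0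
      + christoffelAt g (f z) (V z) (V z) := by
  have hc : ∀ᶠ t in 𝓝 (0 : ℝ), MDifferentiableAt 𝓘(ℝ, ℝ) 𝓘(ℝ, E) (fun s => W (s, z)) t := by
    filter_upwards [eventually_slice_left h.isOpen hz] with t ht
    exact h.mdifferentiableAt_slice ht
  rw [accelAt, covAt_velocity g hc, mapDeriv_slice_left (h.mdifferentiableAt hz), h.initial z hz,
    h.velocity z hz]

theorem dt_dt_chart_sub (h₁ : LocalVariation f V W₁ O₁) (h₂ : LocalVariation f V W₂ O₂)
    (g : RMetric E N) {q : N} {z : ℂ} (hz₁ : (0, z) ∈ O₁) (hz₂ : (0, z) ∈ O₂)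
    (hq : f z ∈ (chartAt E q).source) :
    dt (dt fun x => extChartAt 𝓘(ℝ, E) q (W₁ x)) (0, z)
        - dt (dt fun x => extChartAt 𝓘(ℝ, E) q (W₂ x)) (0, z)
      = chartDeriv q (f z) (accelAt g W₁ z - accelAt g W₂ z) := by
  have i₁ := h₁.initial z hz₁
  have i₂ := h₂.initial z hz₂
  have hsm : ∀ {W : ℝ × ℂ → N} {O : Set (ℝ × ℂ)}, LocalVariation f V W O → (0, z) ∈ O →
      ∀ q : N, f z ∈ (chartAt E q).source →
      ContDiffOn ℝ ∞ (fun x => extChartAt 𝓘(ℝ, E) q (W x)) (O ∩ W ⁻¹' (chartAt E q).source) ∧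
      IsOpen (O ∩ W ⁻¹' (chartAt E q).source) ∧ (0, z) ∈ O ∩ W ⁻¹' (chartAt E q).source :=
    fun h hz q hq => ⟨contDiffOn_extChartAt_comp h.smooth q,
      isOpen_inter_preimage_source h.isOpen h.smooth q, hz, by
        rwa [mem_preimage, h.initial z hz]⟩
  obtain ⟨a₁, b₁, c₁⟩ := hsm h₁ hz₁ q hq
  obtain ⟨a₂, b₂, c₂⟩ := hsm h₂ hz₂ q hq
  obtain ⟨a₁', b₁', c₁'⟩ := hsm h₁ hz₁ (f z) (mem_chart_source E _)
  obtain ⟨a₂', b₂', c₂'⟩ := hsm h₂ hz₂ (f z) (mem_chart_source E _)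
  -- Both covariant accelerations contain the same Γ(V, V), leaving the difference of coordinate
  -- accelerations in the chart at f z.
  rw [← deriv_deriv_eq_dt a₁ b₁ c₁, ← deriv_deriv_eq_dt a₂ b₂ c₂, h₁.accelAt_eq g hz₁,
    h₂.accelAt_eq g hz₂, add_sub_add_right_eq_sub]
  have key := deriv_deriv_chart_sub (E := E) (c₁ := fun t => W₁ (t, z)) (c₂ := fun t => W₂ (t, z))
    (t := 0) (q := q) (h₁.mdifferentiableAt_slice hz₁).continuousAt
    (h₂.mdifferentiableAt_slice hz₂).continuousAt
  simp only [i₁, i₂] at key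
  refine key (contDiffAt_slice a₁' b₁' c₁') (contDiffAt_slice a₂' b₂' c₂') trivial ?_ hq
  rw [(hasDerivAt_dt a₁' b₁' c₁').deriv, (hasDerivAt_dt a₂' b₂' c₂').deriv,
    h₁.dt_chart hz₁ (mem_chart_source E _), h₂.dt_chart hz₂ (mem_chart_source E _)]

/-- The coordinate 1-jet of a family in the direction `ξ`. -/
def jet (W : ℝ × ℂ → N) (q : N) (ξ : ℂ) (x : ℝ × ℂ) : E × E :=
  (extChartAt 𝓘(ℝ, E) q (W x), fderiv ℝ (fun x => extChartAt 𝓘(ℝ, E) q (W x)) x (0, ξ))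

theorem contDiffOn_jet (h : LocalVariation f V W O) (q : N) (ξ : ℂ) :
    ContDiffOn ℝ ∞ (jet (E := E) W q ξ) (O ∩ W ⁻¹' (chartAt E q).source) :=
  (contDiffOn_extChartAt_comp h.smooth q).prodMk
    (contDiffOn_fderiv_apply (isOpen_inter_preimage_source h.isOpen h.smooth q)
      (contDiffOn_extChartAt_comp h.smooth q) _)

theorem pullback_eq_jet (h : LocalVariation f V W O) (g : RMetric E N) (q : N) (ξ : ℂ)
    {x : ℝ × ℂ} (hx : x ∈ O ∩ W ⁻¹' (chartAt E q).source) :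
    pullback g W (0, ξ) (0, ξ) x
      = metricCoord g q (jet (E := E) W q ξ x).1 (jet W q ξ x).2 (jet W q ξ x).2 := by
  rw [jet, fderiv_extChartAt_comp (h.mdifferentiableAt hx.1) hx.2, metricCoord_chartDeriv g hx.2,
    pullback]

theorem jet_zero (h : LocalVariation f V W O) {q : N} (ξ : ℂ) {z : ℂ} (hz : (0, z) ∈ O)
    (hq : f z ∈ (chartAt E q).source) : jet W q ξ (0, z)
      = (extChartAt 𝓘(ℝ, E) q (f z), chartDeriv q (f z) (mapDeriv E f z ξ)) := by
  rw [jet, fderiv_extChartAt_comp (h.mdifferentiableAt hz) (by rwa [h.initial z hz]),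
    h.initial z hz, h.mapDeriv_eq hz]

theorem dt_prodMk {Y Z : Type*} [NormedAddCommGroup Y] [NormedSpace ℝ Y]
    [NormedAddCommGroup Z] [NormedSpace ℝ Z] {φ : ℝ × ℂ → Y} {ψ : ℝ × ℂ → Z} {x : ℝ × ℂ}
    (hφ : DifferentiableAt ℝ φ x) (hψ : DifferentiableAt ℝ ψ x) :
    dt (fun x => (φ x, ψ x)) x = (dt φ x, dt ψ x) := by
  rw [dt, (hφ.hasFDerivAt.prodMk hψ.hasFDerivAt).fderiv]
  rfl

theorem differentiableAt_of_contDiffOn {X Y : Type*} [NormedAddCommGroup X] [NormedSpace ℝ X]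
    [NormedAddCommGroup Y] [NormedSpace ℝ Y] {φ : X → Y}
    {O : Set X} (hφ : ContDiffOn ℝ ∞ φ O) (hO : IsOpen O) {x : X} (hx : x ∈ O) :
    DifferentiableAt ℝ φ x :=
  (hφ.contDiffAt (hO.mem_nhds hx)).differentiableAt (by simp)

/-- Time and space derivatives commute, so the velocity of the jet is the jet of the velocity. -/
theorem dt_jet (h : LocalVariation f V W O) (q : N) (ξ : ℂ) {x : ℝ × ℂ}
    (hx : x ∈ O ∩ W ⁻¹' (chartAt E q).source) :
    dt (jet W q ξ) x = (dt (fun x => extChartAt 𝓘(ℝ, E) q (W x)) x,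
      fderiv ℝ (dt fun x => extChartAt 𝓘(ℝ, E) q (W x)) x (0, ξ)) := by
  have hO := isOpen_inter_preimage_source h.isOpen h.smooth q
  have hF := contDiffOn_extChartAt_comp h.smooth q
  have := dt_prodMk (differentiableAt_of_contDiffOn hF hO hx)
    (differentiableAt_of_contDiffOn (contDiffOn_fderiv_apply hO hF (0, ξ)) hO hx)
  refine this.trans (Prod.ext rfl ?_)
  exact fderiv_fderiv_comm hO hF hx _ _

theorem dt_dt_jet (h : LocalVariation f V W O) (q : N) (ξ : ℂ) {x : ℝ × ℂ}
    (hx : x ∈ O ∩ W ⁻¹' (chartAt E q).source) :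
    dt (dt (jet W q ξ)) x = (dt (dt fun x => extChartAt 𝓘(ℝ, E) q (W x)) x,
      fderiv ℝ (dt (dt fun x => extChartAt 𝓘(ℝ, E) q (W x))) x (0, ξ)) := by
  have hO := isOpen_inter_preimage_source h.isOpen h.smooth q
  have hF := contDiffOn_dt hO (contDiffOn_extChartAt_comp h.smooth q)
  have he : dt (jet W q ξ) =ᶠ[𝓝 x] fun x => (dt (fun x => extChartAt 𝓘(ℝ, E) q (W x)) x,
      fderiv ℝ (dt fun x => extChartAt 𝓘(ℝ, E) q (W x)) x (0, ξ)) := by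
    filter_upwards [hO.mem_nhds hx] with y hy
    exact h.dt_jet q ξ hy
  have := dt_prodMk (differentiableAt_of_contDiffOn hF hO hx)
    (differentiableAt_of_contDiffOn (contDiffOn_fderiv_apply hO hF (0, ξ)) hO hx)
  rw [dt, he.fderiv_eq]
  refine this.trans (Prod.ext rfl ?_)
  exact fderiv_fderiv_comm hO hF hx _ _

theorem contDiffAt_metricCoord_sq (g : RMetric E N) (q : N) {y : E × E}
    (hy : y.1 ∈ (extChartAt 𝓘(ℝ, E) q).target) :
    ContDiffAt ℝ ∞ (fun y : E × E => metricCoord g q y.1 y.2 y.2) y := by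
  have h : ContDiffAt ℝ ∞ (fun y : E × E => metricCoord g q y.1) y :=
    ((contDiffOn_metricCoord g q).contDiffAt ((isOpen_extChartAt_target q).mem_nhds hy)).comp y
      contDiffAt_fst
  exact (h.clm_apply contDiffAt_snd).clm_apply contDiffAt_snd

/-- |∂_ξ W|² is a fixed smooth function Θ of the coordinate 1-jet in the direction ξ. Those jets of
`W₁` and `W₂` agree to first order in time, so the second derivatives differ by DΘ applied to the
difference of the jet accelerations. This difference is the jet of the tangent field A₁ - A₂, and DΘ
of the jet of a field is the first variation along it. Only the difference of `A₁` and `A₂` is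
prescribed. -/
theorem dt_dt_pullback_sub (h₁ : LocalVariation f V W₁ O₁) (h₂ : LocalVariation f V W₂ O₂)
    (k₁ : LocalVariation f A₁ H₁ P₁) (k₂ : LocalVariation f A₂ H₂ P₂) (g : RMetric E N) {z : ℂ}
    (hz₁ : (0, z) ∈ O₁) (hz₂ : (0, z) ∈ O₂) (hk₁ : (0, z) ∈ P₁) (hk₂ : (0, z) ∈ P₂)
    (hA : ∀ᶠ w in 𝓝 z, A₁ w - A₂ w = accelAt g W₁ w - accelAt g W₂ w) (ξ : ℂ) :
    dt (dt (pullback g W₁ (0, ξ) (0, ξ))) (0, z) - dt (dt (pullback g W₂ (0, ξ) (0, ξ))) (0, z)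
      = dt (pullback g H₁ (0, ξ) (0, ξ)) (0, z) - dt (pullback g H₂ (0, ξ) (0, ξ)) (0, z) := by
  set q := f z with hq
  have hqs : f z ∈ (chartAt E q).source := mem_chart_source E q
  set Θ : E × E → ℝ := fun y => metricCoord g q y.1 y.2 y.2 with hΘ_def
  have mem : ∀ {V : ℂ → E} {W : ℝ × ℂ → N} {O : Set (ℝ × ℂ)}, LocalVariation f V W O →
      (0, z) ∈ O → (0, z) ∈ O ∩ W ⁻¹' (chartAt E q).source :=
    fun h hz => ⟨hz, by rwa [mem_preimage, h.initial z hz]⟩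
  have op : ∀ {V : ℂ → E} {W : ℝ × ℂ → N} {O : Set (ℝ × ℂ)}, LocalVariation f V W O →
      IsOpen (O ∩ W ⁻¹' (chartAt E q).source) :=
    fun h => isOpen_inter_preimage_source h.isOpen h.smooth q
  have j0 : ∀ {V : ℂ → E} {W : ℝ × ℂ → N} {O : Set (ℝ × ℂ)}, LocalVariation f V W O →
      (0, z) ∈ O → jet W q ξ (0, z)
        = (extChartAt 𝓘(ℝ, E) q (f z), chartDeriv q (f z) (mapDeriv E f z ξ)) :=
    fun h hz => h.jet_zero ξ hz hqs
  have hΘ : ContDiffAt ℝ ∞ Θ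
      (extChartAt 𝓘(ℝ, E) q (f z), chartDeriv q (f z) (mapDeriv E f z ξ)) :=
    contDiffAt_metricCoord_sq g q (mem_extChartAt_target q)
  have ev : ∀ {V : ℂ → E} {W : ℝ × ℂ → N} {O : Set (ℝ × ℂ)}, LocalVariation f V W O →
      (0, z) ∈ O → (fun t => pullback g W (0, ξ) (0, ξ) (t, z)) =ᶠ[𝓝 0]
        fun t => Θ (jet W q ξ (t, z)) := by
    intro V W O h hz
    filter_upwards [eventually_slice_left (op h) (mem h hz)] with t ht
    exact h.pullback_eq_jet g q ξ ht
  have hdt : ∀ {V : ℂ → E} {W : ℝ × ℂ → N} {O : Set (ℝ × ℂ)}, LocalVariation f V W O →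
      (0, z) ∈ O → dt (jet W q ξ) (0, z) = (chartDeriv q (f z) (V z),
        fderiv ℝ (fun w => chartDeriv q (f w) (V w)) z ξ) := by
    intro V W O h hz
    rw [h.dt_jet q ξ (mem h hz), h.dt_chart hz hqs, ← fderiv_slice_right
      (differentiableAt_of_contDiffOn (contDiffOn_dt (op h)
        (contDiffOn_extChartAt_comp h.smooth q)) (op h) (mem h hz))]
    congr 2
    refine Filter.EventuallyEq.fderiv_eq ?_
    filter_upwards [eventually_slice_right (op h) (mem h hz)] with w hw
    exact h.dt_chart hw.1 (by rw [← h.initial w hw.1]; exact hw.2)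
  have first : ∀ {V : ℂ → E} {W : ℝ × ℂ → N} {O : Set (ℝ × ℂ)}, LocalVariation f V W O →
      (0, z) ∈ O → dt (pullback g W (0, ξ) (0, ξ)) (0, z)
        = fderiv ℝ Θ (extChartAt 𝓘(ℝ, E) q (f z), chartDeriv q (f z) (mapDeriv E f z ξ))
          (dt (jet W q ξ) (0, z)) := by
    intro V W O h hz
    rw [← (hasDerivAt_dt (contDiffOn_pullback g h.isOpen h.smooth (0, ξ) (0, ξ))
      h.isOpen hz).deriv, (ev h hz).deriv_eq, ← j0 h hz]
    rw [← j0 h hz] at hΘ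
    exact ((hΘ.differentiableAt (by simp)).hasFDerivAt.comp_hasDerivAt 0
      (hasDerivAt_dt (h.contDiffOn_jet q ξ) (op h) (mem h hz))).deriv
  have d1 : deriv (fun t => jet (E := E) W₁ q ξ (t, z)) 0
      = deriv (fun t => jet (E := E) W₂ q ξ (t, z)) 0 := by
    rw [(hasDerivAt_dt (h₁.contDiffOn_jet q ξ) (op h₁) (mem h₁ hz₁)).deriv,
      (hasDerivAt_dt (h₂.contDiffOn_jet q ξ) (op h₂) (mem h₂ hz₂)).deriv, hdt h₁ hz₁, hdt h₂ hz₂]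
  rw [first k₁ hk₁, first k₂ hk₂, ← map_sub,
    ← deriv_deriv_eq_dt (contDiffOn_pullback g h₁.isOpen h₁.smooth _ _) h₁.isOpen hz₁,
    ← deriv_deriv_eq_dt (contDiffOn_pullback g h₂.isOpen h₂.smooth _ _) h₂.isOpen hz₂,
    (ev h₁ hz₁).deriv.deriv_eq, (ev h₂ hz₂).deriv.deriv_eq,
    deriv_deriv_comp_sub (γ₁ := fun t => jet (E := E) W₁ q ξ (t, z))
      (γ₂ := fun t => jet (E := E) W₂ q ξ (t, z))
      (by rwa [j0 h₁ hz₁])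
      (contDiffAt_slice (h₁.contDiffOn_jet q ξ) (op h₁) (mem h₁ hz₁))
      (contDiffAt_slice (h₂.contDiffOn_jet q ξ) (op h₂) (mem h₂ hz₂))
      (by rw [j0 h₁ hz₁, j0 h₂ hz₂]) d1, j0 h₁ hz₁,
    deriv_deriv_eq_dt (h₁.contDiffOn_jet q ξ) (op h₁) (mem h₁ hz₁),
    deriv_deriv_eq_dt (h₂.contDiffOn_jet q ξ) (op h₂) (mem h₂ hz₂),
    h₁.dt_dt_jet q ξ (mem h₁ hz₁), h₂.dt_dt_jet q ξ (mem h₂ hz₂), hdt k₁ hk₁, hdt k₂ hk₂]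
  congr 1
  -- The identity of accelerations holds near z and not only at z, so it may be differentiated in
  -- the direction ξ; this gives the second component of the jet.
  have hD : ∀ᶠ w in 𝓝 z, dt (dt fun x => extChartAt 𝓘(ℝ, E) q (W₁ x)) (0, w)
        - dt (dt fun x => extChartAt 𝓘(ℝ, E) q (W₂ x)) (0, w)
      = chartDeriv q (f w) (A₁ w) - chartDeriv q (f w) (A₂ w) := by
    filter_upwards [hA, eventually_slice_right (op h₁) (mem h₁ hz₁),
      eventually_slice_right (op h₂) (mem h₂ hz₂)] with w hw hw₁ hw₂
    rw [h₁.dt_dt_chart_sub h₂ g hw₁.1 hw₂.1 (by rw [← h₁.initial w hw₁.1]; exact hw₁.2), ← hw,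
      map_sub]
  have s₁ := differentiableAt_of_contDiffOn (contDiffOn_dt (op h₁) (contDiffOn_dt (op h₁)
    (contDiffOn_extChartAt_comp h₁.smooth q))) (op h₁) (mem h₁ hz₁)
  have s₂ := differentiableAt_of_contDiffOn (contDiffOn_dt (op h₂) (contDiffOn_dt (op h₂)
    (contDiffOn_extChartAt_comp h₂.smooth q))) (op h₂) (mem h₂ hz₂)
  refine Prod.ext hD.self_of_nhds ?_
  simp only [Prod.snd_sub]
  rw [← fderiv_slice_right s₁, ← fderiv_slice_right s₂, ← sub_apply, ← sub_apply,
    ← fderiv_sub, ← fderiv_sub]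
  · exact congrFun (congrArg DFunLike.coe (Filter.EventuallyEq.fderiv_eq hD)) ξ
  · exact k₁.differentiableAt_field hk₁
  · exact k₂.differentiableAt_field hk₂
  · exact s₁.comp z (f := fun w => (0, w)) (by fun_prop)
  · exact s₂.comp z (f := fun w => (0, w)) (by fun_prop)

end LocalVariation

end SecondOrder

/-! ### The field η expressed by the first variation of the metric. -/

section ConformalDefect

variable {E : Type*} [NormedAddCommGroup E] [NormedSpace ℝ E] [FiniteDimensional ℝ E]
  {N : Type*} [TopologicalSpace N] [ChartedSpace E N] [IsManifold 𝓘(ℝ, E) ∞ N]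

/-- `⟨a, f_ξ⟩`. -/
def innerDeriv (g : RMetric E N) (f : ℂ → N) (z : ℂ) (a : E) (ξ : ℂ) : ℝ :=
  innerAt g (f z) a (mapDeriv E f z ξ)

theorem confFactor_eq (g : RMetric E N) (f : ℂ → N) (z : ℂ) :
    confFactor g f z = (pullback g f 1 1 z + pullback g f Complex.I Complex.I z) / 2 := by
  have h : confFactor g f z = 2 * (innerAt g (f z) ((1 / 2 : ℝ) • mapDeriv E f z 1)
      ((1 / 2 : ℝ) • mapDeriv E f z 1) + innerAt g (f z) (-((1 / 2 : ℝ) • mapDeriv E f z Complex.I))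
      (-((1 / 2 : ℝ) • mapDeriv E f z Complex.I))) := rfl
  rw [h]
  simp only [pullback, map_neg, map_smul, neg_apply, smul_apply, smul_eq_mul]
  ring

theorem cinner_dZ (g : RMetric E N) (f : ℂ → N) (z : ℂ) (P Q : E) :
    cinner g ((P, Q) : CTangent E (f z)) (dZ f z)
      = ⟨(innerDeriv g f z P 1 + innerDeriv g f z Q Complex.I) / 2,
        (innerDeriv g f z Q 1 - innerDeriv g f z P Complex.I) / 2⟩ := by
  have h : cinner g ((P, Q) : CTangent E (f z)) (dZ f z)
      = ⟨innerAt g (f z) P ((1 / 2 : ℝ) • mapDeriv E f z 1)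
          - innerAt g (f z) Q (-((1 / 2 : ℝ) • mapDeriv E f z Complex.I)),
        innerAt g (f z) P (-((1 / 2 : ℝ) • mapDeriv E f z Complex.I))
          + innerAt g (f z) Q ((1 / 2 : ℝ) • mapDeriv E f z 1)⟩ := rfl
  rw [h]
  simp only [innerDeriv, map_neg, map_smul, smul_eq_mul]
  congr 1 <;> ring

theorem cinner_dZbar (g : RMetric E N) (f : ℂ → N) (z : ℂ) (P Q : E) :
    cinner g ((P, Q) : CTangent E (f z)) (dZbar f z)
      = ⟨(innerDeriv g f z P 1 - innerDeriv g f z Q Complex.I) / 2,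
        (innerDeriv g f z Q 1 + innerDeriv g f z P Complex.I) / 2⟩ := by
  have h : cinner g ((P, Q) : CTangent E (f z)) (dZbar f z)
      = ⟨innerAt g (f z) P ((1 / 2 : ℝ) • mapDeriv E f z 1)
          - innerAt g (f z) Q ((1 / 2 : ℝ) • mapDeriv E f z Complex.I),
        innerAt g (f z) P ((1 / 2 : ℝ) • mapDeriv E f z Complex.I)
          + innerAt g (f z) Q ((1 / 2 : ℝ) • mapDeriv E f z 1)⟩ := rfl
  rw [h]
  simp only [innerDeriv, map_smul, smul_eq_mul]
  congr 1 <;> ring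

theorem cmul_dZbar (f : ℂ → N) (z : ℂ) (c : ℂ) :
    cmul c (dZbar f z) = (((c.re / 2) • mapDeriv E f z 1 - (c.im / 2) • mapDeriv E f z Complex.I,
      (c.re / 2) • mapDeriv E f z Complex.I + (c.im / 2) • mapDeriv E f z 1) :
        CTangent E (f z)) := by
  have h : cmul c (dZbar f z) = ((c.re • (1 / 2 : ℝ) • mapDeriv E f z 1
      - c.im • (1 / 2 : ℝ) • mapDeriv E f z Complex.I,
      c.re • (1 / 2 : ℝ) • mapDeriv E f z Complex.I + c.im • (1 / 2 : ℝ) • mapDeriv E f z 1) :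
      E × E) := rfl
  rw [h]
  simp only [smul_smul, mul_one_div]
  rfl

theorem proj01_real (g : RMetric E N) (f : ℂ → N) (z : ℂ) (a : E) :
    proj01 g f z ((a, (0 : E)) : CTangent E (f z)) =
      (((innerDeriv g f z a 1 / confFactor g f z / 2) • mapDeriv E f z 1
        + (innerDeriv g f z a Complex.I / confFactor g f z / 2) • mapDeriv E f z Complex.I,
      (innerDeriv g f z a 1 / confFactor g f z / 2) • mapDeriv E f z Complex.I
        - (innerDeriv g f z a Complex.I / confFactor g f z / 2) • mapDeriv E f z 1) :
        CTangent E (f z)) := by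
  have h0 : ∀ ξ, innerDeriv g f z (0 : E) ξ = 0 := fun ξ => by simp [innerDeriv]
  rw [proj01, cmul_dZbar, cinner_dZ, h0, h0]
  simp only [Complex.re_ofReal_mul, Complex.im_ofReal_mul]
  have e1 : 2 / confFactor g f z * ((innerDeriv g f z a 1 + 0) / 2) / 2
      = innerDeriv g f z a 1 / confFactor g f z / 2 := by ring
  have e2 : 2 / confFactor g f z * ((0 - innerDeriv g f z a Complex.I) / 2) / 2
      = -(innerDeriv g f z a Complex.I / confFactor g f z / 2) := by ring
  have e3 : ∀ (r r' : ℝ) (b b' : E), ((r • b - (-r') • b', r • b' + (-r') • b) : E × E)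
      = (r • b + r' • b', r • b' - r' • b) := fun r r' b b' => by
    rw [neg_smul, neg_smul, sub_neg_eq_add, sub_eq_add_neg]
  rw [e1, e2]
  exact e3 _ _ _ _

/-- The pulled back metric is conformal at `z`. -/
def ConformalAt (g : RMetric E N) (f : ℂ → N) (z : ℂ) : Prop :=
  pullback g f 1 1 z = pullback g f Complex.I Complex.I z ∧ pullback g f 1 Complex.I z = 0

/-- The vectors p, m, n stand for ∇_x f_x, ∇_x f_y = ∇_y f_x and ∇_y f_y; using one m for both mixed
derivatives encodes vanishing torsion. -/
theorem covDz_dZ (g : RMetric E N) (f : ℂ → N) (z : ℂ) {p m n : E}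
    (hp : covAt g f (fun w => (1 / 2 : ℝ) • mapDeriv E f w 1) z 1 = (1 / 2 : ℝ) • p)
    (hm : covAt g f (fun w => (1 / 2 : ℝ) • mapDeriv E f w 1) z Complex.I = (1 / 2 : ℝ) • m)
    (hm' : covAt g f (fun w => -((1 / 2 : ℝ) • mapDeriv E f w Complex.I)) z 1
      = -((1 / 2 : ℝ) • m))
    (hn : covAt g f (fun w => -((1 / 2 : ℝ) • mapDeriv E f w Complex.I)) z Complex.I
      = -((1 / 2 : ℝ) • n)) :
    covDz g f (dZ f) z
      = (((1 / 4 : ℝ) • (p - n), -((1 / 2 : ℝ) • m)) : CTangent E (f z)) := by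
  have h : covDz g f (dZ f) z =
      ((1 / 2 : ℝ) • (covAt g f (fun w => (1 / 2 : ℝ) • mapDeriv E f w 1) z 1
        + covAt g f (fun w => -((1 / 2 : ℝ) • mapDeriv E f w Complex.I)) z Complex.I),
      (1 / 2 : ℝ) • (covAt g f (fun w => -((1 / 2 : ℝ) • mapDeriv E f w Complex.I)) z 1
        - covAt g f (fun w => (1 / 2 : ℝ) • mapDeriv E f w 1) z Complex.I)) := rfl
  rw [h, hp, hm, hm', hn]
  refine Prod.ext ?_ ?_
  · show (1 / 2 : ℝ) • ((1 / 2 : ℝ) • p + -((1 / 2 : ℝ) • n)) = (1 / 4 : ℝ) • (p - n)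
    module
  · show (1 / 2 : ℝ) • (-((1 / 2 : ℝ) • m) - (1 / 2 : ℝ) • m) = -((1 / 2 : ℝ) • m)
    module

theorem innerAt_ext (g : RMetric E N) (q : N) {a b : E}
    (h : ∀ c, innerAt g q a c = innerAt g q b c) : a = b := by
  by_contra hne
  have h1 : 0 < innerAt g q (a - b) (a - b) := g.pos q (a - b) (sub_ne_zero.2 hne)
  have h2 := h (a - b)
  rw [← sub_eq_zero, ← sub_apply, ← map_sub] at h2
  exact h1.ne' h2

/-- Homogeneity of the chosen Christoffel vector is not definitional; it follows from the Koszul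
formula and nondegeneracy of the metric. -/
theorem covAt_const_smul (g : RMetric E N) {f : ℂ → N} {Z : ℂ → E} {z : ℂ}
    (hZ : DifferentiableAt ℝ (fun w => chartDeriv (f z) (f w) (Z w)) z) (c : ℝ) (ξ : ℂ) :
    covAt g f (fun w => c • Z w) z ξ = c • covAt g f Z z ξ := by
  have h1 : christoffelAt g (f z) (mapDeriv E f z ξ) (c • Z z)
      = c • christoffelAt g (f z) (mapDeriv E f z ξ) (Z z) := by
    refine innerAt_ext g (f z) fun w => ?_
    simp only [innerAt_christoffelAt, map_smul, smul_apply, smul_eq_mul]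
    ring
  rw [covAt_eq, covAt_eq, h1, smul_add]
  simp only [map_smul]
  rw [fderiv_fun_const_smul hZ]
  rfl

/-- Differentiating an identity between inner products with the partial derivatives. -/
theorem LocalVariation.innerDeriv_covAt {f : ℂ → N} {V : ℂ → E} {W : ℝ × ℂ → N}
    {O : Set (ℝ × ℂ)} (h : LocalVariation f V W O) (g : RMetric E N) {z : ℂ} (hz : (0, z) ∈ O)
    {Z Z' : ℂ → E}
    (hZ : DifferentiableAt ℝ (fun w => chartDeriv (f z) (f w) (Z w)) z)
    (hZ' : DifferentiableAt ℝ (fun w => chartDeriv (f z) (f w) (Z' w)) z)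
    {c : ℝ} {η η' : ℂ}
    (heq : ∀ᶠ w in 𝓝 z, innerDeriv g f w (Z w) η = c * innerDeriv g f w (Z' w) η') (ξ : ℂ) :
    innerDeriv g f z (covAt g f Z z ξ) η
        + innerAt g (f z) (Z z) (covAt g f (fun w => mapDeriv E f w η) z ξ)
      = c * (innerDeriv g f z (covAt g f Z' z ξ) η'
        + innerAt g (f z) (Z' z) (covAt g f (fun w => mapDeriv E f w η') z ξ)) := by
  obtain ⟨-, e₁⟩ := hasFDerivAt_innerAt g (h.mdifferentiableAt_map hz) hZ
    (h.differentiableAt_mapDeriv hz η)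
  obtain ⟨d₂, e₂⟩ := hasFDerivAt_innerAt g (h.mdifferentiableAt_map hz) hZ'
    (h.differentiableAt_mapDeriv hz η')
  have e₃ : (fun w => innerAt g (f w) (Z w) (mapDeriv E f w η)) =ᶠ[𝓝 z]
      fun w => c * innerAt g (f w) (Z' w) (mapDeriv E f w η') := heq
  rw [innerDeriv, innerDeriv, ← e₁, ← e₂, e₃.fderiv_eq, fderiv_const_mul d₂]
  rfl

theorem LocalVariation.contMDiffOn_map {f : ℂ → N} {V : ℂ → E} {W : ℝ × ℂ → N}
    {O : Set (ℝ × ℂ)} (h : LocalVariation f V W O) :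
    ContMDiffOn 𝓘(ℝ, ℂ) 𝓘(ℝ, E) ∞ f ((fun z : ℂ => ((0 : ℝ), z)) ⁻¹' O) := by
  have hi : ContMDiff 𝓘(ℝ, ℂ) 𝓘(ℝ, ℝ × ℂ) ∞ (fun z : ℂ => ((0 : ℝ), z)) :=
    contMDiff_iff_contDiff.2 (contDiff_const.prodMk contDiff_id)
  exact (h.smooth.comp hi.contMDiffOn fun z hz => hz).congr fun z hz => (h.initial z hz).symm

theorem cnormSq_cmul_dZbar (g : RMetric E N) (f : ℂ → N) (z : ℂ) (c : ℂ) :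
    cnormSq g (cmul c (dZbar f z)) = Complex.normSq c * confFactor g f z / 2 := by
  rw [cmul_dZbar, confFactor_eq]
  have h : ∀ a b : E, cnormSq g ((a, b) : CTangent E (f z))
      = innerAt g (f z) a a + innerAt g (f z) b b := fun a b => rfl
  rw [h, Complex.normSq_apply, pullback, pullback]
  have hs := innerAt_symm g (f z) (mapDeriv E f z 1) (mapDeriv E f z Complex.I)
  simp only [map_add, map_sub, map_smul, add_apply, sub_apply, smul_apply, smul_eq_mul, hs]
  ring

theorem cmul_dZ (f : ℂ → N) (z : ℂ) (c : ℂ) :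
    cmul c (dZ f z) = (((c.re / 2) • mapDeriv E f z 1 + (c.im / 2) • mapDeriv E f z Complex.I,
      -((c.re / 2) • mapDeriv E f z Complex.I) + (c.im / 2) • mapDeriv E f z 1) :
        CTangent E (f z)) := by
  have h : cmul c (dZ f z) = ((c.re • (1 / 2 : ℝ) • mapDeriv E f z 1
      - c.im • -((1 / 2 : ℝ) • mapDeriv E f z Complex.I),
      c.re • -((1 / 2 : ℝ) • mapDeriv E f z Complex.I) + c.im • (1 / 2 : ℝ) • mapDeriv E f z 1) :
      E × E) := rfl
  rw [h]
  simp only [smul_neg, sub_neg_eq_add, smul_smul, mul_one_div]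
  rfl

/-- The normal projection does not change the inner product with a normal vector. -/
theorem cinner_norProj (g : RMetric E N) (f : ℂ → N) (z : ℂ) {a : E}
    (ha : ∀ ξ, innerDeriv g f z a ξ = 0) (P Q : E) :
    cinner g ((a, (0 : E)) : CTangent E (f z)) (norProj g f z ((P, Q) : CTangent E (f z)))
      = ⟨innerAt g (f z) a P, innerAt g (f z) a Q⟩ := by
  have h : ∀ C D : E, cinner g ((a, (0 : E)) : CTangent E (f z)) ((C, D) : CTangent E (f z))
      = ⟨innerAt g (f z) a C, innerAt g (f z) a D⟩ := fun C D => by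
    have h' : cinner g ((a, (0 : E)) : CTangent E (f z)) ((C, D) : CTangent E (f z))
      = ⟨innerAt g (f z) a C - innerAt g (f z) 0 D, innerAt g (f z) a D + innerAt g (f z) 0 C⟩ :=
      rfl
    rw [h']
    simp
  have hn : ∃ r₁ r₂ r₃ r₄ : ℝ, norProj g f z ((P, Q) : CTangent E (f z))
      = ((P - (r₁ • mapDeriv E f z 1 + r₂ • mapDeriv E f z Complex.I),
        Q - (r₃ • mapDeriv E f z 1 + r₄ • mapDeriv E f z Complex.I)) : CTangent E (f z)) := by
    rw [norProj, tanProj, proj10, proj01, cmul_dZ, cmul_dZbar]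
    generalize ((2 / confFactor g f z : ℝ) * cinner g ((P, Q) : CTangent E (f z)) (dZbar f z)) = c
    generalize ((2 / confFactor g f z : ℝ) * cinner g ((P, Q) : CTangent E (f z)) (dZ f z)) = d
    refine ⟨c.re / 2 + d.re / 2, c.im / 2 - d.im / 2, c.im / 2 + d.im / 2, d.re / 2 - c.re / 2,
      Prod.ext ?_ ?_⟩
    · show P - (((c.re / 2) • mapDeriv E f z 1 + (c.im / 2) • mapDeriv E f z Complex.I)
        + ((d.re / 2) • mapDeriv E f z 1 - (d.im / 2) • mapDeriv E f z Complex.I)) = P - _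
      module
    · show Q - ((-((c.re / 2) • mapDeriv E f z Complex.I) + (c.im / 2) • mapDeriv E f z 1)
        + ((d.re / 2) • mapDeriv E f z Complex.I + (d.im / 2) • mapDeriv E f z 1)) = Q - _
      module
  obtain ⟨r₁, r₂, r₃, r₄, hr⟩ := hn
  have h1 : innerAt g (f z) a (mapDeriv E f z 1) = 0 := ha 1
  have h2 : innerAt g (f z) a (mapDeriv E f z Complex.I) = 0 := ha Complex.I
  rw [hr, h]
  simp [h1, h2]

theorem cmul_sub_cmul_dZbar (f : ℂ → N) (z c d : ℂ) :
    cmul c (dZbar f z) - cmul d (dZbar f z) = cmul (E := E) (c - d) (dZbar f z) := by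
  rw [cmul_dZbar, cmul_dZbar, cmul_dZbar, Complex.sub_re, Complex.sub_im]
  refine Prod.ext ?_ ?_
  · show ((c.re / 2) • mapDeriv E f z 1 - (c.im / 2) • mapDeriv E f z Complex.I)
      - ((d.re / 2) • mapDeriv E f z 1 - (d.im / 2) • mapDeriv E f z Complex.I)
      = ((c.re - d.re) / 2) • mapDeriv E f z 1 - ((c.im - d.im) / 2) • mapDeriv E f z Complex.I
    module
  · show ((c.re / 2) • mapDeriv E f z Complex.I + (c.im / 2) • mapDeriv E f z 1)
      - ((d.re / 2) • mapDeriv E f z Complex.I + (d.im / 2) • mapDeriv E f z 1)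
      = ((c.re - d.re) / 2) • mapDeriv E f z Complex.I + ((c.im - d.im) / 2) • mapDeriv E f z 1
    module

theorem zero_cmul_dZ (f : ℂ → N) (z : ℂ) : cmul (E := E) 0 (dZ f z) = 0 := by
  rw [cmul_dZ]
  refine Prod.ext ?_ ?_
  · show ((0 : ℝ) / 2) • mapDeriv E f z 1 + ((0 : ℝ) / 2) • mapDeriv E f z Complex.I = 0
    simp
  · show -(((0 : ℝ) / 2) • mapDeriv E f z Complex.I) + ((0 : ℝ) / 2) • mapDeriv E f z 1 = 0
    simp

theorem eta_eq (g : RMetric E N) (f : ℂ → N) (σ s : ℂ → E) (z : ℂ) :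
    eta g f σ s z = tanProj g f z
        (covDz g f (fun w => proj01 g f w ((σ w, (0 : E)) : CTangent E (f w))) z)
      - cmul ((2 / confFactor g f z : ℝ)
        * cinner g ((s z, (0 : E)) : CTangent E (f z)) (secondFundZZ g f z)) (dZbar f z) := rfl

/-- The conformal defect vanishes by convention where the differential does. -/
theorem cnormSq_eta_of_confFactor_eq_zero (g : RMetric E N) (f : ℂ → N) (σ s : ℂ → E) (z : ℂ)
    (hz : confFactor g f z = 0) : cnormSq g (eta g f σ s z) = 0 := by
  have h : eta g f σ s z = cmul 0 (dZbar f z) := by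
    rw [eta_eq, tanProj, proj10, proj01, hz]
    simp only [div_zero, Complex.ofReal_zero, zero_mul]
    -- Division by zero makes the coefficient 2/e^{2λ} vanish, so both projections and the curvature
    -- term are zero multiples of the frame.
    rw [zero_cmul_dZ, zero_add, cmul_sub_cmul_dZbar, sub_zero]
  rw [h, cnormSq_cmul_dZbar, map_zero]
  simp

/-- The conformal defect in terms of the first variation of the pulled back metric. -/
theorem LocalVariation.cnormSq_eta {f : ℂ → N} {V : ℂ → E} {W : ℝ × ℂ → N}
    {O : Set (ℝ × ℂ)} (h : LocalVariation f V W O) (g : RMetric E N) {z : ℂ} (hz : (0, z) ∈ O)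
    {σ s : ℂ → E} (hsum : ∀ᶠ w in 𝓝 z, V w = σ w + s w)
    (hs : ∀ᶠ w in 𝓝 z, ∀ ξ, innerDeriv g f w (s w) ξ = 0)
    (hσ : ∃ r₁ r₂ : ℝ, σ z = r₁ • mapDeriv E f z 1 + r₂ • mapDeriv E f z Complex.I)
    (hconf : ∀ᶠ w in 𝓝 z, ConformalAt g f w) (hpos : 0 < confFactor g f z) :
    cnormSq g (eta g f σ s z)
      = (((pullbackVar g f V 1 1 z - pullbackVar g f V Complex.I Complex.I z) / 2) ^ 2
        + pullbackVar g f V 1 Complex.I z ^ 2) / (8 * confFactor g f z) := by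
  set a : ℂ → E := fun w => mapDeriv E f w 1 with ha
  set b : ℂ → E := fun w => mapDeriv E f w Complex.I with hb
  set e : ℂ → ℝ := fun w => confFactor g f w with he
  have hfd := h.mdifferentiableAt_map hz
  have hVd := h.differentiableAt_field hz
  have had := h.differentiableAt_mapDeriv hz 1
  have hbd := h.differentiableAt_mapDeriv hz Complex.I
  have hed : DifferentiableAt ℝ e z := by
    have : e = fun w => (pullback g f 1 1 w + pullback g f Complex.I Complex.I w) * 2⁻¹ :=
      funext fun w => (confFactor_eq g f w).trans (div_eq_mul_inv _ _)
    rw [this]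
    exact (DifferentiableAt.fun_add (hasFDerivAt_innerAt g hfd had had).1
      (hasFDerivAt_innerAt g hfd hbd hbd).1).mul_const _
  have hepos : ∀ᶠ w in 𝓝 z, 0 < e w := hed.continuousAt.eventually (lt_mem_nhds hpos)
  have haa : ∀ᶠ w in 𝓝 z, innerDeriv g f w (a w) 1 = e w := by
    filter_upwards [hconf] with w hw
    have := hw.1
    simp only [he, confFactor_eq, ← this]
    simp only [innerDeriv, pullback, ha]
    ring
  have hbb : ∀ᶠ w in 𝓝 z, innerDeriv g f w (b w) Complex.I = e w := by
    filter_upwards [hconf] with w hw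
    have := hw.1
    simp only [he, confFactor_eq, this]
    simp only [innerDeriv, pullback, hb]
    ring
  have hab : ∀ᶠ w in 𝓝 z, innerDeriv g f w (a w) Complex.I = 0 := by
    filter_upwards [hconf] with w hw using hw.2
  have hba : ∀ᶠ w in 𝓝 z, innerDeriv g f w (b w) 1 = 0 := by
    filter_upwards [hab] with w hw
    rw [innerDeriv, innerAt_symm]
    exact hw
  set α : ℂ → ℝ := fun w => innerDeriv g f w (σ w) 1 / e w / 2 with hα
  set β : ℂ → ℝ := fun w => innerDeriv g f w (σ w) Complex.I / e w / 2 with hβ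
  -- No regularity of σ is assumed. Its pairings with the frame are those of the smooth field V,
  -- because s is normal, and hence they are differentiable.
  have hσV : ∀ ξ, ∀ᶠ w in 𝓝 z, innerDeriv g f w (σ w) ξ = innerDeriv g f w (V w) ξ := by
    intro ξ
    filter_upwards [hsum, hs] with w hw hw'
    have := hw' ξ
    rw [innerDeriv] at this
    rw [innerDeriv, innerDeriv, hw, map_add, add_apply, this, add_zero]
  have hσd : ∀ ξ, DifferentiableAt ℝ (fun w => innerDeriv g f w (σ w) ξ) z := fun ξ =>
    (hasFDerivAt_innerAt g hfd hVd (h.differentiableAt_mapDeriv hz ξ)).1.congr_of_eventuallyEq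
      (hσV ξ)
  have hdiv : ∀ φ : ℂ → ℝ, DifferentiableAt ℝ φ z →
      DifferentiableAt ℝ (fun w => φ w / e w / 2) z := by
    intro φ hφ
    have h0 : e z ≠ 0 := hpos.ne'
    simp only [div_eq_mul_inv]
    exact (hφ.fun_mul (hed.fun_inv h0)).mul_const _
  have hαd : DifferentiableAt ℝ α z := hdiv _ (hσd 1)
  have hβd : DifferentiableAt ℝ β z := hdiv _ (hσd Complex.I)
  -- `Z₁` and `Z₂` are the real and imaginary parts of σ^{0,1}. Their pairings with the frame are
  -- ±1/2 times those of V, and differentiating these identities yields the tangential part of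
  -- ∇σ^{0,1} without derivatives of α and β.
  set Z₁ : ℂ → E := fun w => α w • a w + β w • b w with hZ₁
  set Z₂ : ℂ → E := fun w => α w • b w - β w • a w with hZ₂
  have hZ₁d : DifferentiableAt ℝ (fun w => chartDeriv (f z) (f w) (Z₁ w)) z := by
    simp only [hZ₁, map_add, map_smul]
    exact (hαd.smul had).add (hβd.smul hbd)
  have hZ₂d : DifferentiableAt ℝ (fun w => chartDeriv (f z) (f w) (Z₂ w)) z := by
    simp only [hZ₂, map_sub, map_smul]
    exact (hαd.smul hbd).sub (hβd.smul had)
  have lin₁ : ∀ w ξ, innerDeriv g f w (Z₁ w) ξ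
      = α w * innerDeriv g f w (a w) ξ + β w * innerDeriv g f w (b w) ξ := fun w ξ => by
    simp [innerDeriv, hZ₁]
  have lin₂ : ∀ w ξ, innerDeriv g f w (Z₂ w) ξ
      = α w * innerDeriv g f w (b w) ξ - β w * innerDeriv g f w (a w) ξ := fun w ξ => by
    simp [innerDeriv, hZ₂]
  have q₁a : ∀ᶠ w in 𝓝 z, innerDeriv g f w (Z₁ w) 1 = 1 / 2 * innerDeriv g f w (V w) 1 := by
    filter_upwards [haa, hba, hσV 1, hepos] with w h1 h2 h3 h4
    rw [lin₁, h1, h2, ← h3]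
    simp only [hα]
    field_simp
    ring
  have q₁b : ∀ᶠ w in 𝓝 z, innerDeriv g f w (Z₁ w) Complex.I
      = 1 / 2 * innerDeriv g f w (V w) Complex.I := by
    filter_upwards [hbb, hab, hσV Complex.I, hepos] with w h1 h2 h3 h4
    rw [lin₁, h1, h2, ← h3]
    simp only [hβ]
    field_simp
    ring
  have q₂a : ∀ᶠ w in 𝓝 z, innerDeriv g f w (Z₂ w) 1
      = -(1 / 2) * innerDeriv g f w (V w) Complex.I := by
    filter_upwards [haa, hba, hσV Complex.I, hepos] with w h1 h2 h3 h4
    rw [lin₂, h1, h2, ← h3]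
    simp only [hβ]
    field_simp
    ring
  have q₂b : ∀ᶠ w in 𝓝 z, innerDeriv g f w (Z₂ w) Complex.I
      = 1 / 2 * innerDeriv g f w (V w) 1 := by
    filter_upwards [hbb, hab, hσV 1, hepos] with w h1 h2 h3 h4
    rw [lin₂, h1, h2, ← h3]
    simp only [hα]
    field_simp
    ring
  have hα_z : σ z = (2 * α z) • a z + (2 * β z) • b z := by
    obtain ⟨r₁, r₂, hr⟩ := hσ
    have h1 : innerDeriv g f z (σ z) 1 = r₁ * e z := by
      have h2 := haa.self_of_nhds
      have h3 := hba.self_of_nhds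
      rw [innerDeriv] at h2 h3 ⊢
      rw [hr]
      simp only [map_add, map_smul, add_apply, smul_apply, smul_eq_mul]
      simp only [ha, hb] at h2 h3
      rw [h2, h3]
      ring
    have h1' : innerDeriv g f z (σ z) Complex.I = r₂ * e z := by
      have h2 := hbb.self_of_nhds
      have h3 := hab.self_of_nhds
      rw [innerDeriv] at h2 h3 ⊢
      rw [hr]
      simp only [map_add, map_smul, add_apply, smul_apply, smul_eq_mul]
      simp only [ha, hb] at h2 h3
      rw [h2, h3]
      ring
    have h4 : 2 * α z = r₁ := by
      simp only [hα, h1]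
      have : e z ≠ 0 := hpos.ne'
      field_simp
    have h5 : 2 * β z = r₂ := by
      simp only [hβ, h1']
      have : e z ≠ 0 := hpos.ne'
      field_simp
    rw [h4, h5, hr]
  have hVz : V z = (2 * α z) • a z + (2 * β z) • b z + s z := by
    rw [hsum.self_of_nhds, hα_z]
  set p := covAt g f a z 1 with hp
  set m := covAt g f a z Complex.I with hm
  set n := covAt g f b z Complex.I with hn
  have hm' : covAt g f b z 1 = m :=
    covAt_mapDeriv_comm g (h.isOpen.preimage (Continuous.prodMk_right 0)) h.contMDiffOn_map hz
      Complex.I 1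
  have Vin : ∀ c, innerAt g (f z) (V z) c = 2 * α z * innerAt g (f z) (a z) c
      + 2 * β z * innerAt g (f z) (b z) c + innerAt g (f z) (s z) c := fun c => by
    rw [hVz]
    simp
  have Zin₁ : ∀ c, innerAt g (f z) (Z₁ z) c = α z * innerAt g (f z) (a z) c
      + β z * innerAt g (f z) (b z) c := fun c => by simp [hZ₁]
  have Zin₂ : ∀ c, innerAt g (f z) (Z₂ z) c = α z * innerAt g (f z) (b z) c
      - β z * innerAt g (f z) (a z) c := fun c => by simp [hZ₂]
  have sym : ∀ c ξ, innerDeriv g f z c ξ = innerAt g (f z) (mapDeriv E f z ξ) c := fun c ξ =>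
    innerAt_symm g _ _ _
  have hc1 : ∀ᶠ w in 𝓝 z, innerDeriv g f w (a w) 1 = 1 * innerDeriv g f w (b w) Complex.I := by
    filter_upwards [haa, hbb] with w h1 h2
    rw [h1, h2, one_mul]
  have hc2 : ∀ᶠ w in 𝓝 z, innerDeriv g f w (a w) Complex.I
      = 0 * innerDeriv g f w (b w) Complex.I := by
    filter_upwards [hab] with w h1
    rw [h1, zero_mul]
  have c1 := h.innerDeriv_covAt g hz had hbd hc1 1
  have c2 := h.innerDeriv_covAt g hz had hbd hc1 Complex.I
  have c3 := h.innerDeriv_covAt g hz had hbd hc2 1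
  have c4 := h.innerDeriv_covAt g hz had hbd hc2 Complex.I
  have d1 := h.innerDeriv_covAt g hz hZ₁d hVd q₁a 1
  have d2 := h.innerDeriv_covAt g hz hZ₁d hVd q₁a Complex.I
  have d3 := h.innerDeriv_covAt g hz hZ₁d hVd q₁b 1
  have d4 := h.innerDeriv_covAt g hz hZ₁d hVd q₁b Complex.I
  have d5 := h.innerDeriv_covAt g hz hZ₂d hVd q₂a 1
  have d6 := h.innerDeriv_covAt g hz hZ₂d hVd q₂a Complex.I
  have d7 := h.innerDeriv_covAt g hz hZ₂d hVd q₂b 1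
  have d8 := h.innerDeriv_covAt g hz hZ₂d hVd q₂b Complex.I
  clear_value Z₁ Z₂ α β
  set P := (1 / 2 : ℝ) • (covAt g f Z₁ z 1 + covAt g f Z₂ z Complex.I) with hP
  set Q := (1 / 2 : ℝ) • (covAt g f Z₂ z 1 - covAt g f Z₁ z Complex.I) with hQ
  simp only [← ha, ← hb, hm', ← hp, ← hm, ← hn] at c1 c2 c3 c4
  simp only [← ha, ← hb, hm', ← hp, ← hm, ← hn, Zin₁, Zin₂, Vin] at d1 d2 d3 d4 d5 d6 d7 d8
  have sym1 : ∀ c, innerDeriv g f z c 1 = innerAt g (f z) (a z) c := fun c => sym c 1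
  have sym2 : ∀ c, innerDeriv g f z c Complex.I = innerAt g (f z) (b z) c := fun c => sym c _
  have ea : mapDeriv E f z 1 = a z := rfl
  have eb : mapDeriv E f z Complex.I = b z := rfl
  rw [ea, eb, sym1, sym2] at c1 c2
  rw [ea, sym2, zero_mul] at c3 c4
  -- The derivatives of |f_x|² = |f_y|² and ⟨f_x, f_y⟩ = 0 express every tangential component of p,
  -- m, n by ⟨f_x, p⟩ and ⟨f_x, m⟩.
  have r1 : innerAt g (f z) (b z) m = innerAt g (f z) (a z) p := by linarith
  have r2 : innerAt g (f z) (b z) n = innerAt g (f z) (a z) m := by linarith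
  have r3 : innerAt g (f z) (b z) p = -innerAt g (f z) (a z) m := by linarith
  have r4 : innerAt g (f z) (a z) n = -innerAt g (f z) (a z) p := by linarith
  rw [r3] at d1 d5
  rw [r1] at d2 d3 d6 d7
  rw [r3] at d7
  rw [r2, r4] at d4 d8
  rw [r4, r2] at d6
  rw [r1] at d5 d8
  have innP : ∀ ξ, innerDeriv g f z P ξ = 1 / 2 * (innerDeriv g f z (covAt g f Z₁ z 1) ξ
      + innerDeriv g f z (covAt g f Z₂ z Complex.I) ξ) := fun ξ => by
    simp only [innerDeriv, hP, map_add, map_smul, add_apply, smul_apply, smul_eq_mul]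
  have innQ : ∀ ξ, innerDeriv g f z Q ξ = 1 / 2 * (innerDeriv g f z (covAt g f Z₂ z 1) ξ
      - innerDeriv g f z (covAt g f Z₁ z Complex.I) ξ) := fun ξ => by
    simp only [innerDeriv, hQ, map_sub, map_smul, sub_apply, smul_apply, smul_eq_mul]
  -- Here X - iY = 4⟨∇_z V, f_z⟩, that is, X and Y are the first variations of h₁ and h₂.
  set X := innerDeriv g f z (covAt g f V z 1) 1 - innerDeriv g f z (covAt g f V z Complex.I)
    Complex.I with hX
  set Y := innerDeriv g f z (covAt g f V z 1) Complex.I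
    + innerDeriv g f z (covAt g f V z Complex.I) 1 with hY
  have P1 : innerDeriv g f z P 1
      = (X + innerAt g (f z) (s z) p - innerAt g (f z) (s z) n) / 4 := by
    rw [innP, hX]; linarith
  have P2 : innerDeriv g f z P Complex.I = (Y + 2 * innerAt g (f z) (s z) m) / 4 := by
    rw [innP, hY]; linarith
  have Q1 : innerDeriv g f z Q 1 = -(Y + 2 * innerAt g (f z) (s z) m) / 4 := by
    rw [innQ, hY]; linarith
  have Q2 : innerDeriv g f z Q Complex.I
      = (X + innerAt g (f z) (s z) p - innerAt g (f z) (s z) n) / 4 := by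
    rw [innQ, hX]; linarith
  have hfun : (fun w => proj01 g f w ((σ w, (0 : E)) : CTangent E (f w)))
      = fun w => ((Z₁ w, Z₂ w) : CTangent E (f w)) := by
    funext w
    rw [hZ₁, hZ₂, hα, hβ]
    exact proj01_real g f w (σ w)
  have hcov : covDz g f (fun w => ((Z₁ w, Z₂ w) : CTangent E (f w))) z
      = ((P, Q) : CTangent E (f z)) := rfl
  have hA : covDz g f (dZ f) z
      = (((1 / 4 : ℝ) • (p - n), -((1 / 2 : ℝ) • m)) : CTangent E (f z)) := by
    have hneg : (fun w => -((1 / 2 : ℝ) • mapDeriv E f w Complex.I))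
        = fun w => (-(1 / 2) : ℝ) • b w := funext fun w => (neg_smul _ _).symm
    refine covDz_dZ g f z (covAt_const_smul g had _ _) (covAt_const_smul g had _ _) ?_ ?_
    · rw [hneg, covAt_const_smul g hbd, neg_smul, hm']
    · rw [hneg, covAt_const_smul g hbd, neg_smul]
  have hc : eta g f σ s z = cmul ((2 / e z : ℝ) * ⟨X / 4, -Y / 4⟩) (dZbar f z) := by
    rw [eta_eq, hfun, hcov, tanProj, proj10, proj01, cinner_dZbar, cinner_dZ, P1, P2, Q1, Q2,
      secondFundZZ, hA, cinner_norProj g f z hs.self_of_nhds]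
    -- The (1,0) part of ∇_z σ^{0,1} vanishes, so its tangential part is a multiple of f_z̄ alone.
    have z1 : ((⟨((X + innerAt g (f z) (s z) p - innerAt g (f z) (s z) n) / 4
        - (X + innerAt g (f z) (s z) p - innerAt g (f z) (s z) n) / 4) / 2,
        (-(Y + 2 * innerAt g (f z) (s z) m) / 4 + (Y + 2 * innerAt g (f z) (s z) m) / 4) / 2⟩ : ℂ))
        = 0 := Complex.ext (by simp) (by simp; ring)
    rw [z1, mul_zero, zero_cmul_dZ, zero_add, cmul_sub_cmul_dZbar, ← mul_sub]
    -- The remaining coefficient contains ⟨s, (p - n)/4 - i m/2⟩, which is ⟨s, A(f_z, f_z)⟩ and is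
    -- subtracted by the second term of η.
    congr 2
    refine Complex.ext ?_ ?_
    · simp only [Complex.sub_re, map_smul, map_sub, smul_eq_mul]
      ring
    · simp only [Complex.sub_im, map_smul, map_neg, smul_eq_mul]
      ring
  have hvar1 : (pullbackVar g f V 1 1 z - pullbackVar g f V Complex.I Complex.I z) / 2 = X := by
    rw [pullbackVar, pullbackVar, innerAt_symm g _ (mapDeriv E f z 1),
      innerAt_symm g _ (mapDeriv E f z Complex.I), hX, innerDeriv, innerDeriv]
    ring
  have hvar2 : pullbackVar g f V 1 Complex.I z = Y := by
    rw [pullbackVar, innerAt_symm g _ (mapDeriv E f z 1), hY, innerDeriv, innerDeriv]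
  have he0 : e z ≠ 0 := hpos.ne'
  rw [hc, cnormSq_cmul_dZbar, hvar1, hvar2]
  change Complex.normSq _ * e z / 2 = _ / (8 * e z)
  rw [map_mul, Complex.normSq_ofReal, Complex.normSq_mk]
  field_simp
  ring

end ConformalDefect

/-! ### The scalar inequality behind the uniform bound, and the pointwise limit. -/

section AreaDefect

/-- The claim is (e - H/e)² ≤ e² - H, which after expansion is H ≤ e². -/
theorem sub_sqrt_le_div {e H : ℝ} (he : 0 < e) (hH : 0 ≤ H) (hHe : H ≤ e ^ 2) :
    e - √(e ^ 2 - H) ≤ H / e := by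
  have h1 : e - H / e ≤ √(e ^ 2 - H) := by
    refine Real.le_sqrt_of_sq_le ?_
    have h2 : (e - H / e) ^ 2 = e ^ 2 - 2 * H + H * (H / e ^ 2) := by field_simp; ring
    have h3 : H / e ^ 2 ≤ 1 := (div_le_one (by positivity)).2 hHe
    nlinarith
  linarith

/-- If `|h| ≤ e` are smooth families with `h = 0` at time `0`, then `e - √(e² - |h|²)` is bounded
by a multiple of `t²`, which depends only on the bounds of the second derivatives. -/
theorem sub_sqrt_le_sq {e h₁ h₂ : ℝ → ℝ} {e₀ e₁ k₁ k₂ m r : ℝ} (hm : 0 < m) (hr : 0 < r)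
    (he : ∀ t, |t| ≤ r → 0 ≤ e t) (hh : ∀ t, |t| ≤ r → h₁ t ^ 2 + h₂ t ^ 2 ≤ e t ^ 2)
    (he₀ : 0 ≤ e₀) (he₀m : e₀ ≤ m ^ 2 * r ^ 2)
    (te : ∀ t, |t| ≤ r → |e t - e₀ - t * e₁| ≤ m ^ 2 * t ^ 2)
    (t₁ : ∀ t, |t| ≤ r → |h₁ t - t * k₁| ≤ m ^ 2 * t ^ 2)
    (t₂ : ∀ t, |t| ≤ r → |h₂ t - t * k₂| ≤ m ^ 2 * t ^ 2) {t : ℝ} (ht : |t| ≤ r) :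
    e t - √(e t ^ 2 - h₁ t ^ 2 - h₂ t ^ 2) ≤ 144 * m ^ 2 * t ^ 2 := by
  set s := √e₀ with hs
  have hs0 : 0 ≤ s := Real.sqrt_nonneg _
  have hss : s ^ 2 = e₀ := Real.sq_sqrt he₀
  have hsm : s ≤ m * r := by
    refine abs_le_of_sq_le_sq' ?_ (by positivity) |>.2
    rw [hss]; nlinarith
  -- Nonnegativity of e at both τ and -τ bounds the slope of e; then |h_i| ≤ e at τ bounds the
  -- slopes of h₁ and h₂.
  have aux : ∀ τ, 0 < τ → τ ≤ r → τ * |e₁| ≤ s ^ 2 + m ^ 2 * τ ^ 2 ∧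
      τ * |k₁| ≤ 2 * s ^ 2 + 3 * (m ^ 2 * τ ^ 2) ∧ τ * |k₂| ≤ 2 * s ^ 2 + 3 * (m ^ 2 * τ ^ 2) := by
    intro τ hτ hτr
    have a1 : |τ| ≤ r := by rwa [abs_of_pos hτ]
    have a2 : |-τ| ≤ r := by rwa [abs_neg]
    have b1 := abs_le.1 (te τ a1)
    have b2 := abs_le.1 (te (-τ) a2)
    have c1 := he τ a1
    have c2 := he (-τ) a2
    have d1 : τ * |e₁| ≤ s ^ 2 + m ^ 2 * τ ^ 2 := by
      rw [← abs_of_pos hτ, ← abs_mul, abs_of_pos hτ, abs_le]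
      rw [hss]
      constructor <;> nlinarith
    have d2 : e τ ≤ 2 * s ^ 2 + 2 * (m ^ 2 * τ ^ 2) := by
      have := le_abs_self (τ * e₁)
      rw [abs_mul, abs_of_pos hτ] at this
      linarith [b1.2]
    have hb := hh τ a1
    have e1 : |h₁ τ| ≤ e τ := abs_le_of_sq_le_sq (by nlinarith [sq_nonneg (h₂ τ)]) c1
    have e2 : |h₂ τ| ≤ e τ := abs_le_of_sq_le_sq (by nlinarith [sq_nonneg (h₁ τ)]) c1
    have key : ∀ h k : ℝ, |h| ≤ e τ → |h - τ * k| ≤ m ^ 2 * τ ^ 2 →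
        τ * |k| ≤ 2 * s ^ 2 + 3 * (m ^ 2 * τ ^ 2) := by
      intro h k f1 f2
      have f3 : |τ * k| ≤ |h| + |h - τ * k| := by
        have := abs_sub h (h - τ * k)
        rwa [sub_sub_cancel] at this
      rw [abs_mul, abs_of_pos hτ] at f3
      linarith
    exact ⟨d1, key _ _ e1 (t₁ τ a1), key _ _ e2 (t₂ τ a1)⟩
  have main : |e₁| ≤ 2 * m * s ∧ |k₁| ≤ 5 * m * s ∧ |k₂| ≤ 5 * m * s := by
    rcases hs0.eq_or_lt with h0 | h0
    -- At a zero of e₀ the three slopes must vanish: divide by τ and let τ tend to 0.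
    · have lim : ∀ x C : ℝ, 0 ≤ C → (∀ τ, 0 < τ → τ ≤ r → τ * x ≤ C * τ ^ 2) → x ≤ 0 := by
        intro x C hC hx
        by_contra hpos
        push Not at hpos
        have hτ : 0 < min r (x / (2 * (C + 1))) := lt_min hr (by positivity)
        have h1 := hx _ hτ (min_le_left _ _)
        have h2 : min r (x / (2 * (C + 1))) ≤ x / (2 * (C + 1)) := min_le_right _ _
        set τ := min r (x / (2 * (C + 1)))
        have h3 : x ≤ C * τ := by
          have : τ * x ≤ τ * (C * τ) := by linarith [h1, (by ring : C * τ ^ 2 = τ * (C * τ))]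
          exact le_of_mul_le_mul_left this hτ
        rw [le_div_iff₀ (by positivity)] at h2
        nlinarith
      have hm2 : 0 ≤ m ^ 2 := by positivity
      refine ⟨?_, ?_, ?_⟩ <;> rw [← h0, mul_zero]
      · refine lim _ (m ^ 2) hm2 fun τ a b => ?_
        have := (aux τ a b).1
        rw [← h0] at this
        linarith
      · refine lim _ (3 * m ^ 2) (by positivity) fun τ a b => ?_
        have := (aux τ a b).2.1
        rw [← h0] at this
        linarith
      · refine lim _ (3 * m ^ 2) (by positivity) fun τ a b => ?_
        have := (aux τ a b).2.2
        rw [← h0] at this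
        linarith
    -- The choice τ = s/m balances s² against m²τ²; the hypothesis e₀ ≤ m²r² is what makes it
    -- admissible.
    · have hτ : 0 < s / m := by positivity
      have hτr : s / m ≤ r := by rw [div_le_iff₀ hm]; linarith
      obtain ⟨a, b, c⟩ := aux _ hτ hτr
      have hmτ : m ^ 2 * (s / m) ^ 2 = s ^ 2 := by field_simp
      rw [hmτ] at a b c
      have fin : ∀ x C : ℝ, s / m * x ≤ C * s ^ 2 → x ≤ C * m * s := by
        intro x C hx
        have : s / m * x ≤ s / m * (C * m * s) := by
          refine hx.trans_eq ?_
          field_simp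
        exact le_of_mul_le_mul_left this hτ
      exact ⟨fin _ 2 (by linarith), fin _ 5 (by linarith), fin _ 5 (by linarith)⟩
  obtain ⟨be, b₁, b₂⟩ := main
  have hT := abs_nonneg t
  have ht2 : t ^ 2 = |t| ^ 2 := (sq_abs t).symm
  have hE := abs_le.1 (te t ht)
  have hte : |t * e₁| ≤ |t| * (2 * m * s) := by rw [abs_mul]; gcongr
  have hte' := abs_le.1 hte
  rw [show e t ^ 2 - h₁ t ^ 2 - h₂ t ^ 2 = e t ^ 2 - (h₁ t ^ 2 + h₂ t ^ 2) by ring, ht2]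
  rw [ht2] at hE
  -- For s ≤ 8m|t| the value e t itself is at most (64 + 16 + 1) m²t². Otherwise e t ≥ s²/2 and
  -- |h_i| ≤ 6m|t|s, so (h₁² + h₂²)/e ≤ 72 m²t²s²/(s²/2), whence 144.
  rcases le_or_gt s (8 * m * |t|) with hc | hc
  · have h1 : e t ≤ s ^ 2 + |t| * (2 * m * s) + m ^ 2 * |t| ^ 2 := by linarith [hE.2, hte'.2]
    have h2 : s ^ 2 ≤ (8 * m * |t|) ^ 2 := by gcongr
    have h3 : |t| * (2 * m * s) ≤ |t| * (2 * m * (8 * m * |t|)) := by gcongr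
    have h4 := Real.sqrt_nonneg (e t ^ 2 - (h₁ t ^ 2 + h₂ t ^ 2))
    nlinarith [sq_nonneg (m * |t|)]
  · have hspos : 0 < s := lt_of_le_of_lt (by positivity) hc
    have hmt : m * |t| ≤ s / 8 := by linarith
    have hmt0 : 0 ≤ m * |t| := by positivity
    have h1 : s ^ 2 / 2 ≤ e t := by nlinarith [hE.1, hte'.1]
    have hbd : ∀ h k : ℝ, |h - t * k| ≤ m ^ 2 * t ^ 2 → |k| ≤ 5 * m * s →
        |h| ≤ 6 * (m * |t|) * s := by
      intro h k f1 f2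
      have f3 : |h| ≤ |t * k| + |h - t * k| := by
        have := abs_add_le (t * k) (h - t * k)
        rwa [add_sub_cancel] at this
      have f4 : |t * k| ≤ |t| * (5 * m * s) := by rw [abs_mul]; gcongr
      rw [ht2] at f1
      nlinarith
    have g₁ := hbd _ _ (t₁ t ht) b₁
    have g₂ := hbd _ _ (t₂ t ht) b₂
    have g₁' : h₁ t ^ 2 ≤ (6 * (m * |t|) * s) ^ 2 := by
      rw [← sq_abs (h₁ t)]; gcongr
    have g₂' : h₂ t ^ 2 ≤ (6 * (m * |t|) * s) ^ 2 := by
      rw [← sq_abs (h₂ t)]; gcongr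
    have hepos : 0 < e t := lt_of_lt_of_le (by positivity) h1
    refine (sub_sqrt_le_div hepos (by positivity) (hh t ht)).trans ?_
    rw [div_le_iff₀ hepos]
    calc h₁ t ^ 2 + h₂ t ^ 2 ≤ 144 * m ^ 2 * |t| ^ 2 * (s ^ 2 / 2) := by nlinarith
      _ ≤ 144 * m ^ 2 * |t| ^ 2 * e t := by gcongr

/-- Multiplying by the conjugate, e - R = (h₁² + h₂²)/(e + R) for the square root R. The numerator
over t² tends to k₁² + k₂² and the denominator to 2 e(0). -/
theorem tendsto_sub_sqrt {e h₁ h₂ : ℝ → ℝ} {k₁ k₂ : ℝ} (he : ContinuousAt e 0) (he0 : 0 < e 0)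
    (h₁0 : h₁ 0 = 0) (h₂0 : h₂ 0 = 0) (d₁ : HasDerivAt h₁ k₁ 0) (d₂ : HasDerivAt h₂ k₂ 0)
    (hh : ∀ᶠ t in 𝓝 0, h₁ t ^ 2 + h₂ t ^ 2 ≤ e t ^ 2) :
    Tendsto (fun t => (e t - √(e t ^ 2 - h₁ t ^ 2 - h₂ t ^ 2)) / t ^ 2) (𝓝[≠] 0)
      (𝓝 ((k₁ ^ 2 + k₂ ^ 2) / (2 * e 0))) := by
  have q₁ : Tendsto (fun t => h₁ t / t) (𝓝[≠] 0) (𝓝 k₁) := by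
    have := d₁.tendsto_slope
    refine this.congr' ?_
    filter_upwards with t
    simp [slope_def_field, h₁0]
  have q₂ : Tendsto (fun t => h₂ t / t) (𝓝[≠] 0) (𝓝 k₂) := by
    have := d₂.tendsto_slope
    refine this.congr' ?_
    filter_upwards with t
    simp [slope_def_field, h₂0]
  have hden : Tendsto (fun t => e t + √(e t ^ 2 - h₁ t ^ 2 - h₂ t ^ 2)) (𝓝[≠] 0)
      (𝓝 (2 * e 0)) := by
    have hc : ContinuousAt (fun t => e t + √(e t ^ 2 - h₁ t ^ 2 - h₂ t ^ 2)) 0 :=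
      he.add (((he.pow 2).sub (d₁.continuousAt.pow 2)).sub (d₂.continuousAt.pow 2)).sqrt
    have h0 : e 0 + √(e 0 ^ 2 - h₁ 0 ^ 2 - h₂ 0 ^ 2) = 2 * e 0 := by
      rw [h₁0, h₂0]
      simp only [ne_eq, OfNat.ofNat_ne_zero, not_false_eq_true, zero_pow, sub_zero]
      rw [Real.sqrt_sq he0.le]
      ring
    have := hc.tendsto
    rw [h0] at this
    exact this.mono_left nhdsWithin_le_nhds
  refine (((q₁.pow 2).add (q₂.pow 2)).div hden (by positivity)).congr' ?_
  have hepos : ∀ᶠ t in 𝓝 (0 : ℝ), 0 < e t := he.eventually (lt_mem_nhds he0)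
  filter_upwards [nhdsWithin_le_nhds hepos, nhdsWithin_le_nhds hh, self_mem_nhdsWithin]
    with t h1 h2 h3
  have h3' : t ≠ 0 := h3
  have hsq : √(e t ^ 2 - h₁ t ^ 2 - h₂ t ^ 2) ^ 2 = e t ^ 2 - h₁ t ^ 2 - h₂ t ^ 2 :=
    Real.sq_sqrt (by linarith)
  have hnn := Real.sqrt_nonneg (e t ^ 2 - h₁ t ^ 2 - h₂ t ^ 2)
  set R := √(e t ^ 2 - h₁ t ^ 2 - h₂ t ^ 2)
  have hR : e t + R ≠ 0 := by positivity
  simp only [Pi.div_apply]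
  rw [div_pow, div_pow, ← add_div, div_div, div_eq_div_iff (by positivity) (by positivity)]
  linear_combination t ^ 2 * hsq

end AreaDefect

/-! ### Taylor expansion in time, uniform over compact sets. -/

section Taylor

variable {φ : ℝ × ℂ → ℝ} {O : Set (ℝ × ℂ)}

/-- The tube lemma gives a time interval common to all of K; the second time derivative is bounded
on the compact product, and the mean value inequality is applied twice. -/
theorem exists_taylor_bound (hO : IsOpen O) (hφ : ContDiffOn ℝ ∞ φ O) {K : Set ℂ}
    (hK : IsCompact K) (hKO : ∀ z ∈ K, (0, z) ∈ O) :
    ∃ r > 0, ∃ M, ∀ z ∈ K, |φ (0, z)| ≤ M ∧ ∀ t, |t| ≤ r → (t, z) ∈ O ∧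
      |φ (t, z) - φ (0, z) - t * dt φ (0, z)| ≤ M * t ^ 2 := by
  obtain ⟨u, v, hu, hv, hu0, hKv, huv⟩ := generalized_tube_lemma (isCompact_singleton (x := (0 : ℝ)))
    hK hO (by rintro ⟨t, z⟩ ⟨rfl, hz⟩; exact hKO z hz)
  obtain ⟨r, hr, hru⟩ := Metric.nhds_basis_closedBall.mem_iff.1 (hu.mem_nhds (hu0 rfl))
  have hsub : Metric.closedBall (0 : ℝ) r ×ˢ K ⊆ O := (prod_mono hru hKv).trans huv
  have hcomp : IsCompact (Metric.closedBall (0 : ℝ) r ×ˢ K) := (isCompact_closedBall _ _).prod hK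
  have hd := contDiffOn_dt hO hφ
  obtain ⟨M₁, hM₁⟩ := hcomp.exists_bound_of_continuousOn
    ((contDiffOn_dt hO hd).continuousOn.mono hsub)
  obtain ⟨M₂, hM₂⟩ := hcomp.exists_bound_of_continuousOn (hφ.continuousOn.mono hsub)
  have mem0 : (0 : ℝ) ∈ Metric.closedBall (0 : ℝ) r := Metric.mem_closedBall_self hr.le
  refine ⟨r, hr, max M₁ M₂, fun z hz => ⟨(hM₂ (0, z) ⟨mem0, hz⟩).trans (le_max_right _ _),
    fun t ht => ?_⟩⟩
  have hmem : ∀ s, |s| ≤ r → (s, z) ∈ Metric.closedBall (0 : ℝ) r ×ˢ K := fun s hs =>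
    ⟨by simpa using hs, hz⟩
  refine ⟨hsub (hmem t ht), ?_⟩
  have step1 : ∀ s, |s| ≤ |t| → |dt φ (s, z) - dt φ (0, z)| ≤ M₁ * |t| := by
    intro s hs
    have h := (convex_closedBall (0 : ℝ) r).norm_image_sub_le_of_norm_hasDerivWithin_le
      (f := fun s => dt φ (s, z)) (f' := fun s => dt (dt φ) (s, z)) (C := M₁) (x := 0) (y := s)
      (fun x hx => (hasDerivAt_dt hd hO (hsub ⟨hx, hz⟩)).hasDerivWithinAt)
      (fun x hx => hM₁ _ ⟨hx, hz⟩) mem0 (hmem s (hs.trans ht)).1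
    have hM0 : 0 ≤ M₁ := (norm_nonneg _).trans (hM₁ (0, z) ⟨mem0, hz⟩)
    rw [Real.norm_eq_abs, sub_zero, Real.norm_eq_abs] at h
    exact h.trans (by gcongr)
  have h := (convex_closedBall (0 : ℝ) |t|).norm_image_sub_le_of_norm_hasDerivWithin_le
    (f := fun s => φ (s, z) - s * dt φ (0, z)) (f' := fun s => dt φ (s, z) - 1 * dt φ (0, z))
    (C := M₁ * |t|) (x := 0) (y := t)
    (fun x hx => ((hasDerivAt_dt hφ hO (hsub (hmem x
      ((by simpa using hx : |x| ≤ |t|).trans ht)))).sub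
      ((hasDerivAt_id x).mul_const _)).hasDerivWithinAt)
    (fun x hx => by
      rw [one_mul, Real.norm_eq_abs]
      exact step1 x (by simpa using hx))
    (Metric.mem_closedBall_self (abs_nonneg t)) (by simp)
  rw [Real.norm_eq_abs, Real.norm_eq_abs, sub_zero] at h
  calc |φ (t, z) - φ (0, z) - t * dt φ (0, z)|
      = |φ (t, z) - t * dt φ (0, z) - (φ (0, z) - 0 * dt φ (0, z))| := by congr 1; ring
    _ ≤ M₁ * |t| * |t| := h
    _ = M₁ * t ^ 2 := by rw [mul_assoc, abs_mul_abs_self, sq]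
    _ ≤ max M₁ M₂ * t ^ 2 := by gcongr; exact le_max_left _ _

theorem tendsto_taylor (hO : IsOpen O) (hφ : ContDiffOn ℝ ∞ φ O) {z : ℂ} (hz : (0, z) ∈ O) :
    Tendsto (fun t => (φ (t, z) - φ (0, z) - t * dt φ (0, z)) / t ^ 2) (𝓝[≠] 0)
      (𝓝 (dt (dt φ) (0, z) / 2)) := by
  have hev : ∀ᶠ t in 𝓝[≠] (0 : ℝ), (t, z) ∈ O := nhdsWithin_le_nhds (eventually_slice_left hO hz)
  have hφ0 := hasDerivAt_dt hφ hO hz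
  have hd0 := hasDerivAt_dt (contDiffOn_dt hO hφ) hO hz
  refine HasDerivAt.lhopital_zero_nhdsNE (f' := fun t => dt φ (t, z) - 1 * dt φ (0, z))
    (g' := fun t => 2 * t) ?_ ?_ ?_ ?_ ?_ ?_
  · filter_upwards [hev] with t ht
    exact ((hasDerivAt_dt hφ hO ht).sub_const _).sub ((hasDerivAt_id t).mul_const _)
  · filter_upwards with t
    simpa using hasDerivAt_pow 2 t
  · filter_upwards [self_mem_nhdsWithin] with t ht
    exact mul_ne_zero two_ne_zero ht
  · have hc : ContinuousAt (fun t => φ (t, z) - φ (0, z) - t * dt φ (0, z)) 0 :=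
      (hφ0.continuousAt.sub continuousAt_const).sub (continuousAt_id.mul continuousAt_const)
    have := hc.tendsto
    simp only [sub_self, zero_mul] at this
    exact this.mono_left nhdsWithin_le_nhds
  · have hc : ContinuousAt (fun t : ℝ => t ^ 2) 0 := by fun_prop
    have := hc.tendsto
    rw [zero_pow two_ne_zero] at this
    exact this.mono_left nhdsWithin_le_nhds
  · have := hd0.tendsto_slope.div_const 2
    refine this.congr' ?_
    filter_upwards [self_mem_nhdsWithin] with t ht
    have ht' : t ≠ 0 := ht
    rw [slope_def_field, sub_zero]
    field_simp

end Taylor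

/-! ### Integrating expansions against a cutoff. -/

section Cutoff

/-- `ρ` is a continuous function on the open set `T` with values in `[0, 1]` which vanishes outside
of the compact set `K`. -/
structure IsCutoff (ρ : ℂ → ℝ) (T K : Set ℂ) : Prop where
  isOpen : IsOpen T
  isCompact : IsCompact K
  subset : K ⊆ T
  continuousOn : ContinuousOn ρ T
  nonneg : ∀ z, 0 ≤ ρ z
  le_one : ∀ z, ρ z ≤ 1
  eq_zero : ∀ z ∈ T, z ∉ K → ρ z = 0

variable {ρ : ℂ → ℝ} {T K : Set ℂ}

theorem IsCutoff.norm_mul_le (h : IsCutoff ρ T K) {φ : ℂ → ℝ} {C : ℝ} (hC : ∀ z ∈ K, |φ z| ≤ C)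
    {z : ℂ} (hz : z ∈ T) : ‖ρ z * φ z‖ ≤ K.indicator (fun _ => C) z := by
  by_cases hzK : z ∈ K
  · rw [indicator_of_mem hzK, norm_mul, Real.norm_eq_abs, Real.norm_eq_abs, abs_of_nonneg (h.nonneg z)]
    calc ρ z * |φ z| ≤ 1 * |φ z| := by gcongr; exact h.le_one z
      _ ≤ C := by rw [one_mul]; exact hC z hzK
  · rw [indicator_of_notMem hzK, h.eq_zero z hz hzK, zero_mul, norm_zero]

theorem IsCutoff.integrable_indicator (h : IsCutoff ρ T K) (C : ℝ) :
    IntegrableOn (K.indicator fun _ => C) T := by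
  have : IntegrableOn (fun _ : ℂ => C) K := integrableOn_const h.isCompact.measure_lt_top.ne
  exact ((integrable_indicator_iff h.isCompact.measurableSet).2 this).integrableOn

theorem IsCutoff.aestronglyMeasurable_mul (h : IsCutoff ρ T K) {φ : ℂ → ℝ}
    (hφ : AEStronglyMeasurable φ (volume.restrict T)) :
    AEStronglyMeasurable (fun z => ρ z * φ z) (volume.restrict T) :=
  (h.continuousOn.aestronglyMeasurable h.isOpen.measurableSet).mul hφ

theorem IsCutoff.integrableOn_of_bound (h : IsCutoff ρ T K) {φ : ℂ → ℝ}
    (hφ : AEStronglyMeasurable φ (volume.restrict T)) {C : ℝ} (hC : ∀ z ∈ K, |φ z| ≤ C) :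
    IntegrableOn (fun z => ρ z * φ z) T :=
  (h.integrable_indicator C).mono' (h.aestronglyMeasurable_mul hφ)
    ((ae_restrict_iff' h.isOpen.measurableSet).2
      (Eventually.of_forall fun _ hz => h.norm_mul_le hC hz))

theorem IsCutoff.integrableOn (h : IsCutoff ρ T K) {φ : ℂ → ℝ} (hφ : ContinuousOn φ T) :
    IntegrableOn (fun z => ρ z * φ z) T := by
  obtain ⟨C, hC⟩ := h.isCompact.exists_bound_of_continuousOn (hφ.mono h.subset)
  exact h.integrableOn_of_bound (hφ.aestronglyMeasurable h.isOpen.measurableSet) hC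

/-- A second order expansion may be integrated if it holds almost everywhere and the remainder is
uniformly of second order. -/
theorem IsCutoff.integral_expansion (h : IsCutoff ρ T K) {α : ℝ → ℂ → ℝ} {α₁ α₂ : ℂ → ℝ}
    (hα : ∀ᶠ t in 𝓝 0, ContinuousOn (α t) T) (hα₁ : ContinuousOn α₁ T) {C : ℝ}
    (hb : ∀ᶠ t in 𝓝 0, ∀ z ∈ K, |α t z - α 0 z - t * α₁ z| ≤ C * t ^ 2)
    (hl : ∀ᵐ z ∂volume.restrict T, Tendsto (fun t => (α t z - α 0 z - t * α₁ z) / t ^ 2)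
      (𝓝[≠] 0) (𝓝 (α₂ z))) :
    (fun t => (∫ z in T, ρ z * α t z) - ((∫ z in T, ρ z * α 0 z) + t * (∫ z in T, ρ z * α₁ z)
      + t ^ 2 * ∫ z in T, ρ z * α₂ z)) =o[𝓝 0] fun t => t ^ 2 := by
  have h0 : ContinuousOn (α 0) T := hα.self_of_nhds
  have hlim : Tendsto (fun t => ∫ z in T, ρ z * ((α t z - α 0 z - t * α₁ z) / t ^ 2))
      (𝓝[≠] 0) (𝓝 (∫ z in T, ρ z * α₂ z)) := by
    refine tendsto_integral_filter_of_dominated_convergence (K.indicator fun _ => C) ?_ ?_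
      (h.integrable_indicator C) ?_
    · filter_upwards [nhdsWithin_le_nhds hα] with t ht
      exact h.aestronglyMeasurable_mul ((((ht.sub h0).sub (continuousOn_const.mul hα₁)).div_const
        _).aestronglyMeasurable h.isOpen.measurableSet)
    · filter_upwards [nhdsWithin_le_nhds hb, self_mem_nhdsWithin] with t ht ht0
      refine (ae_restrict_iff' h.isOpen.measurableSet).2 (Eventually.of_forall fun z hz =>
        h.norm_mul_le (φ := fun z => (α t z - α 0 z - t * α₁ z) / t ^ 2) (fun z hz => ?_) hz)
      have ht0' : t ≠ 0 := ht0
      rw [abs_div, abs_of_pos (by positivity : 0 < t ^ 2), div_le_iff₀ (by positivity)]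
      exact ht z hz
    · filter_upwards [hl] with z hz
      exact hz.const_mul _
  rw [isLittleO_iff_tendsto (fun t ht => by
    rw [sq_eq_zero_iff] at ht; subst ht; ring)]
  -- At t = 0 the quotient has the default value 0, so continuity there is the same as the punctured
  -- limit being 0.
  have hca := (continuousAt_iff_punctured_nhds (a := (0 : ℝ)) (f := fun t =>
    ((∫ z in T, ρ z * α t z) - ((∫ z in T, ρ z * α 0 z) + t * (∫ z in T, ρ z * α₁ z)
      + t ^ 2 * ∫ z in T, ρ z * α₂ z)) / t ^ 2)).2 ?_
  · have := hca.tendsto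
    simpa using this
  · have h1 : ((∫ z in T, ρ z * α 0 z) - ((∫ z in T, ρ z * α 0 z) + 0 * (∫ z in T, ρ z * α₁ z)
      + 0 ^ 2 * ∫ z in T, ρ z * α₂ z)) / 0 ^ 2 = 0 := by simp
    rw [h1]
    have h2 := hlim.sub_const (∫ z in T, ρ z * α₂ z)
    rw [sub_self] at h2
    refine h2.congr' ?_
    filter_upwards [nhdsWithin_le_nhds hα, self_mem_nhdsWithin] with t ht ht0
    have ht0' : t ≠ 0 := ht0
    have i1 := h.integrableOn ht
    have i2 := h.integrableOn h0
    have i3 := h.integrableOn hα₁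
    have i12 : IntegrableOn (fun z => ρ z * α t z - ρ z * α 0 z) T := i1.sub i2
    have e1 : ∫ z in T, ρ z * ((α t z - α 0 z - t * α₁ z) / t ^ 2)
        = ((∫ z in T, ρ z * α t z) - (∫ z in T, ρ z * α 0 z) - t * ∫ z in T, ρ z * α₁ z)
          / t ^ 2 := by
      rw [← integral_const_mul, ← integral_sub i1 i2, ← integral_sub i12 (i3.const_mul t),
        ← integral_div]
      congr 1
      funext z
      ring
    rw [e1]
    field_simp
    ring

end Cutoff

/-! ### Expansion of the integrated energy and area densities. -/

section ConformalExpansion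

variable {O : Set (ℝ × ℂ)} {e h₁ h₂ : ℝ × ℂ → ℝ}

/-- The coefficient of `t²` in the difference of the energy and the area density. -/
def defectCoeff (e h₁ h₂ : ℝ × ℂ → ℝ) (z : ℂ) : ℝ :=
  (dt h₁ (0, z) ^ 2 + dt h₂ (0, z) ^ 2) / (2 * e (0, z))

/-- One constant controls both the difference quotient of the defect and its limit; zeros of e
inside K are allowed. -/
theorem exists_defect_bound (hO : IsOpen O) (he : ContDiffOn ℝ ∞ e O) (hh₁ : ContDiffOn ℝ ∞ h₁ O)
    (hh₂ : ContDiffOn ℝ ∞ h₂ O) (he0 : ∀ x ∈ O, 0 ≤ e x)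
    (hle : ∀ x ∈ O, h₁ x ^ 2 + h₂ x ^ 2 ≤ e x ^ 2) {K : Set ℂ} (hK : IsCompact K)
    (hKO : ∀ z ∈ K, (0, z) ∈ O) (h₁0 : ∀ z ∈ K, h₁ (0, z) = 0) (h₂0 : ∀ z ∈ K, h₂ (0, z) = 0) :
    ∃ r > 0, ∃ C, ∀ z ∈ K, |defectCoeff e h₁ h₂ z| ≤ C ∧ ∀ t, |t| ≤ r →
      |e (t, z) - √(e (t, z) ^ 2 - h₁ (t, z) ^ 2 - h₂ (t, z) ^ 2)| ≤ C * t ^ 2 := by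
  obtain ⟨r₀, hr₀, M₀, hM₀⟩ := exists_taylor_bound hO he hK hKO
  obtain ⟨r₁, hr₁, M₁, hM₁⟩ := exists_taylor_bound hO hh₁ hK hKO
  obtain ⟨r₂, hr₂, M₂, hM₂⟩ := exists_taylor_bound hO hh₂ hK hKO
  set r := min r₀ (min r₁ r₂) with hr_def
  have hr : 0 < r := lt_min hr₀ (lt_min hr₁ hr₂)
  have le0 : r ≤ r₀ := min_le_left _ _
  have le1 : r ≤ r₁ := (min_le_right _ _).trans (min_le_left _ _)
  have le2 : r ≤ r₂ := (min_le_right _ _).trans (min_le_right _ _)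
  -- The summand 1 gives m ≤ m², so that m² dominates all Taylor constants; the last summand secures
  -- e₀ ≤ m²r².
  set m := 1 + |M₀| + |M₁| + |M₂| + |M₀| / r ^ 2 with hm_def
  have p0 := abs_nonneg M₀
  have p1 := abs_nonneg M₁
  have p2 := abs_nonneg M₂
  have p3 : 0 ≤ |M₀| / r ^ 2 := by positivity
  have hm1 : 1 ≤ m := by linarith
  have hmm : m ≤ m ^ 2 := by nlinarith
  have q0 : M₀ ≤ m ^ 2 := by linarith [le_abs_self M₀]
  have q1 : M₁ ≤ m ^ 2 := by linarith [le_abs_self M₁]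
  have q2 : M₂ ≤ m ^ 2 := by linarith [le_abs_self M₂]
  have q3 : M₀ ≤ m ^ 2 * r ^ 2 := by
    have : |M₀| / r ^ 2 ≤ m ^ 2 := by linarith
    rw [div_le_iff₀ (by positivity)] at this
    linarith [le_abs_self M₀]
  have key : ∀ z ∈ K, ∀ t, |t| ≤ r →
      |e (t, z) - √(e (t, z) ^ 2 - h₁ (t, z) ^ 2 - h₂ (t, z) ^ 2)| ≤ 144 * m ^ 2 * t ^ 2 := by
    intro z hz t ht
    have hmem : ∀ t, |t| ≤ r → (t, z) ∈ O := fun t ht => ((hM₀ z hz).2 t (ht.trans le0)).1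
    have hx := he0 _ (hmem t ht)
    rw [abs_of_nonneg (sub_nonneg.2 ((Real.sqrt_le_sqrt (by
      nlinarith [sq_nonneg (h₁ (t, z)), sq_nonneg (h₂ (t, z))])).trans_eq (Real.sqrt_sq hx)))]
    refine sub_sqrt_le_sq (e := fun t => e (t, z)) (h₁ := fun t => h₁ (t, z))
      (h₂ := fun t => h₂ (t, z)) (e₀ := e (0, z)) (e₁ := dt e (0, z)) (k₁ := dt h₁ (0, z))
      (k₂ := dt h₂ (0, z)) (by linarith : (0 : ℝ) < m) hr
      (fun t ht => he0 _ (hmem t ht)) (fun t ht => hle _ (hmem t ht)) (he0 _ (hKO z hz))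
      ((le_abs_self _).trans ((hM₀ z hz).1.trans q3)) ?_ ?_ ?_ ht
    · intro t ht
      exact ((hM₀ z hz).2 t (ht.trans le0)).2.trans (by gcongr)
    · intro t ht
      have := ((hM₁ z hz).2 t (ht.trans le1)).2
      rw [h₁0 z hz, sub_zero] at this
      exact this.trans (by gcongr)
    · intro t ht
      have := ((hM₂ z hz).2 t (ht.trans le2)).2
      rw [h₂0 z hz, sub_zero] at this
      exact this.trans (by gcongr)
  refine ⟨r, hr, 144 * m ^ 2, fun z hz => ⟨?_, key z hz⟩⟩
  have hz0 := hKO z hz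
  -- Where e = 0 the coefficient is 0 by division by zero; elsewhere it is a limit of quotients
  -- already bounded.
  rcases (he0 _ hz0).eq_or_lt with h0 | h0
  · rw [defectCoeff, ← h0, mul_zero, div_zero, abs_zero]
    positivity
  · have hl := tendsto_sub_sqrt (e := fun t => e (t, z)) (hasDerivAt_dt he hO hz0).continuousAt h0
      (h₁0 z hz) (h₂0 z hz) (hasDerivAt_dt hh₁ hO hz0) (hasDerivAt_dt hh₂ hO hz0) (by
        filter_upwards [eventually_slice_left hO hz0] with t ht using hle _ ht)
    refine le_of_tendsto hl.abs ?_
    have : ∀ᶠ t in 𝓝 (0 : ℝ), |t| ≤ r := by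
      filter_upwards [Metric.closedBall_mem_nhds (0 : ℝ) hr] with t ht
      simpa using ht
    filter_upwards [nhdsWithin_le_nhds this, self_mem_nhdsWithin] with t ht ht0
    have ht0' : t ≠ 0 := ht0
    rw [abs_div, abs_of_pos (by positivity : 0 < t ^ 2), div_le_iff₀ (by positivity)]
    exact key z hz t ht

variable {ρ : ℂ → ℝ} {T K : Set ℂ} {δ : ℝ}

/-- The second order expansion of the integral of a smooth family of densities. -/
theorem IsCutoff.smooth_expansion (h : IsCutoff ρ T K) (hδ : 0 < δ)
    (he : ContDiffOn ℝ ∞ e (Ioo (-δ) δ ×ˢ T)) :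
    (fun t => (∫ z in T, ρ z * e (t, z)) - ((∫ z in T, ρ z * e (0, z))
      + t * (∫ z in T, ρ z * dt e (0, z)) + t ^ 2 * ∫ z in T, ρ z * (dt (dt e) (0, z) / 2)))
        =o[𝓝 0] fun t => t ^ 2 := by
  have hO : IsOpen (Ioo (-δ) δ ×ˢ T) := isOpen_Ioo.prod h.isOpen
  have h0 : (0 : ℝ) ∈ Ioo (-δ) δ := ⟨by linarith, hδ⟩
  have hmap : ∀ t ∈ Ioo (-δ) δ, MapsTo (fun z : ℂ => (t, z)) T (Ioo (-δ) δ ×ˢ T) :=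
    fun t ht z hz => ⟨ht, hz⟩
  obtain ⟨r, hr, M, hM⟩ := exists_taylor_bound hO he h.isCompact fun z hz => ⟨h0, h.subset hz⟩
  refine h.integral_expansion (α := fun t z => e (t, z)) (C := M) ?_ ?_ ?_ ?_
  · filter_upwards [isOpen_Ioo.mem_nhds h0] with t ht
    exact he.continuousOn.comp (Continuous.prodMk_right t).continuousOn (hmap t ht)
  · exact (contDiffOn_dt hO he).continuousOn.comp (Continuous.prodMk_right 0).continuousOn
      (hmap 0 h0)
  · filter_upwards [Metric.closedBall_mem_nhds (0 : ℝ) hr] with t ht z hz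
    exact ((hM z hz).2 t (by simpa using ht)).2
  · exact (ae_restrict_iff' h.isOpen.measurableSet).2 (Eventually.of_forall fun z hz =>
      tendsto_taylor hO he ⟨h0, hz⟩)

/-- The second order expansion of the integral of a family of area densities `√(e² - |h|²)`, which
are not smooth where `e = 0`. -/
theorem IsCutoff.sqrt_expansion (h : IsCutoff ρ T K) (hδ : 0 < δ)
    (he : ContDiffOn ℝ ∞ e (Ioo (-δ) δ ×ˢ T)) (hh₁ : ContDiffOn ℝ ∞ h₁ (Ioo (-δ) δ ×ˢ T))
    (hh₂ : ContDiffOn ℝ ∞ h₂ (Ioo (-δ) δ ×ˢ T)) (he0 : ∀ x ∈ Ioo (-δ) δ ×ˢ T, 0 ≤ e x)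
    (hle : ∀ x ∈ Ioo (-δ) δ ×ˢ T, h₁ x ^ 2 + h₂ x ^ 2 ≤ e x ^ 2)
    (h₁0 : ∀ z ∈ T, h₁ (0, z) = 0) (h₂0 : ∀ z ∈ T, h₂ (0, z) = 0)
    (hpos : ∀ᵐ z ∂volume.restrict T, 0 < e (0, z)) :
    (fun t => (∫ z in T, ρ z * √(e (t, z) ^ 2 - h₁ (t, z) ^ 2 - h₂ (t, z) ^ 2))
      - ((∫ z in T, ρ z * √(e (0, z) ^ 2 - h₁ (0, z) ^ 2 - h₂ (0, z) ^ 2))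
      + t * (∫ z in T, ρ z * dt e (0, z))
      + t ^ 2 * ∫ z in T, ρ z * (dt (dt e) (0, z) / 2 - defectCoeff e h₁ h₂ z)))
        =o[𝓝 0] fun t => t ^ 2 := by
  have hO : IsOpen (Ioo (-δ) δ ×ˢ T) := isOpen_Ioo.prod h.isOpen
  have h0 : (0 : ℝ) ∈ Ioo (-δ) δ := ⟨by linarith, hδ⟩
  have hmap : ∀ t ∈ Ioo (-δ) δ, MapsTo (fun z : ℂ => (t, z)) T (Ioo (-δ) δ ×ˢ T) :=
    fun t ht z hz => ⟨ht, hz⟩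
  have hK0 : ∀ z ∈ K, ((0 : ℝ), z) ∈ Ioo (-δ) δ ×ˢ T := fun z hz => ⟨h0, h.subset hz⟩
  obtain ⟨r, hr, M, hM⟩ := exists_taylor_bound hO he h.isCompact hK0
  obtain ⟨r', hr', C, hC⟩ := exists_defect_bound hO he hh₁ hh₂ he0 hle h.isCompact hK0
    (fun z hz => h₁0 z (h.subset hz)) (fun z hz => h₂0 z (h.subset hz))
  have s0 : ∀ z ∈ T, √(e (0, z) ^ 2 - h₁ (0, z) ^ 2 - h₂ (0, z) ^ 2) = e (0, z) := by
    intro z hz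
    rw [h₁0 z hz, h₂0 z hz, zero_pow two_ne_zero, sub_zero, sub_zero,
      Real.sqrt_sq (he0 _ ⟨h0, hz⟩)]
  refine h.integral_expansion
    (α := fun t z => √(e (t, z) ^ 2 - h₁ (t, z) ^ 2 - h₂ (t, z) ^ 2)) (C := M + C) ?_ ?_ ?_ ?_
  · filter_upwards [isOpen_Ioo.mem_nhds h0] with t ht
    have hc : ContinuousOn (fun x => √(e x ^ 2 - h₁ x ^ 2 - h₂ x ^ 2)) (Ioo (-δ) δ ×ˢ T) :=
      (((he.continuousOn.pow 2).sub (hh₁.continuousOn.pow 2)).sub (hh₂.continuousOn.pow 2)).sqrt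
    exact hc.comp (Continuous.prodMk_right t).continuousOn (hmap t ht)
  · exact (contDiffOn_dt hO he).continuousOn.comp (Continuous.prodMk_right 0).continuousOn
      (hmap 0 h0)
  · filter_upwards [Metric.closedBall_mem_nhds (0 : ℝ) hr, Metric.closedBall_mem_nhds (0 : ℝ) hr']
      with t ht ht' z hz
    have a1 := ((hM z hz).2 t (by simpa using ht)).2
    have a2 := (hC z hz).2 t (by simpa using ht')
    rw [s0 z (h.subset hz)]
    rw [abs_le] at a1 a2 ⊢
    constructor <;> linarith
  · filter_upwards [hpos, ae_restrict_mem h.isOpen.measurableSet] with z hz hzT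
    have hz0 : ((0 : ℝ), z) ∈ Ioo (-δ) δ ×ˢ T := ⟨h0, hzT⟩
    have l1 := tendsto_taylor hO he hz0
    have l2 := tendsto_sub_sqrt (e := fun t => e (t, z)) (hasDerivAt_dt he hO hz0).continuousAt hz
      (h₁0 z hzT) (h₂0 z hzT) (hasDerivAt_dt hh₁ hO hz0) (hasDerivAt_dt hh₂ hO hz0) (by
        filter_upwards [eventually_slice_left hO hz0] with t ht using hle _ ht)
    refine (l1.sub l2).congr fun t => ?_
    rw [s0 z hzT]
    ring

end ConformalExpansion

/-! ### Real differentials on a Riemann surface. -/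

section RiemannSurface

variable (S : Type*) [TopologicalSpace S] [ChartedSpace ℂ S] [IsManifold 𝓘(ℂ, ℂ) ω S]

/-- A Riemann surface is a smooth real manifold. -/
theorem isManifold_real : IsManifold 𝓘(ℝ, ℂ) ∞ S := by
  refine isManifold_of_contDiffOn _ _ _ fun e e' he he' => ?_
  have h := (contDiffGroupoid ω 𝓘(ℂ, ℂ)).compatible he he'
  rw [contDiffGroupoid, mem_groupoid_of_pregroupoid] at h
  have h1 : ContDiffOn ℂ ω _ _ := h.1
  simpa using (h1.restrict_scalars ℝ).of_le (m := ∞) (by simp)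

variable {S}

theorem mdifferentiableAt_chart_symm (p : S) {z : ℂ} (hz : z ∈ (chartAt ℂ p).target) :
    MDifferentiableAt 𝓘(ℝ, ℂ) 𝓘(ℝ, ℂ) (chartAt ℂ p).symm z := by
  have := isManifold_real S
  have : IsManifold 𝓘(ℝ, ℂ) 1 S := IsManifold.of_le (n := ∞) (by simp)
  exact mdifferentiableAt_atlas_symm (chart_mem_atlas ℂ p) hz

/-- In the identification of the tangent spaces with `ℂ`, the differential of the inverse of a
chart is the multiplication by a complex number. -/
theorem exists_mfderiv_chart_symm (p : S) {z : ℂ} (hz : z ∈ (chartAt ℂ p).target) :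
    ∃ c : ℂ, c ≠ 0 ∧ ∀ ξ : ℂ,
      (mfderiv 𝓘(ℝ, ℂ) 𝓘(ℝ, ℂ) (chartAt ℂ p).symm z : ℂ →L[ℝ] ℂ) ξ = c * ξ := by
  have hm : IsManifold 𝓘(ℂ, ℂ) 1 S := IsManifold.of_le (n := ω) (by simp)
  have hc := mdifferentiableAt_atlas_symm (I := 𝓘(ℂ, ℂ)) (chart_mem_atlas ℂ p) hz
  have hr := mdifferentiableAt_chart_symm p hz
  -- The differential refers to the preferred chart at the image point, so it is the derivative of
  -- the transition map from the chart at p, which is holomorphic.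
  set φ : ℂ → ℂ := fun w => chartAt ℂ ((chartAt ℂ p).symm z) ((chartAt ℂ p).symm w) with hφ
  have hd : DifferentiableAt ℂ φ z := by
    have h0 := ((mdifferentiableAt_iff _ _).1 hc).2
    simp only [mfld_simps, differentiableWithinAt_univ] at h0
    exact h0
  have h1 : (mfderiv 𝓘(ℂ, ℂ) 𝓘(ℂ, ℂ) (chartAt ℂ p).symm z : ℂ →L[ℂ] ℂ) = fderiv ℂ φ z := by
    rw [hc.mfderiv]
    simp only [mfld_simps, fderivWithin_univ]
    rfl
  have h2 : (mfderiv 𝓘(ℝ, ℂ) 𝓘(ℝ, ℂ) (chartAt ℂ p).symm z : ℂ →L[ℝ] ℂ) = fderiv ℝ φ z := by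
    rw [hr.mfderiv]
    simp only [mfld_simps, fderivWithin_univ]
    rfl
  have h3 : ∀ ξ : ℂ, fderiv ℝ φ z ξ = fderiv ℂ φ z 1 * ξ := by
    intro ξ
    rw [hd.fderiv_restrictScalars ℝ, ContinuousLinearMap.coe_restrictScalars']
    conv_lhs => rw [← mul_one ξ, ← smul_eq_mul, map_smul, smul_eq_mul, mul_comm]
  refine ⟨fderiv ℂ φ z 1, ?_, fun ξ => (DFunLike.congr_fun h2 ξ).trans (h3 ξ)⟩
  intro h0
  have h4 := (mdifferentiable_chart (I := 𝓘(ℂ, ℂ)) p).symm.mfderiv_injective hz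
  have h5 : Function.Injective (fderiv ℂ φ z) := by rw [← h1]; exact h4
  exact one_ne_zero (h5 (h0.trans (map_zero _).symm))

theorem mapDeriv_inChart {E : Type*} [NormedAddCommGroup E] [NormedSpace ℝ E]
    {N : Type*} [TopologicalSpace N] [ChartedSpace E N] {u : S → N} (p : S) {z : ℂ}
    (hz : z ∈ (chartAt ℂ p).target)
    (hu : MDifferentiableAt 𝓘(ℝ, ℂ) 𝓘(ℝ, E) u ((chartAt ℂ p).symm z)) :
    ∃ c : ℂ, c ≠ 0 ∧ ∀ ξ : ℂ, mapDeriv E (inChart u p) z ξ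
      = (mfderiv 𝓘(ℝ, ℂ) 𝓘(ℝ, E) u ((chartAt ℂ p).symm z) : ℂ →L[ℝ] E) (c * ξ) := by
  obtain ⟨c, hc, h⟩ := exists_mfderiv_chart_symm p hz
  refine ⟨c, hc, fun ξ => ?_⟩
  rw [← h]
  have := (hu.hasMFDerivAt.comp z (mdifferentiableAt_chart_symm p hz).hasMFDerivAt).mfderiv
  exact DFunLike.congr_fun this ξ

end RiemannSurface

/-! ### The surface integral as a finite sum of chart integrals. -/

section Cutoff

variable {S : Type*} [TopologicalSpace S] [T2Space S] [CompactSpace S] [ChartedSpace ℂ S]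

/-- The partition function of the chart at `p`, in this chart. -/
def chartCutoff (p : S) (z : ℂ) : ℝ := chartPartition S p ((chartAt ℂ p).symm z)

/-- The support of the partition function of the chart at `p`, in this chart. -/
def chartSupport (p : S) : Set ℂ := chartAt ℂ p '' tsupport (chartPartition S p)

theorem isCutoff_chartCutoff (p : S) :
    IsCutoff (chartCutoff p) (chartAt ℂ p).target (chartSupport p) where
  isOpen := (chartAt ℂ p).open_target
  isCompact := (isClosed_tsupport _).isCompact.image_of_continuousOn
    ((chartAt ℂ p).continuousOn.mono (chartPartition_isSubordinate S p))
  subset := by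
    rintro _ ⟨x, hx, rfl⟩
    exact (chartAt ℂ p).map_source (chartPartition_isSubordinate S p hx)
  continuousOn := (chartPartition S p).continuous.comp_continuousOn (chartAt ℂ p).continuousOn_symm
  nonneg z := (chartPartition S).nonneg p _
  le_one z := (chartPartition S).le_one p _
  eq_zero z hz hzK := by
    by_contra h
    exact hzK ⟨(chartAt ℂ p).symm z, subset_tsupport _ h, (chartAt ℂ p).right_inv hz⟩

variable (S) in
theorem finite_support_chartPartition : {p : S | (chartPartition S p : S → ℝ) ≠ 0}.Finite := by
  refine ((chartPartition S).locallyFinite.finite_nonempty_of_compact).subset fun p hp => ?_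
  exact Function.support_nonempty_iff.2 hp

variable (S) in
/-- The charts which meet the support of the partition of unity. -/
def chartFinset : Finset S := (finite_support_chartPartition S).toFinset

theorem surfaceIntegral_eq_sum (d : S → ℂ → ℝ) :
    surfaceIntegral d = ∑ p ∈ chartFinset S, ∫ z in (chartAt ℂ p).target, chartCutoff p z * d p z := by
  refine finsum_eq_sum_of_support_subset _ fun p hp => ?_
  rw [chartFinset, Finite.coe_toFinset]
  intro h0
  refine hp ?_
  have : ∀ x, chartPartition S p x = 0 := fun x => congrFun h0 x
  simp [this]

theorem surfaceIntegral_congr {d d' : S → ℂ → ℝ}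
    (h : ∀ p, ∀ z ∈ (chartAt ℂ p).target, d p z = d' p z) :
    surfaceIntegral d = surfaceIntegral d' := by
  rw [surfaceIntegral_eq_sum, surfaceIntegral_eq_sum]
  refine Finset.sum_congr rfl fun p _ => setIntegral_congr_fun (chartAt ℂ p).open_target.measurableSet
    fun z hz => ?_
  simp only [h p z hz]

theorem surfaceIntegral_const_mul (c : ℝ) (d : S → ℂ → ℝ) :
    surfaceIntegral (fun p z => c * d p z) = c * surfaceIntegral d := by
  rw [surfaceIntegral_eq_sum, surfaceIntegral_eq_sum, Finset.mul_sum]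
  refine Finset.sum_congr rfl fun p _ => ?_
  rw [← integral_const_mul]
  congr 1 with z
  ring

theorem surfaceIntegral_sub {d d' : S → ℂ → ℝ} (h : SurfaceIntegrable d)
    (h' : SurfaceIntegrable d') :
    surfaceIntegral (fun p z => d p z - d' p z) = surfaceIntegral d - surfaceIntegral d' := by
  rw [surfaceIntegral_eq_sum, surfaceIntegral_eq_sum, surfaceIntegral_eq_sum,
    ← Finset.sum_sub_distrib]
  refine Finset.sum_congr rfl fun p _ => ?_
  refine Eq.trans ?_ (integral_sub (h p) (h' p))
  congr 1 with z
  exact mul_sub _ _ _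

theorem surfaceIntegrable_of_continuousOn {d : S → ℂ → ℝ}
    (h : ∀ p, ContinuousOn (d p) (chartAt ℂ p).target) : SurfaceIntegrable d := fun p =>
  (isCutoff_chartCutoff p).integrableOn (h p)

/-- Second order expansions in all charts give a second order expansion of the integral. -/
theorem surfaceIntegral_expansion {d : ℝ → S → ℂ → ℝ} {d₀ d₁ d₂ : S → ℂ → ℝ}
    (h : ∀ p, (fun t => (∫ z in (chartAt ℂ p).target, chartCutoff p z * d t p z)
      - ((∫ z in (chartAt ℂ p).target, chartCutoff p z * d₀ p z)
      + t * (∫ z in (chartAt ℂ p).target, chartCutoff p z * d₁ p z)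
      + t ^ 2 * ∫ z in (chartAt ℂ p).target, chartCutoff p z * d₂ p z)) =o[𝓝 0] fun t => t ^ 2) :
    (fun t => surfaceIntegral (d t) - (surfaceIntegral d₀ + t * surfaceIntegral d₁
      + t ^ 2 * surfaceIntegral d₂)) =o[𝓝 0] fun t : ℝ => t ^ 2 := by
  have := IsLittleO.sum (s := chartFinset S) fun p _ => h p
  refine this.congr_left fun t => ?_
  simp only [surfaceIntegral_eq_sum, Finset.sum_apply, Finset.sum_sub_distrib,
    Finset.sum_add_distrib, Finset.mul_sum]

end Cutoff

/-- A function with a second order expansion is differentiable. -/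
theorem hasDerivAt_of_expansion {F : ℝ → ℝ} {a L Q : ℝ}
    (h : (fun t => F t - (a + t * L + t ^ 2 * Q)) =o[𝓝 0] fun t => t ^ 2) :
    HasDerivAt F L 0 := by
  have h0 : F 0 = a := by
    -- A function that is o(t²) vanishes at t = 0, since t² does; this identifies F(0) with the
    -- constant term.
    have := h.isBigO.eq_zero_imp.self_of_nhds (by simp)
    simp at this
    linarith
  rw [hasDerivAt_iff_isLittleO]
  have h1 : (fun t : ℝ => t ^ 2) =o[𝓝 0] fun t => t := by
    simpa using (isLittleO_pow_pow (𝕜 := ℝ) one_lt_two)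
  have h2 := (h.trans h1).add (h1.const_mul_left Q)
  simp only [sub_zero, h0, smul_eq_mul]
  refine h2.congr_left fun t => ?_
  ring

/-! ### The densities e, h₁, h₂ of a family. -/

section FamilyDensities

variable {E : Type*} [NormedAddCommGroup E] [NormedSpace ℝ E] [FiniteDimensional ℝ E]
  {N : Type*} [TopologicalSpace N] [ChartedSpace E N] [IsManifold 𝓘(ℝ, E) ∞ N]

theorem innerAt_sq_le (g : RMetric E N) (q : N) (a b : E) :
    innerAt g q a b ^ 2 ≤ innerAt g q a a * innerAt g q b b := by
  have h : ∀ r : ℝ, 0 ≤ innerAt g q b b * (r * r) + (2 * innerAt g q a b) * r + innerAt g q a a := by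
    intro r
    have h1 := innerAt_nonneg g q (a + r • b)
    simp only [map_add, map_smul, add_apply, smul_apply, smul_eq_mul] at h1
    rw [innerAt_symm g q b a] at h1
    linarith
  have := discrim_le_zero h
  rw [discrim] at this
  linarith

/-- The energy density of a family. -/
def famEnergy (g : RMetric E N) (W : ℝ × ℂ → N) (x : ℝ × ℂ) : ℝ :=
  (pullback g W (0, 1) (0, 1) x + pullback g W (0, Complex.I) (0, Complex.I) x) / 2

/-- Half the difference of the diagonal coefficients of the metrics induced by a family. -/
def famDiff (g : RMetric E N) (W : ℝ × ℂ → N) (x : ℝ × ℂ) : ℝ :=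
  (pullback g W (0, 1) (0, 1) x - pullback g W (0, Complex.I) (0, Complex.I) x) / 2

/-- The mixed coefficient of the metrics induced by a family. -/
def famMixed (g : RMetric E N) (W : ℝ × ℂ → N) (x : ℝ × ℂ) : ℝ :=
  pullback g W (0, 1) (0, Complex.I) x

/-- The first variation of the energy density. -/
def energyVarDensity (g : RMetric E N) (f : ℂ → N) (V : ℂ → E) (z : ℂ) : ℝ :=
  (pullbackVar g f V 1 1 z + pullbackVar g f V Complex.I Complex.I z) / 2

variable {f : ℂ → N} {V : ℂ → E} {W : ℝ × ℂ → N} {O : Set (ℝ × ℂ)}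

theorem famEnergy_nonneg (g : RMetric E N) (W : ℝ × ℂ → N) (x : ℝ × ℂ) : 0 ≤ famEnergy g W x :=
  div_nonneg (add_nonneg (innerAt_nonneg g _ _) (innerAt_nonneg g _ _)) zero_le_two

/-- This is Cauchy–Schwarz, because e² - h₁² = |W_x|² |W_y|². -/
theorem famDiff_sq_add_le (g : RMetric E N) (W : ℝ × ℂ → N) (x : ℝ × ℂ) :
    famDiff g W x ^ 2 + famMixed g W x ^ 2 ≤ famEnergy g W x ^ 2 := by
  have h : famMixed g W x ^ 2
      ≤ pullback g W (0, 1) (0, 1) x * pullback g W (0, Complex.I) (0, Complex.I) x :=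
    innerAt_sq_le g _ _ _
  rw [famDiff, famEnergy]
  linarith

namespace LocalVariation

theorem contDiffOn_famEnergy (h : LocalVariation f V W O) (g : RMetric E N) :
    ContDiffOn ℝ ∞ (famEnergy g W) O :=
  ((contDiffOn_pullback g h.isOpen h.smooth _ _).add
    (contDiffOn_pullback g h.isOpen h.smooth _ _)).div_const 2

theorem contDiffOn_famDiff (h : LocalVariation f V W O) (g : RMetric E N) :
    ContDiffOn ℝ ∞ (famDiff g W) O :=
  ((contDiffOn_pullback g h.isOpen h.smooth _ _).sub
    (contDiffOn_pullback g h.isOpen h.smooth _ _)).div_const 2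

theorem contDiffOn_famMixed (h : LocalVariation f V W O) (g : RMetric E N) :
    ContDiffOn ℝ ∞ (famMixed g W) O :=
  contDiffOn_pullback g h.isOpen h.smooth _ _

theorem dt_famEnergy_apply (h : LocalVariation f V W O) (g : RMetric E N) {x : ℝ × ℂ}
    (hx : x ∈ O) : dt (famEnergy g W) x = (dt (pullback g W (0, 1) (0, 1)) x
      + dt (pullback g W (0, Complex.I) (0, Complex.I)) x) / 2 := by
  have h1 := (hasDerivAt_dt (contDiffOn_pullback g h.isOpen h.smooth (0, 1) (0, 1)) h.isOpen
    (t := x.1) (z := x.2) hx).add (hasDerivAt_dt (contDiffOn_pullback g h.isOpen h.smooth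
      (0, Complex.I) (0, Complex.I)) h.isOpen (t := x.1) (z := x.2) hx) |>.div_const 2
  exact (hasDerivAt_dt (h.contDiffOn_famEnergy g) h.isOpen (t := x.1) (z := x.2) hx).unique h1

theorem dt_famDiff_apply (h : LocalVariation f V W O) (g : RMetric E N) {x : ℝ × ℂ}
    (hx : x ∈ O) : dt (famDiff g W) x = (dt (pullback g W (0, 1) (0, 1)) x
      - dt (pullback g W (0, Complex.I) (0, Complex.I)) x) / 2 := by
  have h1 := (hasDerivAt_dt (contDiffOn_pullback g h.isOpen h.smooth (0, 1) (0, 1)) h.isOpen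
    (t := x.1) (z := x.2) hx).sub (hasDerivAt_dt (contDiffOn_pullback g h.isOpen h.smooth
      (0, Complex.I) (0, Complex.I)) h.isOpen (t := x.1) (z := x.2) hx) |>.div_const 2
  exact (hasDerivAt_dt (h.contDiffOn_famDiff g) h.isOpen (t := x.1) (z := x.2) hx).unique h1

theorem dt_dt_famEnergy_apply (h : LocalVariation f V W O) (g : RMetric E N) {t : ℝ} {z : ℂ}
    (hx : (t, z) ∈ O) : dt (dt (famEnergy g W)) (t, z)
      = (dt (dt (pullback g W (0, 1) (0, 1))) (t, z)
        + dt (dt (pullback g W (0, Complex.I) (0, Complex.I))) (t, z)) / 2 := by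
  have hs := fun a => contDiffOn_dt h.isOpen (contDiffOn_pullback g h.isOpen h.smooth a a)
  have h1 := ((hasDerivAt_dt (hs (0, 1)) h.isOpen hx).add
    (hasDerivAt_dt (hs (0, Complex.I)) h.isOpen hx)).div_const 2
  refine (hasDerivAt_dt (contDiffOn_dt h.isOpen (h.contDiffOn_famEnergy g)) h.isOpen hx).unique
    (h1.congr_of_eventuallyEq ?_)
  filter_upwards [eventually_slice_left h.isOpen hx] with s hs
  exact h.dt_famEnergy_apply g hs

theorem dt_famEnergy (h : LocalVariation f V W O) (g : RMetric E N) {z : ℂ} (hz : (0, z) ∈ O) :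
    dt (famEnergy g W) (0, z) = energyVarDensity g f V z := by
  rw [h.dt_famEnergy_apply g hz, h.dt_pullback g hz, h.dt_pullback g hz, energyVarDensity]

theorem famEnergy_zero (h : LocalVariation f V W O) (g : RMetric E N) {z : ℂ} (hz : (0, z) ∈ O) :
    famEnergy g W (0, z) = confFactor g f z := by
  rw [confFactor_eq, h.pullback_eq g hz, h.pullback_eq g hz, famEnergy]

theorem famDiff_zero (h : LocalVariation f V W O) (g : RMetric E N) {z : ℂ} (hz : (0, z) ∈ O)
    (hc : ConformalAt g f z) : famDiff g W (0, z) = 0 := by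
  have h1 := hc.1
  rw [h.pullback_eq g hz, h.pullback_eq g hz] at h1
  rw [famDiff, h1, sub_self, zero_div]

theorem famMixed_zero (h : LocalVariation f V W O) (g : RMetric E N) {z : ℂ} (hz : (0, z) ∈ O)
    (hc : ConformalAt g f z) : famMixed g W (0, z) = 0 := by
  have h1 := hc.2
  rwa [h.pullback_eq g hz] at h1

/-- The defect coefficient in terms of the first variation of the induced metric. -/
theorem defectCoeff_eq (h : LocalVariation f V W O) (g : RMetric E N) {z : ℂ} (hz : (0, z) ∈ O) :
    defectCoeff (famEnergy g W) (famDiff g W) (famMixed g W) z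
      = (((pullbackVar g f V 1 1 z - pullbackVar g f V Complex.I Complex.I z) / 2) ^ 2
        + pullbackVar g f V 1 Complex.I z ^ 2) / (2 * confFactor g f z) := by
  rw [defectCoeff, h.dt_famDiff_apply g hz, h.famEnergy_zero g hz, h.dt_pullback g hz,
    h.dt_pullback g hz, ← h.dt_pullback g hz 1 Complex.I]
  rfl

theorem pullback_slice (h : LocalVariation f V W O) (g : RMetric E N) {t : ℝ} {z : ℂ}
    (hz : (t, z) ∈ O) (ξ ζ : ℂ) :
    pullback g (fun w => W (t, w)) ξ ζ z = pullback g W (0, ξ) (0, ζ) (t, z) := by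
  rw [pullback, mapDeriv_slice_right (h.mdifferentiableAt hz),
    mapDeriv_slice_right (h.mdifferentiableAt hz), pullback]

theorem energyDensity_slice (h : LocalVariation f V W O) (g : RMetric E N) {t : ℝ} {z : ℂ}
    (hz : (t, z) ∈ O) : energyDensity g (fun w => W (t, w)) z = famEnergy g W (t, z) := by
  rw [famEnergy, ← h.pullback_slice g hz, ← h.pullback_slice g hz]
  rfl

theorem areaDensity_slice (h : LocalVariation f V W O) (g : RMetric E N) {t : ℝ} {z : ℂ}
    (hz : (t, z) ∈ O) : areaDensity g (fun w => W (t, w)) z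
      = √(famEnergy g W (t, z) ^ 2 - famDiff g W (t, z) ^ 2 - famMixed g W (t, z) ^ 2) := by
  have h1 : areaDensity g (fun w => W (t, w)) z
      = √(pullback g (fun w => W (t, w)) 1 1 z
        * pullback g (fun w => W (t, w)) Complex.I Complex.I z
        - pullback g (fun w => W (t, w)) 1 Complex.I z ^ 2) := rfl
  rw [h1, h.pullback_slice g hz, h.pullback_slice g hz, h.pullback_slice g hz, famEnergy, famDiff,
    famMixed]
  congr 1
  ring

end LocalVariation

end FamilyDensities

/-! ### Global families seen in charts. -/

section Families

variable {S : Type*} [TopologicalSpace S] [ChartedSpace ℂ S] [IsManifold 𝓘(ℂ, ℂ) ω S]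
  {E : Type*} [NormedAddCommGroup E] [NormedSpace ℝ E] [FiniteDimensional ℝ E]
  {N : Type*} [TopologicalSpace N] [ChartedSpace E N] [IsManifold 𝓘(ℝ, E) ∞ N]

/-- A family of maps in the preferred coordinate at `p`. -/
def famInChart (U : ℝ → S → N) (p : S) (x : ℝ × ℂ) : N := U x.1 ((chartAt ℂ p).symm x.2)

/-- A field along a map in the preferred coordinate at `p`. -/
def fieldInChart {u : S → N} (w : ∀ p, TangentSpace 𝓘(ℝ, E) (u p)) (p : S) (z : ℂ) : E :=
  w ((chartAt ℂ p).symm z)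

variable {u : S → N} {w : ∀ p, TangentSpace 𝓘(ℝ, E) (u p)} {U : ℝ → S → N}

theorem IsVariation.exists_localVariation (hU : IsVariation u w U) :
    ∃ δ > 0, ∀ p, LocalVariation (inChart u p) (fieldInChart w p) (famInChart U p)
      (Ioo (-δ) δ ×ˢ (chartAt ℂ p).target) := by
  have := isManifold_real S
  obtain ⟨δ, hδ, hs⟩ := hU.smooth
  refine ⟨δ, hδ, fun p => ?_⟩
  have hopen : IsOpen (Ioo (-δ) δ ×ˢ (chartAt ℂ p).target) :=
    isOpen_Ioo.prod (chartAt ℂ p).open_target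
  have hsm : ContMDiffOn 𝓘(ℝ, ℝ × ℂ) 𝓘(ℝ, E) ∞ (famInChart U p)
      (Ioo (-δ) δ ×ˢ (chartAt ℂ p).target) := by
    have h1 : ContMDiffOn 𝓘(ℝ, ℝ × ℂ) 𝓘(ℝ, ℝ) ∞ (fun x : ℝ × ℂ => x.1)
        (Ioo (-δ) δ ×ˢ (chartAt ℂ p).target) := contMDiffOn_iff_contDiffOn.2 contDiffOn_fst
    have h2 : ContMDiffOn 𝓘(ℝ, ℝ × ℂ) 𝓘(ℝ, ℂ) ∞ (fun x : ℝ × ℂ => x.2)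
        (Ioo (-δ) δ ×ˢ (chartAt ℂ p).target) := contMDiffOn_iff_contDiffOn.2 contDiffOn_snd
    have h3 : ContMDiffOn 𝓘(ℝ, ℝ × ℂ) 𝓘(ℝ, ℂ) ∞ (fun x : ℝ × ℂ => (chartAt ℂ p).symm x.2)
        (Ioo (-δ) δ ×ˢ (chartAt ℂ p).target) :=
      (contMDiffOn_chart_symm (I := 𝓘(ℝ, ℂ)) (n := ∞) (x := p)).comp h2 fun x hx => hx.2
    exact hs.comp (h1.prodMk h3) fun x hx => ⟨hx.1, mem_univ _⟩
  refine ⟨hopen, hsm, fun z _ => ?_, fun z hz => ?_⟩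
  · rw [famInChart, hU.initial, inChart]
  · rw [← mapDeriv_slice_left (mdifferentiableAt_of_contMDiffOn hopen hsm hz)]
    exact congrArg (fun y : TangentBundle 𝓘(ℝ, E) N => (y.2 : E))
      (hU.velocity ((chartAt ℂ p).symm z))

end Families

/-! ### Second order expansions of energy and area. -/

section Expansions

variable {S : Type*} [TopologicalSpace S] [T2Space S] [CompactSpace S] [ChartedSpace ℂ S]
  [IsManifold 𝓘(ℂ, ℂ) ω S]
  {E : Type*} [NormedAddCommGroup E] [NormedSpace ℝ E] [FiniteDimensional ℝ E]
  {N : Type*} [TopologicalSpace N] [ChartedSpace E N] [IsManifold 𝓘(ℝ, E) ∞ N]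
  {u : S → N} {w : ∀ p, TangentSpace 𝓘(ℝ, E) (u p)} {U : ℝ → S → N}

/-- The first variation of the energy. -/
def energyVar (g : RMetric E N) (u : S → N) (w : ∀ p, TangentSpace 𝓘(ℝ, E) (u p)) : ℝ :=
  surfaceIntegral fun p z => energyVarDensity g (inChart u p) (fieldInChart w p) z

/-- The second derivative of the energy along a family. -/
def energySecondDeriv (g : RMetric E N) (U : ℝ → S → N) : ℝ :=
  surfaceIntegral fun p z => dt (dt (famEnergy g (famInChart U p))) (0, z)

/-- The density of the quadratic part of the difference of energy and area along a family. -/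
def defectDensity (g : RMetric E N) (U : ℝ → S → N) (p : S) (z : ℂ) : ℝ :=
  defectCoeff (famEnergy g (famInChart U p)) (famDiff g (famInChart U p))
    (famMixed g (famInChart U p)) z

theorem IsVariation.energy_expansion (hU : IsVariation u w U) (g : RMetric E N) :
    (fun t => energy g (U t) - (energy g u + t * energyVar g u w
      + t ^ 2 * (energySecondDeriv g U / 2))) =o[𝓝 0] fun t : ℝ => t ^ 2 := by
  obtain ⟨δ, hδ, h⟩ := hU.exists_localVariation
  have h0 : (0 : ℝ) ∈ Ioo (-δ) δ := ⟨by linarith, hδ⟩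
  have key := surfaceIntegral_expansion (S := S)
    fun p => (isCutoff_chartCutoff p).smooth_expansion hδ ((h p).contDiffOn_famEnergy g)
  have e1 : ∀ t ∈ Ioo (-δ) δ, surfaceIntegral (fun p z => famEnergy g (famInChart U p) (t, z))
      = energy g (U t) := fun t ht =>
    surfaceIntegral_congr fun p z hz => ((h p).energyDensity_slice g ⟨ht, hz⟩).symm
  have e2 : surfaceIntegral (fun p z => dt (famEnergy g (famInChart U p)) (0, z))
      = energyVar g u w := surfaceIntegral_congr fun p z hz => (h p).dt_famEnergy g ⟨h0, hz⟩
  have e3 : surfaceIntegral (fun p z => dt (dt (famEnergy g (famInChart U p))) (0, z) / 2)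
      = energySecondDeriv g U / 2 := by
    rw [energySecondDeriv, div_eq_inv_mul, ← surfaceIntegral_const_mul]
    simp only [div_eq_inv_mul]
  have e4 := e1 0 h0
  rw [hU.initial] at e4
  refine key.congr' ?_ EventuallyEq.rfl
  filter_upwards [isOpen_Ioo.mem_nhds h0] with t ht
  rw [e1 t ht, e2, e3, e4]

theorem continuousOn_slice {φ : ℝ × ℂ → ℝ} {δ : ℝ} (hδ : 0 < δ) {T : Set ℂ}
    (hφ : ContDiffOn ℝ ∞ φ (Ioo (-δ) δ ×ˢ T)) : ContinuousOn (fun z => φ (0, z)) T :=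
  hφ.continuousOn.comp (Continuous.prodMk_right 0).continuousOn
    fun _ hz => ⟨⟨by linarith, hδ⟩, hz⟩

/-- The second order expansion of the area at an almost everywhere immersed conformal map. -/
theorem IsVariation.area_expansion (hU : IsVariation u w U) (g : RMetric E N)
    (hconf : ∀ p, ∀ z ∈ (chartAt ℂ p).target, ConformalAt g (inChart u p) z)
    (hpos : ∀ p : S, ∀ᵐ z ∂volume.restrict (chartAt ℂ p).target, 0 < confFactor g (inChart u p) z)
    (hint : SurfaceIntegrable (defectDensity g U)) :
    (fun t => area g (U t) - (area g u + t * energyVar g u w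
      + t ^ 2 * (energySecondDeriv g U / 2 - surfaceIntegral (defectDensity g U))))
        =o[𝓝 0] fun t : ℝ => t ^ 2 := by
  obtain ⟨δ, hδ, h⟩ := hU.exists_localVariation
  have h0 : (0 : ℝ) ∈ Ioo (-δ) δ := ⟨by linarith, hδ⟩
  have key := surfaceIntegral_expansion (S := S)
    fun p => (isCutoff_chartCutoff p).sqrt_expansion hδ ((h p).contDiffOn_famEnergy g)
      ((h p).contDiffOn_famDiff g) ((h p).contDiffOn_famMixed g)
      (fun x _ => famEnergy_nonneg g _ x) (fun x _ => famDiff_sq_add_le g _ x)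
      (fun z hz => (h p).famDiff_zero g ⟨h0, hz⟩ (hconf p z hz))
      (fun z hz => (h p).famMixed_zero g ⟨h0, hz⟩ (hconf p z hz)) (by
        filter_upwards [hpos p, ae_restrict_mem (chartAt ℂ p).open_target.measurableSet]
          with z hz hzT
        rwa [(h p).famEnergy_zero g ⟨h0, hzT⟩])
  have e1 : ∀ t ∈ Ioo (-δ) δ, surfaceIntegral (fun p z => √(famEnergy g (famInChart U p) (t, z) ^ 2
      - famDiff g (famInChart U p) (t, z) ^ 2 - famMixed g (famInChart U p) (t, z) ^ 2))
      = area g (U t) := fun t ht =>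
    surfaceIntegral_congr fun p z hz => ((h p).areaDensity_slice g ⟨ht, hz⟩).symm
  have e2 : surfaceIntegral (fun p z => dt (famEnergy g (famInChart U p)) (0, z))
      = energyVar g u w := surfaceIntegral_congr fun p z hz => (h p).dt_famEnergy g ⟨h0, hz⟩
  have hc : SurfaceIntegrable fun (p : S) z => dt (dt (famEnergy g (famInChart U p))) (0, z) / 2 :=
    surfaceIntegrable_of_continuousOn fun p => (continuousOn_slice hδ (contDiffOn_dt (h p).isOpen
      (contDiffOn_dt (h p).isOpen ((h p).contDiffOn_famEnergy g)))).div_const 2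
  have e3 : surfaceIntegral (fun p z => dt (dt (famEnergy g (famInChart U p))) (0, z) / 2
      - defectDensity g U p z)
      = energySecondDeriv g U / 2 - surfaceIntegral (defectDensity g U) := by
    refine (surfaceIntegral_sub hc hint).trans ?_
    rw [energySecondDeriv, div_eq_inv_mul, ← surfaceIntegral_const_mul]
    simp only [div_eq_inv_mul]
  have e4 := e1 0 h0
  rw [hU.initial] at e4
  refine key.congr' ?_ EventuallyEq.rfl
  filter_upwards [isOpen_Ioo.mem_nhds h0] with t ht
  rw [e1 t ht, e2, e4]
  simp only [← e3]
  rfl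

end Expansions

/-! ### Boundedness and integrability of the conformal defect. -/

section LocalDefect

variable {E : Type*} [NormedAddCommGroup E] [NormedSpace ℝ E] [FiniteDimensional ℝ E]
  {N : Type*} [TopologicalSpace N] [ChartedSpace E N] [IsManifold 𝓘(ℝ, E) ∞ N]

/-- The conformal defect of a field along a conformal map, in terms of the first variation of the
induced metric. -/
def metricDefect (g : RMetric E N) (f : ℂ → N) (V : ℂ → E) (z : ℂ) : ℝ :=
  (((pullbackVar g f V 1 1 z - pullbackVar g f V Complex.I Complex.I z) / 2) ^ 2
    + pullbackVar g f V 1 Complex.I z ^ 2) / (8 * confFactor g f z)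

variable {f : ℂ → N} {V : ℂ → E} {T : Set ℂ}

theorem continuousAt_slice {φ : ℝ × ℂ → ℝ} {O : Set (ℝ × ℂ)} (hO : IsOpen O)
    (hφ : ContDiffOn ℝ ∞ φ O) {z : ℂ} (hz : (0, z) ∈ O) : ContinuousAt (fun w => φ (0, w)) z :=
  ContinuousAt.comp (g := φ) (hφ.continuousOn.continuousAt (hO.mem_nhds hz))
    (Continuous.prodMk_right 0).continuousAt

theorem continuousOn_confFactor (hV : ∀ z ∈ T, ∃ W O, LocalVariation f V W O ∧ (0, z) ∈ O) (g : RMetric E N) :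
    ContinuousOn (confFactor g f) T := by
  refine fun z hz => ContinuousAt.continuousWithinAt ?_
  obtain ⟨W, O, h, hzO⟩ := hV z hz
  refine (continuousAt_slice h.isOpen (h.contDiffOn_famEnergy g) hzO).congr ?_
  filter_upwards [eventually_slice_right h.isOpen hzO] with w hw
  exact h.famEnergy_zero g hw

theorem continuousOn_pullbackVar (hV : ∀ z ∈ T, ∃ W O, LocalVariation f V W O ∧ (0, z) ∈ O) (g : RMetric E N) (ξ ζ : ℂ) :
    ContinuousOn (pullbackVar g f V ξ ζ) T := by
  refine fun z hz => ContinuousAt.continuousWithinAt ?_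
  obtain ⟨W, O, h, hzO⟩ := hV z hz
  refine (continuousAt_slice h.isOpen (contDiffOn_dt h.isOpen
    (contDiffOn_pullback g h.isOpen h.smooth (0, ξ) (0, ζ))) hzO).congr ?_
  filter_upwards [eventually_slice_right h.isOpen hzO] with w hw
  exact h.dt_pullback g hw ξ ζ

/-- The factor 4 compares the denominator 2e of the area expansion with the denominator 8e of |η|².
-/
theorem LocalVariation.defectCoeff_eq_metricDefect {W : ℝ × ℂ → N} {O : Set (ℝ × ℂ)}
    (h : LocalVariation f V W O) (g : RMetric E N) {z : ℂ} (hz : (0, z) ∈ O) :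
    defectCoeff (famEnergy g W) (famDiff g W) (famMixed g W) z = 4 * metricDefect g f V z := by
  rw [h.defectCoeff_eq g hz, metricDefect, mul_div_assoc', show
    8 * confFactor g f z = 4 * (2 * confFactor g f z) by ring, mul_div_mul_left _ _ four_ne_zero]

/-- The conformal defect is bounded on compact sets, also near branch points. -/
theorem exists_metricDefect_bound (hT : IsOpen T)
    (hV : ∀ z ∈ T, ∃ W O, LocalVariation f V W O ∧ (0, z) ∈ O) (g : RMetric E N)
    (hconf : ∀ z ∈ T, ConformalAt g f z) {K : Set ℂ} (hK : IsCompact K) (hKT : K ⊆ T) :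
    ∃ C, ∀ z ∈ K, |metricDefect g f V z| ≤ C := by
  -- Variations with velocity V are available only near each point, so the bound is local and
  -- compactness collects finitely many of them.
  refine hK.induction_on (p := fun s => ∃ C, ∀ z ∈ s, |metricDefect g f V z| ≤ C)
    ⟨0, fun z hz => hz.elim⟩ (fun s t hst ⟨C, hC⟩ => ⟨C, fun z hz => hC z (hst hz)⟩)
    (fun s t ⟨C, hC⟩ ⟨D, hD⟩ => ⟨max C D, fun z hz => ?_⟩) fun z hz => ?_
  · rcases hz with hz | hz
    · exact (hC z hz).trans (le_max_left _ _)
    · exact (hD z hz).trans (le_max_right _ _)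
  · obtain ⟨W, O, h, hzO⟩ := hV z (hKT hz)
    obtain ⟨B, hB, hBs, hBc⟩ := local_compact_nhds
      (inter_mem (hT.mem_nhds (hKT hz)) (eventually_slice_right h.isOpen hzO))
    obtain ⟨r, -, C, hC⟩ := exists_defect_bound h.isOpen (h.contDiffOn_famEnergy g)
      (h.contDiffOn_famDiff g) (h.contDiffOn_famMixed g)
      (fun x _ => famEnergy_nonneg g _ x) (fun x _ => famDiff_sq_add_le g _ x) hBc
      (fun z hz => (hBs hz).2)
      (fun z hz => h.famDiff_zero g (hBs hz).2 (hconf z (hBs hz).1))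
      (fun z hz => h.famMixed_zero g (hBs hz).2 (hconf z (hBs hz).1))
    refine ⟨B, mem_nhdsWithin_of_mem_nhds hB, C / 4, fun w hw => ?_⟩
    have h1 := (hC w hw).1
    rw [h.defectCoeff_eq_metricDefect g (hBs hw).2, abs_mul, abs_of_pos (four_pos (α := ℝ))] at h1
    linarith

/-- The defect need not be continuous at branch points; it is measurable as a quotient of continuous
functions. -/
theorem aestronglyMeasurable_metricDefect (hT : IsOpen T)
    (hV : ∀ z ∈ T, ∃ W O, LocalVariation f V W O ∧ (0, z) ∈ O) (g : RMetric E N) :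
    AEStronglyMeasurable (metricDefect g f V) (volume.restrict T) := by
  have m := fun ξ ζ => ((continuousOn_pullbackVar hV g ξ ζ).aestronglyMeasurable (μ := volume)
    hT.measurableSet).aemeasurable
  exact ((((((m 1 1).sub (m Complex.I Complex.I)).div_const 2).pow_const 2).add
    ((m 1 Complex.I).pow_const 2)).div (((continuousOn_confFactor hV g).aestronglyMeasurable
      (μ := volume) hT.measurableSet).aemeasurable.const_mul 8)).aestronglyMeasurable

theorem IsCutoff.integrableOn_metricDefect {ρ : ℂ → ℝ} {K : Set ℂ} (h : IsCutoff ρ T K)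
    (hV : ∀ z ∈ T, ∃ W O, LocalVariation f V W O ∧ (0, z) ∈ O) (g : RMetric E N)
    (hconf : ∀ z ∈ T, ConformalAt g f z) :
    IntegrableOn (fun z => ρ z * metricDefect g f V z) T := by
  obtain ⟨C, hC⟩ := exists_metricDefect_bound h.isOpen hV g hconf h.isCompact h.subset
  exact h.integrableOn_of_bound (aestronglyMeasurable_metricDefect h.isOpen hV g) hC

end LocalDefect

/-! ### Branched conformal immersions in charts. -/

section Branched

variable {S : Type*} [TopologicalSpace S] [ChartedSpace ℂ S] [IsManifold 𝓘(ℂ, ℂ) ω S]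
  {E : Type*} [NormedAddCommGroup E] [NormedSpace ℝ E] [FiniteDimensional ℝ E]
  {N : Type*} [TopologicalSpace N] [ChartedSpace E N] [IsManifold 𝓘(ℝ, E) ∞ N]
  {g : RMetric E N} {u : S → N}

namespace IsBranchedConformalImmersion

/-- Passing from the preferred chart at the image point to the chart at p composes du with
multiplication by some c ≠ 0, which multiplies the conformal factor by |c|². At branch points the
factor is 0, so conformality holds there too. -/
theorem exists_pullback_inChart (hu : IsBranchedConformalImmersion g u) (p : S) {z : ℂ}
    (hz : z ∈ (chartAt ℂ p).target) :
    ∃ r : ℝ, 0 ≤ r ∧ (r = 0 ↔ (chartAt ℂ p).symm z ∈ branchSet E u) ∧ ∀ ξ ζ : ℂ,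
      pullback g (inChart u p) ξ ζ z = r * (ξ * (starRingEnd ℂ) ζ).re := by
  obtain ⟨c, hc, h⟩ := mapDeriv_inChart (E := E) p hz
    (hu.smooth.mdifferentiable (by simp) ((chartAt ℂ p).symm z))
  by_cases hB : (chartAt ℂ p).symm z ∈ branchSet E u
  · refine ⟨0, le_rfl, by simp [hB], fun ξ ζ => ?_⟩
    have h0 : mapDeriv E (inChart u p) z ξ = 0 :=
      (h ξ).trans (DFunLike.congr_fun (show (mfderiv 𝓘(ℝ, ℂ) 𝓘(ℝ, E) u
        ((chartAt ℂ p).symm z) : ℂ →L[ℝ] E) = 0 from hB) _)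
    rw [pullback, h0]
    simp
  · obtain ⟨r, hr, hconf⟩ := hu.conformal _ hB
    have hc' : 0 < Complex.normSq c := Complex.normSq_pos.2 hc
    refine ⟨r * Complex.normSq c, by positivity, by simp [hB, hc, hr.ne'], fun ξ ζ => ?_⟩
    rw [pullback, h, h]
    refine (hconf (c * ξ) (c * ζ)).trans ?_
    rw [map_mul, mul_mul_mul_comm, Complex.mul_conj, Complex.re_ofReal_mul, mul_assoc]

theorem conformalAt_inChart (hu : IsBranchedConformalImmersion g u) (p : S) {z : ℂ}
    (hz : z ∈ (chartAt ℂ p).target) : ConformalAt g (inChart u p) z := by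
  obtain ⟨r, -, -, h⟩ := hu.exists_pullback_inChart p hz
  exact ⟨by simp [h], by simp [h]⟩

theorem confFactor_inChart (hu : IsBranchedConformalImmersion g u) (p : S) {z : ℂ}
    (hz : z ∈ (chartAt ℂ p).target) : 0 ≤ confFactor g (inChart u p) z ∧
      (confFactor g (inChart u p) z = 0 ↔ (chartAt ℂ p).symm z ∈ branchSet E u) := by
  obtain ⟨r, hr, hB, h⟩ := hu.exists_pullback_inChart p hz
  have : confFactor g (inChart u p) z = r := by
    rw [confFactor_eq, h, h]
    simp
  rw [this]
  exact ⟨hr, hB⟩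

/-- A compact surface is second countable, so its discrete subsets are countable; this is enough for
the branch set to be a null set. -/
theorem countable_branchSet [CompactSpace S] (hu : IsBranchedConformalImmersion g u) :
    (branchSet E u).Countable := by
  have : SecondCountableTopology S := ChartedSpace.secondCountable_of_sigmaCompact ℂ S
  have : DiscreteTopology (branchSet E u) := isDiscrete_iff_discreteTopology.1 hu.discrete
  exact countable_of_Lindelof_of_discrete (X := branchSet E u)

theorem ae_confFactor_pos [CompactSpace S] (hu : IsBranchedConformalImmersion g u) (p : S) :
    ∀ᵐ z ∂volume.restrict (chartAt ℂ p).target, 0 < confFactor g (inChart u p) z := by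
  have hcount : ((chartAt ℂ p).target ∩ (chartAt ℂ p).symm ⁻¹' branchSet E u).Countable := by
    refine (hu.countable_branchSet.image (chartAt ℂ p)).mono fun z hz => ?_
    exact ⟨_, hz.2, (chartAt ℂ p).right_inv hz.1⟩
  filter_upwards [ae_restrict_mem (chartAt ℂ p).open_target.measurableSet,
    ae_restrict_of_ae (hcount.ae_notMem volume)] with z hz hzB
  obtain ⟨h1, h2⟩ := hu.confFactor_inChart p hz
  exact h1.lt_of_ne fun h0 => hzB ⟨hz, h2.1 h0.symm⟩

end IsBranchedConformalImmersion

variable {v σ s : ∀ p, TangentSpace 𝓘(ℝ, E) (u p)}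

theorem exists_localVariation_inChart
    (hv : ContMDiff 𝓘(ℝ, ℂ) 𝓘(ℝ, E).tangent ∞
      (fun p => (⟨u p, v p⟩ : TangentBundle 𝓘(ℝ, E) N))) (p : S) :
    ∀ z ∈ (chartAt ℂ p).target, ∃ W O,
      LocalVariation (inChart u p) (fieldInChart v p) W O ∧ (0, z) ∈ O := by
  have := isManifold_real S
  exact fun z hz => exists_localVariation (chartAt ℂ p).open_target
    (hv.comp_contMDiffOn (contMDiffOn_chart_symm (I := 𝓘(ℝ, ℂ)) (n := ∞) (x := p))) hz

/-- The conformal defect `|η|²` of a field along a branched conformal immersion in terms of the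
first variation of the induced metric. -/
theorem etaDensity_eq_metricDefect (hu : IsBranchedConformalImmersion g u)
    (hv : ContMDiff 𝓘(ℝ, ℂ) 𝓘(ℝ, E).tangent ∞
      (fun p => (⟨u p, v p⟩ : TangentBundle 𝓘(ℝ, E) N)))
    (hσs : IsTangentNormalDecomposition g u v σ s) (p : S) {z : ℂ}
    (hz : z ∈ (chartAt ℂ p).target) :
    etaDensity g u σ s p z = metricDefect g (inChart u p) (fieldInChart v p) z := by
  have hT := (chartAt ℂ p).open_target
  have hV := exists_localVariation_inChart hv p
  obtain ⟨hnonneg, hiff⟩ := hu.confFactor_inChart p hz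
  rcases hnonneg.eq_or_lt with h0 | hpos
  · rw [metricDefect, ← h0, mul_zero, div_zero]
    exact cnormSq_eta_of_confFactor_eq_zero g (inChart u p) (fieldInChart σ p) (fieldInChart s p) z
      h0.symm
  · obtain ⟨W, O, h, hzO⟩ := hV z hz
    have hmd : ∀ q : S, MDifferentiableAt 𝓘(ℝ, ℂ) 𝓘(ℝ, E) u q := hu.smooth.mdifferentiable (by simp)
    refine h.cnormSq_eta g hzO (σ := fieldInChart σ p) (s := fieldInChart s p)
      (Eventually.of_forall fun w => hσs.sum _) ?_ ?_ ?_ hpos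
    · have hev : ∀ᶠ w in 𝓝 z, 0 < confFactor g (inChart u p) w :=
        ((continuousOn_confFactor hV g).continuousAt (hT.mem_nhds hz)).eventually_const_lt hpos
      filter_upwards [hev, hT.mem_nhds hz] with w hw hwT ξ
      obtain ⟨c, -, hc⟩ := mapDeriv_inChart (E := E) p hwT (hmd _)
      rw [innerDeriv, hc]
      exact hσs.normal _ (fun hB => hw.ne' ((hu.confFactor_inChart p hwT).2.2 hB)) _
    · obtain ⟨c, hc0, hc⟩ := mapDeriv_inChart (E := E) p hz (hmd _)
      -- The coordinate map has differential ξ ↦ du(cξ), so σ = du(a) is its value at a/c.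
      obtain ⟨a, ha⟩ := hσs.tangential _ (fun hB => hpos.ne' (hiff.2 hB))
      refine ⟨(a / c).re, (a / c).im, ?_⟩
      rw [← map_smul, ← map_smul, ← map_add]
      have e1 : (a / c).re • (1 : ℂ) + (a / c).im • Complex.I = a / c := by
        simp [Complex.re_add_im]
      rw [e1, hc, mul_div_cancel₀ _ hc0]
      exact ha
    · filter_upwards [hT.mem_nhds hz] with w hw
      exact hu.conformalAt_inChart p hw

/-- The weights |dz|² = 2e^{-2λ} and e^{2λ} multiply to 2; at branch points both densities are 0 by
convention. -/
theorem muDensity_eq (g : RMetric E N) (σ s : ∀ p, TangentSpace 𝓘(ℝ, E) (u p)) (p : S) (z : ℂ) :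
    muDensity g u σ s p z = 2 * etaDensity g u σ s p z := by
  by_cases h0 : confFactor g (inChart u p) z = 0
  · have h1 : etaDensity g u σ s p z = 0 := cnormSq_eta_of_confFactor_eq_zero g (inChart u p)
      (fieldInChart σ p) (fieldInChart s p) z h0
    rw [muDensity, h0, h1, mul_zero, mul_zero]
  · have h1 : muDensity g u σ s p z = etaDensity g u σ s p z
      * (2 / confFactor g (inChart u p) z) * confFactor g (inChart u p) z := rfl
    rw [h1, mul_assoc, div_mul_cancel₀ _ h0, mul_comm]

end Branched

/-! ### First variations, and the Hessian of the energy. -/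

section SecondVariation

variable {S : Type*} [TopologicalSpace S] [T2Space S] [CompactSpace S] [ChartedSpace ℂ S]
  [IsManifold 𝓘(ℂ, ℂ) ω S]
  {E : Type*} [NormedAddCommGroup E] [NormedSpace ℝ E] [FiniteDimensional ℝ E]
  {N : Type*} [TopologicalSpace N] [ChartedSpace E N] [IsManifold 𝓘(ℝ, E) ∞ N]
  {g : RMetric E N} {u : S → N} {v w : ∀ p, TangentSpace 𝓘(ℝ, E) (u p)}

theorem surfaceIntegrable_congr {d d' : S → ℂ → ℝ} (h : SurfaceIntegrable d)
    (hd : ∀ p, ∀ z ∈ (chartAt ℂ p).target, d p z = d' p z) : SurfaceIntegrable d' := fun p =>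
  IntegrableOn.congr_fun (h p) (fun z hz => by simp only [hd p z hz])
    (chartAt ℂ p).open_target.measurableSet

theorem SurfaceIntegrable.const_mul {d : S → ℂ → ℝ} (h : SurfaceIntegrable d) (c : ℝ) :
    SurfaceIntegrable fun p z => c * d p z := fun p => by
  refine (Integrable.const_mul (h p) c).congr (Eventually.of_forall fun z => ?_)
  simp only [mul_left_comm]

theorem IsBranchedConformalImmersion.surfaceIntegrable_metricDefect
    (hu : IsBranchedConformalImmersion g u)
    (hw : ∀ p, ∀ z ∈ (chartAt ℂ p).target, ∃ W O,
      LocalVariation (inChart u p) (fieldInChart w p) W O ∧ (0, z) ∈ O) :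
    SurfaceIntegrable fun p z => metricDefect g (inChart u p) (fieldInChart w p) z := fun p =>
  (isCutoff_chartCutoff p).integrableOn_metricDefect (hw p) g
    fun _ hz => hu.conformalAt_inChart p hz

namespace IsVariation

variable {U U₁ U₂ : ℝ → S → N}

/-- The second order expansion of the area at a branched conformal immersion. -/
theorem area_expansion_of_conformal (hU : IsVariation u w U)
    (hu : IsBranchedConformalImmersion g u) :
    (fun t => area g (U t) - (area g u + t * energyVar g u w
      + t ^ 2 * (energySecondDeriv g U / 2 - 4 * surfaceIntegral fun p z =>
        metricDefect g (inChart u p) (fieldInChart w p) z))) =o[𝓝 0] fun t : ℝ => t ^ 2 := by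
  obtain ⟨δ, hδ, h⟩ := hU.exists_localVariation
  have h0 : (0 : ℝ) ∈ Ioo (-δ) δ := ⟨by linarith, hδ⟩
  have heq : ∀ p, ∀ z ∈ (chartAt ℂ p).target,
      4 * metricDefect g (inChart u p) (fieldInChart w p) z = defectDensity g U p z :=
    fun p z hz => ((h p).defectCoeff_eq_metricDefect g ⟨h0, hz⟩).symm
  have hint := hu.surfaceIntegrable_metricDefect (w := w) fun p z hz => ⟨_, _, h p, h0, hz⟩
  rw [← surfaceIntegral_const_mul, surfaceIntegral_congr heq]
  exact hU.area_expansion g (fun p z hz => hu.conformalAt_inChart p hz) hu.ae_confFactor_pos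
    (surfaceIntegrable_congr (hint.const_mul 4) heq)

/-- The second derivatives of the energy along two families with the same velocity differ by the
first variation in the direction of the difference of the accelerations. -/
theorem energySecondDeriv_sub (h₁ : IsVariation u v U₁) (h₂ : IsVariation u v U₂) {W₁ W₂ : ℝ → S → N}
    (k₁ : IsVariation (U₁ 0) (acceleration g U₁) W₁)
    (k₂ : IsVariation (U₂ 0) (acceleration g U₂) W₂) :
    energySecondDeriv g U₁ - energyVar g (U₁ 0) (acceleration g U₁)
      = energySecondDeriv g U₂ - energyVar g (U₂ 0) (acceleration g U₂) := by
  obtain ⟨δ₁, hδ₁, l₁⟩ := h₁.exists_localVariation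
  obtain ⟨δ₂, hδ₂, l₂⟩ := h₂.exists_localVariation
  obtain ⟨ε₁, hε₁, m₁⟩ := k₁.exists_localVariation
  obtain ⟨ε₂, hε₂, m₂⟩ := k₂.exists_localVariation
  have h0 : ∀ {δ : ℝ}, 0 < δ → (0 : ℝ) ∈ Ioo (-δ) δ := fun h => ⟨by linarith, h⟩
  have i₁ : ∀ p, inChart (U₁ 0) p = inChart u p := fun p => by rw [h₁.initial]
  have i₂ : ∀ p, inChart (U₂ 0) p = inChart u p := fun p => by rw [h₂.initial]
  have second : ∀ {U : ℝ → S → N} {δ : ℝ} (_ : 0 < δ) (_ : ∀ p, LocalVariation (inChart u p)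
      (fieldInChart v p) (famInChart U p) (Ioo (-δ) δ ×ˢ (chartAt ℂ p).target)),
      SurfaceIntegrable fun (p : S) z => dt (dt (famEnergy g (famInChart U p))) (0, z) :=
    fun hδ l => surfaceIntegrable_of_continuousOn fun p => continuousOn_slice hδ
      (contDiffOn_dt (l p).isOpen (contDiffOn_dt (l p).isOpen ((l p).contDiffOn_famEnergy g)))
  have first : ∀ {u' : S → N} {a : ∀ p, TangentSpace 𝓘(ℝ, E) (u' p)} {W : ℝ → S → N} {ε : ℝ}
      (_ : 0 < ε) (_ : ∀ p, LocalVariation (inChart u' p) (fieldInChart a p) (famInChart W p)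
        (Ioo (-ε) ε ×ˢ (chartAt ℂ p).target)),
      SurfaceIntegrable fun (p : S) z => energyVarDensity g (inChart u' p) (fieldInChart a p) z :=
    fun hε l => surfaceIntegrable_congr (surfaceIntegrable_of_continuousOn fun p =>
      continuousOn_slice hε (contDiffOn_dt (l p).isOpen ((l p).contDiffOn_famEnergy g)))
      fun p z hz => (l p).dt_famEnergy g ⟨h0 hε, hz⟩
  rw [energySecondDeriv, energySecondDeriv, energyVar, energyVar,
    ← surfaceIntegral_sub (second hδ₁ l₁) (first hε₁ m₁),
    ← surfaceIntegral_sub (second hδ₂ l₂) (first hε₂ m₂)]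
  refine surfaceIntegral_congr fun p z hz => ?_
  have m₁' := m₁ p
  have m₂' := m₂ p
  rw [← m₁'.dt_famEnergy g ⟨h0 hε₁, hz⟩, ← m₂'.dt_famEnergy g ⟨h0 hε₂, hz⟩]
  have c₁ : LocalVariation (inChart u p) (fieldInChart (acceleration g U₁) p) (famInChart W₁ p)
    (Ioo (-ε₁) ε₁ ×ˢ (chartAt ℂ p).target) := i₁ p ▸ m₁'
  have c₂ : LocalVariation (inChart u p) (fieldInChart (acceleration g U₂) p) (famInChart W₂ p)
    (Ioo (-ε₂) ε₂ ×ˢ (chartAt ℂ p).target) := i₂ p ▸ m₂'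
  have key := LocalVariation.dt_dt_pullback_sub (l₁ p) (l₂ p) c₁ c₂ g (z := z) ⟨h0 hδ₁, hz⟩
    ⟨h0 hδ₂, hz⟩ ⟨h0 hε₁, hz⟩ ⟨h0 hε₂, hz⟩ (Eventually.of_forall fun w => rfl)
  have key1 := key 1
  have key2 := key Complex.I
  rw [(l₁ p).dt_dt_famEnergy_apply g ⟨h0 hδ₁, hz⟩, (l₂ p).dt_dt_famEnergy_apply g ⟨h0 hδ₂, hz⟩,
    c₁.dt_famEnergy_apply g ⟨h0 hε₁, hz⟩, c₂.dt_famEnergy_apply g ⟨h0 hε₂, hz⟩]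
  linarith

end IsVariation

theorem isFirstVariation_energy (g : RMetric E N) (w : ∀ p, TangentSpace 𝓘(ℝ, E) (u p)) :
    IsFirstVariation (energy g) u w (energyVar g u w) := fun _ hU =>
  hasDerivAt_of_expansion (hU.energy_expansion g)

/-- Area and energy differ by a term of order t² along any family from a conformal map, so the area
inherits the first variation of the energy. -/
theorem IsBranchedConformalImmersion.isFirstVariation_area (hu : IsBranchedConformalImmersion g u)
    (w : ∀ p, TangentSpace 𝓘(ℝ, E) (u p)) :
    IsFirstVariation (area g) u w (energyVar g u w) := fun _ hU =>
  hasDerivAt_of_expansion (hU.area_expansion_of_conformal hu)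

/-- The second variation of the energy, expressed by the second derivatives along families. -/
theorem exists_energyHessian (g : RMetric E N) (u : S → N) (v : ∀ p, TangentSpace 𝓘(ℝ, E) (u p)) :
    ∃ Q : ℝ, ∀ U W, IsVariation u v U → IsVariation (U 0) (acceleration g U) W →
      energySecondDeriv g U - Q = energyVar g (U 0) (acceleration g U) := by
  -- Q is read off from any one family whose acceleration is itself the velocity of a family. If
  -- there is none, the condition is vacuous and every Q serves, so the exponential map is not
  -- needed.
  by_cases h : ∃ U W, IsVariation u v U ∧ IsVariation (U 0) (acceleration g U) W
  · obtain ⟨U₀, W₀, h₀, k₀⟩ := h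
    refine ⟨energySecondDeriv g U₀ - energyVar g (U₀ 0) (acceleration g U₀), fun U W hU hW => ?_⟩
    have := hU.energySecondDeriv_sub h₀ hW k₀
    linarith
  · exact ⟨0, fun U W hU hW => (h ⟨U, W, hU, hW⟩).elim⟩

end SecondVariation

end

end ConfVar

theorem theorem2p1
    {S : Type*} [TopologicalSpace S] [T2Space S] [CompactSpace S] [ChartedSpace ℂ S]
    [IsManifold 𝓘(ℂ, ℂ) ω S]
    {E : Type*} [NormedAddCommGroup E] [NormedSpace ℝ E] [FiniteDimensional ℝ E]
    {N : Type*} [TopologicalSpace N] [T2Space N] [CompactSpace N] [ChartedSpace E N]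
    [IsManifold 𝓘(ℝ, E) ∞ N]
    (g : ConfVar.RMetric E N)
    (u : S → N) (hu : ConfVar.IsBranchedConformalImmersion g u)
    (v : ∀ p, TangentSpace 𝓘(ℝ, E) (u p))
    (hv : ContMDiff 𝓘(ℝ, ℂ) 𝓘(ℝ, E).tangent ∞
      (fun p => (⟨u p, v p⟩ : TangentBundle 𝓘(ℝ, E) N)))
    (σ s : ∀ p, TangentSpace 𝓘(ℝ, E) (u p))
    (hσs : ConfVar.IsTangentNormalDecomposition g u v σ s) :
    ConfVar.SurfaceIntegrable (ConfVar.etaDensity g u σ s) ∧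
    ConfVar.SurfaceIntegrable (ConfVar.muDensity g u σ s) ∧
    ∃ QA QE : ℝ,
      ConfVar.IsSecondVariation g (ConfVar.area g) u v QA ∧
      ConfVar.IsSecondVariation g (ConfVar.energy g) u v QE ∧
      QA = QE - 8 * ConfVar.surfaceIntegral (ConfVar.etaDensity g u σ s) ∧
      QA = QE - 4 * ConfVar.surfaceIntegral (ConfVar.muDensity g u σ s) := by
  have heta := fun p z hz => ConfVar.etaDensity_eq_metricDefect hu hv hσs p (z := z) hz
  have hint : ConfVar.SurfaceIntegrable (ConfVar.etaDensity g u σ s) :=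
    ConfVar.surfaceIntegrable_congr (hu.surfaceIntegrable_metricDefect
      (ConfVar.exists_localVariation_inChart hv)) fun p z hz => (heta p z hz).symm
  have hmu : ConfVar.muDensity g u σ s = fun p z => 2 * ConfVar.etaDensity g u σ s p z := by
    funext p z
    exact ConfVar.muDensity_eq g σ s p z
  obtain ⟨Q, hQ⟩ := ConfVar.exists_energyHessian g u v
  refine ⟨hint, hmu ▸ hint.const_mul 2, Q - 8 * ConfVar.surfaceIntegral
    (ConfVar.etaDensity g u σ s), Q, fun U hU => ?_, fun U hU => ?_, rfl, ?_⟩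
  · have hu0 : ConfVar.IsBranchedConformalImmersion g (U 0) := hU.initial.symm ▸ hu
    -- The acceleration term L' is defined as what is left of the second derivative after Q. It has
    -- to equal the first variation only when some family W tests it, and then `hQ` applies.
    refine ⟨ConfVar.energyVar g u v, ConfVar.energySecondDeriv g U - Q,
      hu.isFirstVariation_area v, fun W hW => ?_, ?_⟩
    · rw [hQ U W hU hW]
      exact hu0.isFirstVariation_area _ W hW
    · refine (hU.area_expansion_of_conformal hu).congr_left fun t => ?_
      rw [ConfVar.surfaceIntegral_congr heta]
      ring
  · refine ⟨ConfVar.energyVar g u v, ConfVar.energySecondDeriv g U - Q,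
      ConfVar.isFirstVariation_energy g v, fun W hW => ?_, ?_⟩
    · rw [hQ U W hU hW]
      exact ConfVar.isFirstVariation_energy g _ W hW
    · refine (hU.energy_expansion g).congr_left fun t => ?_
      ring
  · rw [hmu, ConfVar.surfaceIntegral_const_mul]
    ring
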